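/- Let $K$ be a principal ideal domain. **Definitions.** A *path pair of sets* $S=(X,Y)$ is a simplicial set $X$ together with subsets $Y_n\subseteq X_n$ $(n\ge 0)$ closed under all degeneracy maps $s_i$ and under the exterior face maps $d_0,d_n:X_n\to X_{n-1}$. For a chain complex $C$ and graded submodule $D\subseteq C$, $\omega(C,D)\subseteq C$ is the subcomplex with $\omega(C,D)_n=D_n\cap\partial^{-1}(D_{n-1})$ (and $\omega(C,D)_0=D_0$). For a simplicial $K$-module $A$, $N A$ is the normalized complex: $A_n$ modulo degenerate elements, with $\partial=\sum_i(-1)^id_i$. Put $\Omega S=\omega(N K[X],\overline{K[Y]})$, where $\overline{K[Y]}_n$ is the image of $K[Y_n]$ in $N_nK[X]$, and $H_n(S)=H_n(\Omega S)$. The box product is $(X,Y)\square(X',Y')=(X\times X',Y\diamond Y')$ with $$(Y\diamond Y')_n=\bigcup_{k+l=n}\ \bigcup_{(\mu,\nu)} s_\mu(Y_k)\times s_\nu(Y'_l),$$ where $(\mu,\nu)$ runs over all $(l,k)$-shuffles: strictly increasing sequences $\mu=(\mu_0,\dots,\mu_{l-1})$, $\nu=(\nu_0,\dots,\nu_{k-1})$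 with $\{\mu_i\}\cup\{\nu_j\}=\{0,\dots,n-1\}$; here $s_\mu$ is induced by the order-preserving surjection $[n]\to[k]$ identifying $j$ and $j+1$ exactly for $j\in\mu$, and similarly $s_\nu$. A *regular path complex* $P$ on a set $V$ consists of sets $P_n\subseteq V^{n+1}$ of sequences with $v_i\neq v_{i+1}$ for all $i$, closed under deleting the first and the last vertex. Put $\Omega P=\omega(N K[\mathrm{cosk}_0V],\mathcal A(P))$, where $(\mathrm{cosk}_0V)_n=V^{n+1}$ and $\mathcal A_n(P)$ is spanned by the classes of the elements of $P_n$. For regular path complexes $P$ on $V$ and $P'$ on $V'$, $P\square_{\rm reg}P'$ is the regular path complex on $V\times V'$ of all sequences $((v_i,v'_i))_{0\le i\le n}$ with $(v_i,v_i')\ne(v_{i+1},v'_{i+1})$, with $v_i=v_{i+1}$ or $v'_i=v'_{i+1}$ for every $i<n$, and such that $v$ and $v'$ become, after deleting consecutive repetitions, elements of some $P_k$ and some $P'_l$ respectively. **Theorem.** (1) For any two path pairs of sets $S,S'$ there is an isomorphism of chain complexes of $K$-modules $$\Omega(S\square S')\cong\Omega S\otimes_K\Omega S'.$$ (2) For any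 two path pairs of sets $S,S'$ and every $n\ge 0$ there is a short exact sequence $$0\to\bigoplus_{i+j=n}H_i(S)\otimes_K H_j(S')\to H_n(S\square S')\to\bigoplus_{i+j=n-1}\mathrm{Tor}^K_1(H_i(S),H_j(S'))\to 0.$$ (3) For any two regular path complexes $P,P'$ (on sets $V,V'$) there is an isomorphism of chain complexes $\Omega(P\square_{\rm reg}P')\cong\Omega P\otimes_K\Omega P'$. -/

import Mathlib

universe u

open CategoryTheory MonoidalCategory Opposite
open scoped TensorProduct

noncomputable section

/-! ## Graded submodules of chain complexes -/

section Omega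

variable {K : Type u} [CommRing K]

/-- The `n`-th component `Dₙ ∩ ∂⁻¹(Dₙ₋₁)` of `ω(C, D)`. (Only `m = n - 1` gives a condition,
since `C.d n m = 0` for all other `m`; for `n = 0` there is no condition besides `x ∈ D₀`.) -/
def omegaSubmodule (C : ChainComplex (ModuleCat.{u} K) ℕ) (D : ∀ n, Submodule K (C.X n)) (n : ℕ) :
    Submodule K (C.X n) :=
  D n ⊓ ⨅ m : ℕ, (D m).comap (C.d n m).hom

lemma omegaSubmodule_d (C : ChainComplex (ModuleCat.{u} K) ℕ) (D : ∀ n, Submodule K (C.X n))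
    (i j : ℕ) : ∀ x ∈ omegaSubmodule C D i, (C.d i j).hom x ∈ omegaSubmodule C D j := by
  intro x hx
  simp only [omegaSubmodule, Submodule.mem_inf, Submodule.mem_iInf, Submodule.mem_comap] at hx ⊢
  refine ⟨hx.2 j, fun m => ?_⟩
  have h : (C.d j m).hom ((C.d i j).hom x) = 0 := by
    rw [← LinearMap.comp_apply, ← ModuleCat.hom_comp, C.d_comp_d]
    rfl
  rw [h]
  exact (D m).zero_mem

/-- `ω(C, D)`: the largest subcomplex of `C` contained in the graded submodule `D`. -/
def omegaComplex (C : ChainComplex (ModuleCat.{u} K) ℕ) (D : ∀ n, Submodule K (C.X n)) :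
    ChainComplex (ModuleCat.{u} K) ℕ where
  X n := ModuleCat.of K (omegaSubmodule C D n)
  d i j := ModuleCat.ofHom ((C.d i j).hom.restrict (omegaSubmodule_d C D i j))
  shape i j h := by
    refine ModuleCat.hom_ext (LinearMap.ext fun x => Subtype.ext ?_)
    change (C.d i j).hom x.1 = 0
    rw [C.shape i j h]
    rfl
  d_comp_d' i j k _ _ := by
    refine ModuleCat.hom_ext (LinearMap.ext fun x => Subtype.ext ?_)
    change (C.d j k).hom ((C.d i j).hom x.1) = 0
    rw [← LinearMap.comp_apply, ← ModuleCat.hom_comp, C.d_comp_d]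
    rfl

end Omega

/-! ## The normalized complex of a simplicial module -/

section Normalized

variable {K : Type u} [CommRing K]

/-- `Dₙ A = ∑ i, sᵢ(Aₙ₋₁)`, the submodule of degenerate elements. -/
def degenerateSubmodule (A : SimplicialObject (ModuleCat.{u} K)) : 
    ∀ n : ℕ, Submodule K (A.obj (op (SimplexCategory.mk n)))
  | 0 => ⊥
  | n + 1 => ⨆ i : Fin (n + 1), LinearMap.range (A.σ i).hom

open Simplicial

open AlgebraicTopology in
/-- The degenerate elements are the kernel of the projector `PInfty` onto the intersection of the
kernels of the faces `dᵢ`, `i ≠ 0`. -/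
lemma mem_degenerateSubmodule_iff (A : SimplicialObject (ModuleCat.{u} K)) (n : ℕ) (x : A _⦋n⦌) :
    x ∈ degenerateSubmodule A n ↔
      ((DoldKan.PInfty (X := A)).f n).hom x = 0 := by
  cases n with
  | zero =>
    simp [degenerateSubmodule]
  | succ n =>
    constructor
    · intro hx
      have : degenerateSubmodule A (n + 1) ≤
          LinearMap.ker ((DoldKan.PInfty (X := A)).f (n + 1)).hom := by
        refine iSup_le fun i => ?_
        rintro _ ⟨y, rfl⟩
        have := DoldKan.σ_comp_PInfty A i
        exact LinearMap.congr_fun (congrArg ModuleCat.Hom.hom this) y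
      exact this hx
    · intro hx
      have h := DoldKan.PInfty_f_add_QInfty_f (X := A) (n + 1)
      have h2 := LinearMap.congr_fun (congrArg ModuleCat.Hom.hom h) x
      rw [ModuleCat.hom_add, LinearMap.add_apply, hx, zero_add, DoldKan.QInfty_f,
        DoldKan.decomposition_Q, ModuleCat.hom_sum, LinearMap.sum_apply] at h2
      have h3 : x = ∑ i ∈ Finset.univ.filter (fun i : Fin (n + 1) => i.val < n + 1),
          (A.σ i.rev).hom ((A.δ i.rev.succ).hom (((DoldKan.P (X := A) i).f (n + 1)).hom x)) :=
        h2.symm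
      rw [h3]
      exact Submodule.sum_mem _ fun i _ =>
        Submodule.mem_iSup_of_mem (p := fun i : Fin (n + 1) => LinearMap.range (A.σ i).hom)
          i.rev ⟨_, rfl⟩

open AlgebraicTopology in
lemma degenerateSubmodule_d (A : SimplicialObject (ModuleCat.{u} K)) (i j : ℕ) :
    degenerateSubmodule A i ≤
      (degenerateSubmodule A j).comap (((alternatingFaceMapComplex _).obj A).d i j).hom := by
  intro x hx
  rw [Submodule.mem_comap, mem_degenerateSubmodule_iff]
  rw [mem_degenerateSubmodule_iff] at hx
  have h := (DoldKan.PInfty (X := A)).comm i j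
  have h2 := LinearMap.congr_fun (congrArg ModuleCat.Hom.hom h) x
  have h3 : (((alternatingFaceMapComplex _).obj A).d i j).hom
      (((DoldKan.PInfty (X := A)).f i).hom x) = ((DoldKan.PInfty (X := A)).f j).hom
      ((((alternatingFaceMapComplex _).obj A).d i j).hom x) := h2
  rw [← h3, hx, map_zero]

open AlgebraicTopology in
/-- The normalized complex `N A = C A / D A`, where `C A` is the complex with `(C A)ₙ = Aₙ` and
`∂ = ∑ (-1)ⁱ dᵢ`. -/
def normalizedComplex (A : SimplicialObject (ModuleCat.{u} K)) :
    ChainComplex (ModuleCat.{u} K) ℕ where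
  X n := ModuleCat.of K (A _⦋n⦌ ⧸ degenerateSubmodule A n)
  d i j := ModuleCat.ofHom (Submodule.mapQ (degenerateSubmodule A i) (degenerateSubmodule A j)
    (((alternatingFaceMapComplex _).obj A).d i j).hom (degenerateSubmodule_d A i j))
  shape i j h := by
    ext x
    simp [((alternatingFaceMapComplex _).obj A).shape i j h]
  d_comp_d' i j k _ _ := by
    ext x
    have h : (((alternatingFaceMapComplex _).obj A).d j k).hom
        ((((alternatingFaceMapComplex _).obj A).d i j).hom x) = 0 := by
      rw [← LinearMap.comp_apply, ← ModuleCat.hom_comp, HomologicalComplex.d_comp_d]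
      rfl
    have h2 := congrArg (Submodule.mkQ (degenerateSubmodule A k)) h
    simpa using h2

/-- The projection `ρ : Aₙ → Nₙ A`. -/
def normalizedProj (A : SimplicialObject (ModuleCat.{u} K)) (n : ℕ) :
    A _⦋n⦌ →ₗ[K] (normalizedComplex A).X n :=
  Submodule.mkQ (degenerateSubmodule A n)

end Normalized

open Simplicial

/-! ## Path pairs of modules -/

/-- A path pair of modules `(A, B)`: a simplicial module `A` with submodules `Bₙ ⊆ Aₙ` closed under
all degeneracy maps and under the exterior face maps `d₀, dₙ : Aₙ → Aₙ₋₁`. -/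
structure ModulePathPair (K : Type u) [CommRing K] where
  /-- the simplicial module -/
  A : SimplicialObject (ModuleCat.{u} K)
  /-- the path submodule -/
  B : ∀ n : ℕ, Submodule K (A _⦋n⦌)
  σ_mem : ∀ (n : ℕ) (i : Fin (n + 1)), ∀ b ∈ B n, (A.σ i).hom b ∈ B (n + 1)
  δ_zero_mem : ∀ n : ℕ, ∀ b ∈ B (n + 1), (A.δ (0 : Fin (n + 2))).hom b ∈ B n
  δ_last_mem : ∀ n : ℕ, ∀ b ∈ B (n + 1), (A.δ (Fin.last (n + 1))).hom b ∈ B n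

/-- `Ω(A, B) = ω(N A, B̄)`, where `B̄ₙ = ρ(Bₙ)`. -/
def ModulePathPair.Omega {K : Type u} [CommRing K] (P : ModulePathPair K) :
    ChainComplex (ModuleCat.{u} K) ℕ :=
  omegaComplex (normalizedComplex P.A) fun n => (P.B n).map (normalizedProj P.A n)

/-! ## Path pairs of sets -/

/-- The free simplicial module `K[X]` on a simplicial set `X`. -/
def freeSimplicialModule (K : Type u) [CommRing K] (X : SSet.{u}) :
    SimplicialObject (ModuleCat.{u} K) :=
  ((SimplicialObject.whiskering _ _).obj (ModuleCat.free K)).obj X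

/-- The basis element of `K[X]ₙ` given by `x ∈ Xₙ`. -/
def simplexBasis (K : Type u) [CommRing K] (X : SSet.{u}) {n : ℕ} (x : X _⦋n⦌) :
    freeSimplicialModule K X _⦋n⦌ :=
  ModuleCat.freeMk x

lemma freeSimplicialModule_map_basis (K : Type u) [CommRing K] (X : SSet.{u}) {n m : ℕ}
    (f : ⦋m⦌ ⟶ ⦋n⦌) (x : X _⦋n⦌) :
    ((freeSimplicialModule K X).map f.op).hom (simplexBasis K X x) =
      simplexBasis K X (X.map f.op x) :=
  ModuleCat.free_map_apply (X.map f.op) x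

lemma freeSimplicialModule_map_span (K : Type u) [CommRing K] (X : SSet.{u}) {n m : ℕ}
    (f : ⦋m⦌ ⟶ ⦋n⦌) (S : Set (X _⦋n⦌)) (T : Set (X _⦋m⦌)) (h : ∀ x ∈ S, X.map f.op x ∈ T) :
    ∀ b ∈ Submodule.span K (simplexBasis K X '' S),
      ((freeSimplicialModule K X).map f.op).hom b ∈
        Submodule.span K (simplexBasis K X '' T) := by
  intro b hb
  have : Submodule.span K (simplexBasis K X '' S) ≤
      (Submodule.span K (simplexBasis K X '' T)).comap
        ((freeSimplicialModule K X).map f.op).hom := by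
    rw [Submodule.span_le]
    rintro _ ⟨x, hx, rfl⟩
    simp only [Submodule.comap_coe, Set.mem_preimage, SetLike.mem_coe]
    rw [freeSimplicialModule_map_basis]
    exact Submodule.subset_span ⟨_, h x hx, rfl⟩
  exact this hb

/-- A path pair of sets `(X, Y)`: a simplicial set `X` with subsets `Yₙ ⊆ Xₙ` closed under all
degeneracy maps and under the exterior face maps `d₀, dₙ : Xₙ → Xₙ₋₁`. -/
structure SetPathPair where
  /-- the simplicial set -/
  X : SSet.{u}
  /-- the path subset -/
  Y : ∀ n : ℕ, Set (X _⦋n⦌)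
  σ_mem : ∀ (n : ℕ) (i : Fin (n + 1)), ∀ y ∈ Y n, X.σ i y ∈ Y (n + 1)
  δ_zero_mem : ∀ n : ℕ, ∀ y ∈ Y (n + 1), X.δ (0 : Fin (n + 2)) y ∈ Y n
  δ_last_mem : ∀ n : ℕ, ∀ y ∈ Y (n + 1), X.δ (Fin.last (n + 1)) y ∈ Y n

namespace SetPathPair

/-- `K[S] = (K[X], K[Y])`. -/
def toModulePathPair (S : SetPathPair.{u}) (K : Type u) [CommRing K] : ModulePathPair K where
  A := freeSimplicialModule K S.X
  B n := Submodule.span K (simplexBasis K S.X '' S.Y n)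
  σ_mem n i := freeSimplicialModule_map_span K S.X (SimplexCategory.σ i) _ _ (S.σ_mem n i)
  δ_zero_mem n := freeSimplicialModule_map_span K S.X (SimplexCategory.δ 0) _ _ (S.δ_zero_mem n)
  δ_last_mem n :=
    freeSimplicialModule_map_span K S.X (SimplexCategory.δ (Fin.last (n + 1))) _ _ (S.δ_last_mem n)

/-- `Ω(S, K) = Ω(K[S])`. -/
def Omega (S : SetPathPair.{u}) (K : Type u) [CommRing K] : ChainComplex (ModuleCat.{u} K) ℕ :=
  (S.toModulePathPair K).Omega

end SetPathPair

/-! ## Shuffles and the box product -/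

/-- An `(l, k)`-shuffle of `{0, …, n - 1}`, where `n = k + l`: strictly increasing sequences
`μ₀ < ⋯ < μₗ₋₁` and `ν₀ < ⋯ < νₖ₋₁`, recorded as sets with `l` resp. `k` elements, that together
exhaust `{0, …, n - 1}`. -/
structure Shuffle (l k n : ℕ) where
  /-- the set of the `μⱼ` -/
  μ : Finset (Fin n)
  /-- the set of the `νⱼ` -/
  ν : Finset (Fin n)
  add_eq : k + l = n
  card_μ : μ.card = l
  card_ν : ν.card = k
  union_eq : μ ∪ ν = Finset.univ

/-- The order-preserving surjection `[n] → [k]`, `k = |ν|`, that jumps from `j` to `j + 1` exactly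
for `j ∈ ν`. -/
def jumpMap {n k : ℕ} (ν : Finset (Fin n)) (h : ν.card = k) : ⦋n⦌ ⟶ ⦋k⦌ :=
  SimplexCategory.mkHom
    { toFun := fun i => ⟨(Finset.univ.filter fun j : Fin n => j ∈ ν ∧ j.castSucc < i).card, by
        rw [Nat.lt_succ_iff, ← h]
        exact Finset.card_le_card fun j hj => (Finset.mem_filter.1 hj).2.1⟩
      monotone' := fun a b hab => by
        refine Fin.mk_le_mk.2 (Finset.card_le_card fun j hj => ?_)
        rw [Finset.mem_filter] at hj ⊢
        exact ⟨hj.1, hj.2.1, lt_of_lt_of_le hj.2.2 hab⟩ }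

namespace Shuffle

variable {l k n : ℕ} (s : Shuffle l k n)

/-- `s^μ = s^{μ₀} ⋯ s^{μₗ₋₁} : [n] → [k]`, the order-preserving surjection that identifies `j` with
`j + 1` exactly for `j ∈ μ`, that is, jumps exactly at the elements of `ν`. -/
def sMu : ⦋n⦌ ⟶ ⦋k⦌ := jumpMap s.ν s.card_ν

/-- `s^ν = s^{ν₀} ⋯ s^{νₖ₋₁} : [n] → [l]`. -/
def sNu : ⦋n⦌ ⟶ ⦋l⦌ := jumpMap s.μ s.card_μ

end Shuffle

/-- `(Y ⋄ Y')ₙ`, the union over `k + l = n` and over all `(l, k)`-shuffles `(μ, ν)` of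
`s_μ(Yₖ) × s_ν(Y'ₗ)`. -/
def diamond (S S' : SetPathPair.{u}) (n : ℕ) : Set ((S.X ⊗ S'.X : SSet.{u}) _⦋n⦌) :=
  {p | ∃ (k l : ℕ) (s : Shuffle l k n), ∃ y ∈ S.Y k, ∃ y' ∈ S'.Y l,
    p.1 = S.X.map s.sMu.op y ∧ p.2 = S'.X.map s.sNu.op y'}

lemma jumpMap_val {n k : ℕ} (ν : Finset (Fin n)) (h : ν.card = k) (i : Fin (n + 1)) :
    (((jumpMap ν h).toOrderHom i : Fin (k + 1)) : ℕ) =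
      ∑ j : Fin n, if j ∈ ν ∧ j.castSucc < i then 1 else 0 := by
  change (Finset.univ.filter fun j : Fin n => j ∈ ν ∧ j.castSucc < i).card = _
  rw [Finset.card_filter]

lemma succAbove_castSucc_lt_iff {n : ℕ} (i : Fin (n + 1)) (j : Fin n) (a : Fin (n + 2)) :
    (i.succAbove j).castSucc < a ↔ j.castSucc < i.predAbove a := by
  rcases lt_or_ge i.castSucc a with h | h
  · rw [Fin.predAbove_of_castSucc_lt _ _ h]
    rcases lt_or_ge j.castSucc i with h1 | h1
    · rw [Fin.succAbove_of_castSucc_lt _ _ h1]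
      simp only [Fin.lt_def, Fin.val_castSucc, Fin.val_pred] at h h1 ⊢
      omega
    · rw [Fin.succAbove_of_le_castSucc _ _ h1]
      simp only [Fin.lt_def, Fin.le_def, Fin.val_castSucc, Fin.val_pred, Fin.val_succ] at h h1 ⊢
      omega
  · rw [Fin.predAbove_of_le_castSucc _ _ h]
    rcases lt_or_ge j.castSucc i with h1 | h1
    · rw [Fin.succAbove_of_castSucc_lt _ _ h1]
      simp only [Fin.lt_def, Fin.val_castSucc, Fin.coe_castPred]
    · rw [Fin.succAbove_of_le_castSucc _ _ h1]
      simp only [Fin.lt_def, Fin.le_def, Fin.val_castSucc, Fin.coe_castPred, Fin.val_succ]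
        at h h1 ⊢
      omega

lemma jumpMap_degen {n k : ℕ} (ν : Finset (Fin n)) (h : ν.card = k) (i : Fin (n + 1))
    (h' : (ν.map i.succAboveEmb).card = k) :
    jumpMap (ν.map i.succAboveEmb) h' = SimplexCategory.σ i ≫ jumpMap ν h := by
  ext a
  change ((jumpMap (ν.map i.succAboveEmb) h').toOrderHom a : ℕ) =
    ((jumpMap ν h).toOrderHom (i.predAbove a) : ℕ)
  rw [jumpMap_val, jumpMap_val, Fin.sum_univ_succAbove _ i, if_neg (by simp), zero_add]
  refine Finset.sum_congr rfl fun j _ => ?_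
  have h1 : i.succAbove j ∈ ν.map i.succAboveEmb ↔ j ∈ ν := by simp
  simp only [h1, succAbove_castSucc_lt_iff]

lemma jumpMap_degen_insert {n k : ℕ} (ν : Finset (Fin n)) (h : ν.card = k) (i : Fin (n + 1))
    (h' : (insert i (ν.map i.succAboveEmb)).card = k + 1) :
    jumpMap (insert i (ν.map i.succAboveEmb)) h' ≫
      SimplexCategory.σ ((jumpMap ν h).toOrderHom i) = SimplexCategory.σ i ≫ jumpMap ν h := by
  have hle : ∀ a b : Fin (n + 1), a ≤ b →
      ((jumpMap ν h).toOrderHom a : ℕ) ≤ (jumpMap ν h).toOrderHom b :=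
    fun a b hab => (jumpMap ν h).toOrderHom.monotone hab
  ext a
  change ((((jumpMap ν h).toOrderHom i : Fin (k + 1)).predAbove
    ((jumpMap (insert i (ν.map i.succAboveEmb)) h').toOrderHom a) : Fin (k + 1)) : ℕ) =
      ((jumpMap ν h).toOrderHom (i.predAbove a) : ℕ)
  have key : ((jumpMap (insert i (ν.map i.succAboveEmb)) h').toOrderHom a : ℕ) =
      (if i.castSucc < a then 1 else 0) + ((jumpMap ν h).toOrderHom (i.predAbove a) : ℕ) := by
    rw [jumpMap_val, jumpMap_val, Fin.sum_univ_succAbove _ i]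
    congr 1
    · simp
    · refine Finset.sum_congr rfl fun j _ => ?_
      have h1 : i.succAbove j ∈ insert i (ν.map i.succAboveEmb) ↔ j ∈ ν := by
        simp
      simp only [h1, succAbove_castSucc_lt_iff]
  generalize (jumpMap (insert i (ν.map i.succAboveEmb)) h').toOrderHom a = b at key ⊢
  by_cases hia : i.castSucc < a
  · have hp : i ≤ i.predAbove a := by
      rw [Fin.predAbove_of_castSucc_lt _ _ hia, Fin.le_def]
      rw [Fin.lt_def] at hia
      simp at hia ⊢
      omega
    have := hle _ _ hp
    rw [if_pos hia] at key
    rw [Fin.predAbove_of_castSucc_lt _ _ (by rw [Fin.lt_def, key]; simp; omega)]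
    simp [key]
  · have hp : i.predAbove a ≤ i := by
      rw [Fin.predAbove_of_le_castSucc _ _ (not_lt.1 hia), Fin.le_def]
      rw [not_lt, Fin.le_def] at hia
      simpa using hia
    have := hle _ _ hp
    rw [if_neg hia] at key
    rw [Fin.predAbove_of_le_castSucc _ _ (by rw [Fin.le_def, key]; simpa using this)]
    simp [key]

/-- `{j | j + 1 ∈ ν}`: the set `ν` seen in the remaining steps after dropping the first one. -/
def tailSet {n : ℕ} (ν : Finset (Fin (n + 1))) : Finset (Fin n) :=
  Finset.univ.filter fun j => j.succ ∈ ν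

/-- `{j < n | j ∈ ν}`: the set `ν` seen in the remaining steps after dropping the last one. -/
def initSet {n : ℕ} (ν : Finset (Fin (n + 1))) : Finset (Fin n) :=
  Finset.univ.filter fun j => j.castSucc ∈ ν

lemma card_tailSet {n : ℕ} (ν : Finset (Fin (n + 1))) :
    ν.card = (if 0 ∈ ν then 1 else 0) + (tailSet ν).card := by
  rw [tailSet, Finset.card_filter, ← Fin.sum_univ_succ (fun j => if j ∈ ν then 1 else 0)]
  simp

lemma card_initSet {n : ℕ} (ν : Finset (Fin (n + 1))) :
    ν.card = (initSet ν).card + (if Fin.last n ∈ ν then 1 else 0) := by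
  rw [initSet, Finset.card_filter, ← Fin.sum_univ_castSucc (fun j => if j ∈ ν then 1 else 0)]
  simp

lemma jumpMap_tail_val {n k k' : ℕ} (ν : Finset (Fin (n + 1))) (h : ν.card = k)
    (h' : (tailSet ν).card = k') (a : Fin (n + 1)) :
    ((jumpMap ν h).toOrderHom a.succ : ℕ) =
      (if 0 ∈ ν then 1 else 0) + ((jumpMap (tailSet ν) h').toOrderHom a : ℕ) := by
  rw [jumpMap_val, jumpMap_val, Fin.sum_univ_succ]
  congr 1
  · simp
  · refine Finset.sum_congr rfl fun j _ => ?_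
    simp [tailSet, Fin.lt_def]

lemma jumpMap_init_val {n k k' : ℕ} (ν : Finset (Fin (n + 1))) (h : ν.card = k)
    (h' : (initSet ν).card = k') (a : Fin (n + 1)) :
    ((jumpMap ν h).toOrderHom a.castSucc : ℕ) =
      ((jumpMap (initSet ν) h').toOrderHom a : ℕ) := by
  rw [jumpMap_val, jumpMap_val, Fin.sum_univ_castSucc, if_neg, add_zero]
  · refine Finset.sum_congr rfl fun j _ => ?_
    simp [initSet, Fin.lt_def]
  · rintro ⟨-, h2⟩
    have := a.2
    simp [Fin.lt_def] at h2
    omega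

lemma jumpMap_tail_of_mem {n k : ℕ} (ν : Finset (Fin (n + 1))) (h : ν.card = k + 1)
    (h0 : 0 ∈ ν) (h' : (tailSet ν).card = k) :
    SimplexCategory.δ 0 ≫ jumpMap ν h = jumpMap (tailSet ν) h' ≫ SimplexCategory.δ 0 := by
  ext a
  change ((jumpMap ν h).toOrderHom a.succ : ℕ) =
    (((jumpMap (tailSet ν) h').toOrderHom a : Fin (k + 1)).succ : ℕ)
  rw [jumpMap_tail_val ν h h', if_pos h0, Fin.val_succ, add_comm]

lemma jumpMap_tail_of_notMem {n k : ℕ} (ν : Finset (Fin (n + 1))) (h : ν.card = k)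
    (h0 : 0 ∉ ν) (h' : (tailSet ν).card = k) :
    SimplexCategory.δ 0 ≫ jumpMap ν h = jumpMap (tailSet ν) h' := by
  ext a
  change ((jumpMap ν h).toOrderHom a.succ : ℕ) = ((jumpMap (tailSet ν) h').toOrderHom a : ℕ)
  rw [jumpMap_tail_val ν h h', if_neg h0, zero_add]

lemma δ_last_apply {n : ℕ} (a : Fin (n + 1)) :
    (SimplexCategory.δ (Fin.last (n + 1))).toOrderHom a = a.castSucc :=
  Fin.succAbove_last_apply a

lemma jumpMap_init_of_mem {n k : ℕ} (ν : Finset (Fin (n + 1))) (h : ν.card = k + 1)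
    (h' : (initSet ν).card = k) :
    SimplexCategory.δ (Fin.last (n + 1)) ≫ jumpMap ν h =
      jumpMap (initSet ν) h' ≫ SimplexCategory.δ (Fin.last (k + 1)) := by
  ext a
  change ((jumpMap ν h).toOrderHom ((SimplexCategory.δ (Fin.last (n + 1))).toOrderHom a) : ℕ) =
    ((SimplexCategory.δ (Fin.last (k + 1))).toOrderHom ((jumpMap (initSet ν) h').toOrderHom a) : ℕ)
  rw [δ_last_apply, δ_last_apply, jumpMap_init_val ν h h', Fin.val_castSucc]

lemma jumpMap_init_of_notMem {n k : ℕ} (ν : Finset (Fin (n + 1))) (h : ν.card = k)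
    (h' : (initSet ν).card = k) :
    SimplexCategory.δ (Fin.last (n + 1)) ≫ jumpMap ν h = jumpMap (initSet ν) h' := by
  ext a
  change ((jumpMap ν h).toOrderHom ((SimplexCategory.δ (Fin.last (n + 1))).toOrderHom a) : ℕ) =
    ((jumpMap (initSet ν) h').toOrderHom a : ℕ)
  rw [δ_last_apply, jumpMap_init_val ν h h']

namespace Shuffle

variable {l k n : ℕ}

/-- In a shuffle the two sets are disjoint, as `k + l = n`. -/
lemma disjoint (s : Shuffle l k n) : Disjoint s.μ s.ν := by
  have h := Finset.card_union_add_card_inter s.μ s.ν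
  rw [s.union_eq, s.card_μ, s.card_ν, Finset.card_univ, Fintype.card_fin] at h
  have := s.add_eq
  rw [Finset.disjoint_iff_inter_eq_empty, ← Finset.card_eq_zero]
  omega

/-- The shuffle with the roles of `μ` and `ν` exchanged. -/
def swap (s : Shuffle l k n) : Shuffle k l n where
  μ := s.ν
  ν := s.μ
  add_eq := by rw [add_comm, s.add_eq]
  card_μ := s.card_ν
  card_ν := s.card_μ
  union_eq := by rw [Finset.union_comm, s.union_eq]

/-- The shuffle of `{0, …, n}` with a new step inserted at `i` and put into `μ`. -/
def degen (s : Shuffle l k n) (i : Fin (n + 1)) : Shuffle (l + 1) k (n + 1) where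
  μ := insert i (s.μ.map i.succAboveEmb)
  ν := s.ν.map i.succAboveEmb
  add_eq := by rw [← add_assoc, s.add_eq]
  card_μ := by
    rw [Finset.card_insert_of_notMem (by simp), Finset.card_map, s.card_μ]
  card_ν := by rw [Finset.card_map, s.card_ν]
  union_eq := by
    rw [Finset.insert_union, ← Finset.map_union, s.union_eq, Finset.eq_univ_iff_forall]
    intro x
    rcases eq_or_ne x i with rfl | hx
    · simp
    · obtain ⟨z, rfl⟩ := Fin.exists_succAbove_eq hx
      simp

/-- The first step of a shuffle belongs to `ν` and is removed. -/
def tailNu (s : Shuffle l (k + 1) (n + 1)) (h : 0 ∈ s.ν) : Shuffle l k n where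
  μ := tailSet s.μ
  ν := tailSet s.ν
  add_eq := by have := s.add_eq; omega
  card_μ := by
    have h1 := card_tailSet s.μ
    rw [if_neg (Finset.disjoint_right.1 s.disjoint h), s.card_μ] at h1
    omega
  card_ν := by
    have h1 := card_tailSet s.ν
    rw [if_pos h, s.card_ν] at h1
    omega
  union_eq := by
    ext j
    have := Finset.ext_iff.1 s.union_eq j.succ
    simpa [tailSet] using this

/-- The last step of a shuffle belongs to `ν` and is removed. -/
def initNu (s : Shuffle l (k + 1) (n + 1)) (h : Fin.last n ∈ s.ν) : Shuffle l k n where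
  μ := initSet s.μ
  ν := initSet s.ν
  add_eq := by have := s.add_eq; omega
  card_μ := by
    have h1 := card_initSet s.μ
    rw [if_neg (Finset.disjoint_right.1 s.disjoint h), s.card_μ] at h1
    omega
  card_ν := by
    have h1 := card_initSet s.ν
    rw [if_pos h, s.card_ν] at h1
    omega
  union_eq := by
    ext j
    have := Finset.ext_iff.1 s.union_eq j.castSucc
    simpa [initSet] using this

end Shuffle

lemma diamond_swap {S S' : SetPathPair.{u}} {n : ℕ} {x : S.X _⦋n⦌} {x' : S'.X _⦋n⦌} :
    ((x, x') : (S.X ⊗ S'.X : SSet.{u}) _⦋n⦌) ∈ diamond S S' n ↔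
      ((x', x) : (S'.X ⊗ S.X : SSet.{u}) _⦋n⦌) ∈ diamond S' S n := by
  constructor
  · rintro ⟨k, l, s, y, hy, y', hy', h, h'⟩
    exact ⟨l, k, s.swap, y', hy', y, hy, h', h⟩
  · rintro ⟨k, l, s, y, hy, y', hy', h, h'⟩
    exact ⟨l, k, s.swap, y', hy', y, hy, h', h⟩

lemma SSet_map_comp_eq (X : SSet.{u}) {a b b' c : ℕ} {f : ⦋a⦌ ⟶ ⦋b⦌} {g : ⦋b⦌ ⟶ ⦋c⦌}
    {f' : ⦋a⦌ ⟶ ⦋b'⦌} {g' : ⦋b'⦌ ⟶ ⦋c⦌} (h : f ≫ g = f' ≫ g') (y : X _⦋c⦌) :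
    X.map f.op (X.map g.op y) = X.map f'.op (X.map g'.op y) := by
  rw [← CategoryTheory.comp_apply, ← Functor.map_comp, ← op_comp, h, op_comp, Functor.map_comp,
    CategoryTheory.comp_apply]

lemma SSet_map_eq (X : SSet.{u}) {a b c : ℕ} {f : ⦋a⦌ ⟶ ⦋b⦌} {g : ⦋b⦌ ⟶ ⦋c⦌}
    {f' : ⦋a⦌ ⟶ ⦋c⦌} (h : f ≫ g = f') (y : X _⦋c⦌) :
    X.map f.op (X.map g.op y) = X.map f'.op y := by
  rw [← CategoryTheory.comp_apply, ← Functor.map_comp, ← op_comp, h]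

lemma diamond_tail_aux (S S' : SetPathPair.{u}) {n k l : ℕ} (s : Shuffle l k (n + 1))
    (h0 : 0 ∈ s.ν) {y : S.X _⦋k⦌} (hy : y ∈ S.Y k) {y' : S'.X _⦋l⦌} (hy' : y' ∈ S'.Y l) :
    ((S.X.map (SimplexCategory.δ (0 : Fin (n + 2))).op (S.X.map s.sMu.op y),
      S'.X.map (SimplexCategory.δ (0 : Fin (n + 2))).op (S'.X.map s.sNu.op y')) :
      (S.X ⊗ S'.X : SSet.{u}) _⦋n⦌) ∈ diamond S S' n := by
  cases k with
  | zero => exact absurd (Finset.card_pos.2 ⟨0, h0⟩) (by rw [s.card_ν]; omega)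
  | succ k =>
    refine ⟨k, l, s.tailNu h0, S.X.δ 0 y, S.δ_zero_mem k y hy, y', hy', ?_, ?_⟩
    · exact SSet_map_comp_eq S.X (jumpMap_tail_of_mem s.ν s.card_ν h0 (s.tailNu h0).card_ν) y
    · exact SSet_map_eq S'.X (jumpMap_tail_of_notMem s.μ s.card_μ
        (Finset.disjoint_right.1 s.disjoint h0) (s.tailNu h0).card_μ) y'

lemma diamond_init_aux (S S' : SetPathPair.{u}) {n k l : ℕ} (s : Shuffle l k (n + 1))
    (h0 : Fin.last n ∈ s.ν) {y : S.X _⦋k⦌} (hy : y ∈ S.Y k) {y' : S'.X _⦋l⦌}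
    (hy' : y' ∈ S'.Y l) :
    ((S.X.map (SimplexCategory.δ (Fin.last (n + 1))).op (S.X.map s.sMu.op y),
      S'.X.map (SimplexCategory.δ (Fin.last (n + 1))).op (S'.X.map s.sNu.op y')) :
      (S.X ⊗ S'.X : SSet.{u}) _⦋n⦌) ∈ diamond S S' n := by
  cases k with
  | zero => exact absurd (Finset.card_pos.2 ⟨_, h0⟩) (by rw [s.card_ν]; omega)
  | succ k =>
    refine ⟨k, l, s.initNu h0, S.X.δ (Fin.last (k + 1)) y, S.δ_last_mem k y hy, y', hy', ?_, ?_⟩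
    · exact SSet_map_comp_eq S.X (jumpMap_init_of_mem s.ν s.card_ν (s.initNu h0).card_ν) y
    · exact SSet_map_eq S'.X (jumpMap_init_of_notMem s.μ s.card_μ (s.initNu h0).card_μ) y'

/-- The box product `S □ S' = (X × X', Y ⋄ Y')`. (`X ⊗ X'` is Mathlib's levelwise cartesian product
of simplicial sets.) -/
def SetPathPair.box (S S' : SetPathPair.{u}) : SetPathPair.{u} where
  X := S.X ⊗ S'.X
  Y := diamond S S'
  σ_mem n i := by
    rintro ⟨x, x'⟩ ⟨k, l, s, y, hy, y', hy', hx, hx'⟩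
    change x = _ at hx
    change x' = _ at hx'
    subst hx hx'
    refine ⟨k, l + 1, s.degen i, y, hy, S'.X.σ (s.sNu.toOrderHom i) y',
      S'.σ_mem l _ y' hy', ?_, ?_⟩
    · exact SSet_map_eq S.X (jumpMap_degen s.ν s.card_ν i (s.degen i).card_ν).symm y
    · exact SSet_map_comp_eq S'.X (jumpMap_degen_insert s.μ s.card_μ i (s.degen i).card_μ).symm y'
  δ_zero_mem n := by
    rintro ⟨x, x'⟩ ⟨k, l, s, y, hy, y', hy', hx, hx'⟩
    change x = _ at hx
    change x' = _ at hx'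
    subst hx hx'
    have h : (0 : Fin (n + 1)) ∈ s.μ ∪ s.ν := by rw [s.union_eq]; exact Finset.mem_univ _
    rcases Finset.mem_union.1 h with h | h
    · exact diamond_swap.2 (diamond_tail_aux S' S s.swap h hy' hy)
    · exact diamond_tail_aux S S' s h hy hy'
  δ_last_mem n := by
    rintro ⟨x, x'⟩ ⟨k, l, s, y, hy, y', hy', hx, hx'⟩
    change x = _ at hx
    change x' = _ at hx'
    subst hx hx'
    have h : Fin.last n ∈ s.μ ∪ s.ν := by rw [s.union_eq]; exact Finset.mem_univ _
    rcases Finset.mem_union.1 h with h | h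
    · exact diamond_swap.2 (diamond_init_aux S' S s.swap h hy' hy)
    · exact diamond_init_aux S S' s h hy hy'

/-! ## Regular path complexes -/

/-- The simplicial set `cosk₀(V)` with `cosk₀(V)ₙ = V^{n+1}`; the simplicial operators act by
precomposition, so `dᵢ` deletes `vᵢ` and `sᵢ` repeats `vᵢ`. -/
def coskZero (V : Type u) : SSet.{u} where
  obj a := Fin (a.unop.len + 1) → V
  map f := ↾fun v => v ∘ f.unop.toOrderHom
  map_id _ := rfl
  map_comp _ _ := rfl

/-- A regular path complex on the vertex set `V`: sets `Pₙ ⊆ V^{n+1}` of regular sequences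
(`vᵢ ≠ vᵢ₊₁`), closed under deleting the last vertex and under deleting the first vertex. -/
structure RegularPathComplex (V : Type u) where
  /-- the sets of paths -/
  P : ∀ n : ℕ, Set (Fin (n + 1) → V)
  init_mem : ∀ n : ℕ, ∀ v ∈ P (n + 1), (fun i : Fin (n + 1) => v i.castSucc) ∈ P n
  tail_mem : ∀ n : ℕ, ∀ v ∈ P (n + 1), (fun i : Fin (n + 1) => v i.succ) ∈ P n
  regular : ∀ n : ℕ, ∀ v ∈ P n, ∀ i : Fin n, v i.castSucc ≠ v i.succ

/-- `Ω P = ω(R(V), A(P))`, where `R(V) = N(K[cosk₀ V])` is the complex of regular paths and `Aₙ(P)`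
is generated by the images of the elements of `Pₙ`. -/
def RegularPathComplex.Omega {V : Type u} (P : RegularPathComplex V) (K : Type u) [CommRing K] :
    ChainComplex (ModuleCat.{u} K) ℕ :=
  omegaComplex (normalizedComplex (freeSimplicialModule K (coskZero V))) fun n =>
    Submodule.span K ((fun v : Fin (n + 1) → V =>
      normalizedProj (freeSimplicialModule K (coskZero V)) n
        (simplexBasis K (coskZero V) (n := n) v)) '' P.P n)

/-- `u = v_reg`: the sequence `u` has no two equal consecutive entries, and `v` is obtained from `u`
by repeating entries; equivalently `u` is `v` with consecutive repetitions deleted. -/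
def IsReg {V : Type u} {n k : ℕ} (v : Fin (n + 1) → V) (u : Fin (k + 1) → V) : Prop :=
  (∀ i : Fin k, u i.castSucc ≠ u i.succ) ∧
    ∃ σ : Fin (n + 1) →o Fin (k + 1), Function.Surjective σ ∧ v = u ∘ σ

lemma RegularPathComplex.isReg_init {V : Type u} (P : RegularPathComplex V) {n k : ℕ}
    {v : Fin (n + 2) → V} {u : Fin (k + 1) → V} (hu : u ∈ P.P k) (h : IsReg v u) :
    ∃ k', ∃ u' ∈ P.P k', IsReg (fun i : Fin (n + 1) => v i.castSucc) u' := by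
  obtain ⟨hreg, σ, hσ, rfl⟩ := h
  by_cases hs : ∃ i : Fin (n + 1), σ i.castSucc = Fin.last k
  · refine ⟨k, u, hu, hreg, σ.comp Fin.castSuccOrderEmb.toOrderHom, fun a => ?_, rfl⟩
    obtain ⟨b, hb⟩ := hσ a
    induction b using Fin.lastCases with
    | last =>
      obtain ⟨i, hi⟩ := hs
      refine ⟨i, le_antisymm ?_ ?_⟩
      · rw [← hb]
        exact σ.monotone (Fin.le_last _)
      · exact (Fin.le_last a).trans hi.ge
    | cast i => exact ⟨i, hb⟩
  · push Not at hs
    cases k with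
    | zero => exact absurd (Fin.ext (by simp)) (hs 0)
    | succ k =>
      refine ⟨k, fun i => u i.castSucc, P.init_mem k u hu, P.regular _ _ (P.init_mem k u hu),
        ⟨fun i => (σ i.castSucc).castPred (hs i), fun a b hab => ?_⟩, fun a => ?_, ?_⟩
      · exact Fin.castPred_le_castPred (σ.monotone (Fin.castSucc_le_castSucc_iff.2 hab))
          (hs b)
      · obtain ⟨b, hb⟩ := hσ a.castSucc
        induction b using Fin.lastCases with
        | last =>
          obtain ⟨c, hc⟩ := hσ (Fin.last (k + 1))
          have h1 := σ.monotone (Fin.le_last c)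
          rw [hb, hc] at h1
          exact absurd h1 (not_le.2 (Fin.castSucc_lt_last a))
        | cast i =>
          exact ⟨i, Fin.ext (congrArg Fin.val hb : (σ i.castSucc : ℕ) = a)⟩
      · exact funext fun i => congrArg u (Fin.castSucc_castPred (σ i.castSucc) (hs i)).symm

lemma RegularPathComplex.isReg_tail {V : Type u} (P : RegularPathComplex V) {n k : ℕ}
    {v : Fin (n + 2) → V} {u : Fin (k + 1) → V} (hu : u ∈ P.P k) (h : IsReg v u) :
    ∃ k', ∃ u' ∈ P.P k', IsReg (fun i : Fin (n + 1) => v i.succ) u' := by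
  obtain ⟨hreg, σ, hσ, rfl⟩ := h
  by_cases hs : ∃ i : Fin (n + 1), σ i.succ = 0
  · refine ⟨k, u, hu, hreg, σ.comp (Fin.succOrderEmb _).toOrderHom, fun a => ?_, rfl⟩
    obtain ⟨b, hb⟩ := hσ a
    induction b using Fin.cases with
    | zero =>
      obtain ⟨i, hi⟩ := hs
      refine ⟨i, le_antisymm ?_ ?_⟩
      · exact hi.le.trans (Fin.zero_le a)
      · rw [← hb]
        exact σ.monotone (Fin.zero_le _)
    | succ i => exact ⟨i, hb⟩
  · push Not at hs
    cases k with
    | zero => exact absurd (Fin.ext (by simp)) (hs 0)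
    | succ k =>
      refine ⟨k, fun i => u i.succ, P.tail_mem k u hu, P.regular _ _ (P.tail_mem k u hu),
        ⟨fun i => (σ i.succ).pred (hs i), fun a b hab => ?_⟩, fun a => ?_, ?_⟩
      · exact Fin.pred_le_pred_iff.2 (σ.monotone (Fin.succ_le_succ_iff.2 hab))
      · obtain ⟨b, hb⟩ := hσ a.succ
        induction b using Fin.cases with
        | zero =>
          obtain ⟨c, hc⟩ := hσ 0
          have h1 := σ.monotone (Fin.zero_le c)
          rw [hb, hc] at h1
          exact absurd h1 (not_le.2 (Fin.succ_pos a))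
        | succ i =>
          exact ⟨i, Fin.succ_injective _ ((Fin.succ_pred (σ i.succ) (hs i)).trans hb)⟩
      · exact funext fun i => congrArg u (Fin.succ_pred (σ i.succ) (hs i)).symm

/-- The regular box product `P □_reg P'` on the vertex set `V × V'`: the regular sequences
`(vᵢ, v'ᵢ)` that are step-like (for each `i`, `vᵢ = vᵢ₊₁` or `v'ᵢ = v'ᵢ₊₁`) and satisfy
`v_reg ∈ Pₖ` and `v'_reg ∈ P'ₗ` for some `k`, `l` (necessarily `k, l ≤ n`). -/
def RegularPathComplex.box {V V' : Type u} (P : RegularPathComplex V)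
    (P' : RegularPathComplex V') : RegularPathComplex (V × V') where
  P n := {w | (∀ i : Fin n, w i.castSucc ≠ w i.succ) ∧
    (∀ i : Fin n, (w i.castSucc).1 = (w i.succ).1 ∨ (w i.castSucc).2 = (w i.succ).2) ∧
    (∃ k, ∃ u ∈ P.P k, IsReg (fun i => (w i).1) u) ∧
    (∃ l, ∃ u' ∈ P'.P l, IsReg (fun i => (w i).2) u')}
  init_mem n := by
    rintro w ⟨h1, h2, ⟨k, u, hu, h⟩, l, u', hu', h'⟩
    exact ⟨fun i => h1 i.castSucc, fun i => h2 i.castSucc, P.isReg_init hu h,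
      P'.isReg_init hu' h'⟩
  tail_mem n := by
    rintro w ⟨h1, h2, ⟨k, u, hu, h⟩, l, u', hu', h'⟩
    exact ⟨fun i => h1 i.succ, fun i => h2 i.succ, P.isReg_tail hu h, P'.isReg_tail hu' h'⟩
  regular n w hw := hw.1

end

/-! Normalized chains of a simplicial set are free on the simplices without flat step, and the span
of a path subset is generated by part of this basis. The shuffle map `nabla`, N K[X]ₖ ⊗ N K[X']ₗ → N
K[X × X']ₖ₊ₗ, is a chain map (`d_nabla`). Its left inverse is given by the front-face/back-face
components `frontBack`: among all shuffle paths, only the one that crosses Δ[k] before Δ[l] has both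
a nondegenerate front face and a nondegenerate back face (`frontBack_nabla_self`,
`frontBack_nabla_ne`).

The heart of the proof is that on Ω the shuffle map is also onto. Every simplex of Y ⋄ Y' is
step-like: along each step one of its two components rests. Let y be a combination of step-like
simplices whose boundary is again one. A simplex (a, b) with a diagonal step r, along which both
components move, is not step-like, and it is a face of exactly two step-like simplices, the two ways
around the corner. Its coefficient in ∂y vanishes, so these two have opposite coefficients in y
(`coeff_flip`). Flipping corners leads from any step-like simplex to one that moves first in X and
then in X', and the coefficient of such a simplex is visible in the front and back faces of y. So y
is determined by these faces (`clsMap_eq_zero_of_frontBack`) and is the shuffle product of them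
(`eq_nablaSum`).

It remains that for y in Ω(S □ S') the components of `frontBack` lie in ΩS ⊗ ΩS'
(`frontBack_mem_range_omegaIncl₂`). They lie in K[Y] ⊗ K[Y'], and comparing them with the components
of ∂y modulo K[Y] or modulo K[Y'] shows that each factor satisfies its own boundary condition.
Flatness over the principal ideal domain turns this into membership in the tensor product of the two
intersections (`mem_range_mapIncl_inf_ker`). This yields `shuffleIso`, which is (1).

For (2), ΩS is a complex of projective modules, since submodules of projectives are projective, and
the algebraic Künneth sequence applies (`kunneth`). There Tor is the kernel of Hᵢ ⊗ Bⱼ → Hᵢ ⊗ Zⱼ,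
and a cycle is sent to it by applying 1 ⊗ ∂ to its component of bidegree (i, j + 1).

For (3), a regular path complex becomes a path pair on cosk₀ V once repetitions of vertices are
allowed. This does not change Ω, which sees only simplices without flat step, and on these the
regular box product agrees with Y ⋄ Y' (`RegularPathComplex.mem_box_iff`). -/

noncomputable section

open Simplicial

/-! ## Evaluation of simplicial operators at natural numbers -/

namespace SimplexCategory

/-- The value of a simplicial operator at a natural number, which is truncated to the source. -/
def ev {n m : ℕ} (θ : ⦋n⦌ ⟶ ⦋m⦌) (i : ℕ) : ℕ :=
  (θ.toOrderHom (⟨min i n, Nat.lt_succ_of_le (min_le_right i n)⟩ : Fin (n + 1)) : Fin (m + 1)).val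

lemma ev_val {n m : ℕ} (θ : ⦋n⦌ ⟶ ⦋m⦌) (i : Fin (n + 1)) :
    ev θ i = (θ.toOrderHom i : Fin (m + 1)).val := by
  have h : (⟨min i n, Nat.lt_succ_of_le (min_le_right i.val n)⟩ : Fin (n + 1)) = i :=
    Fin.ext (min_eq_left (Nat.lt_succ_iff.1 i.2))
  exact congrArg (fun a : Fin (n + 1) => (θ.toOrderHom a : Fin (m + 1)).val) h

lemma ev_le {n m : ℕ} (θ : ⦋n⦌ ⟶ ⦋m⦌) (i : ℕ) : ev θ i ≤ m :=
  Nat.lt_succ_iff.1 (Fin.is_lt _)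

lemma ev_mono {n m : ℕ} (θ : ⦋n⦌ ⟶ ⦋m⦌) {i j : ℕ} (h : i ≤ j) : ev θ i ≤ ev θ j :=
  θ.toOrderHom.monotone (Fin.mk_le_mk.2 (min_le_min_right n h))

/-- Reduces equalities of simplicial operators to arithmetic of natural numbers, free of casts
between the types `Fin`. -/
lemma hom_ext_ev {n m : ℕ} {θ ψ : ⦋n⦌ ⟶ ⦋m⦌} (h : ∀ i ≤ n, ev θ i = ev ψ i) : θ = ψ := by
  refine SimplexCategory.Hom.ext _ _ (OrderHom.ext _ _ (funext fun i => Fin.ext ?_))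
  have := h i.val (Nat.lt_succ_iff.1 i.2)
  rwa [ev_val θ i, ev_val ψ i] at this

lemma ev_comp {n m k : ℕ} (θ : ⦋n⦌ ⟶ ⦋m⦌) (ψ : ⦋m⦌ ⟶ ⦋k⦌) (i : ℕ) :
    ev (θ ≫ ψ) i = ev ψ (ev θ i) := by
  exact (ev_val ψ (θ.toOrderHom
    (⟨min i n, Nat.lt_succ_of_le (min_le_right i n)⟩ : Fin (n + 1)) : Fin (m + 1))).symm

lemma ev_id {n i : ℕ} (h : i ≤ n) : ev (𝟙 ⦋n⦌) i = i := min_eq_left h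

/-- The simplicial operator given by a monotone function on natural numbers. -/
def ofNat (n m : ℕ) (f : ℕ → ℕ) (hf : ∀ i j, i ≤ j → j ≤ n → f i ≤ f j) (h : f n ≤ m) :
    ⦋n⦌ ⟶ ⦋m⦌ :=
  mkHom
    { toFun := fun i => ⟨f i, Nat.lt_succ_of_le
        ((hf i n (Nat.lt_succ_iff.1 i.2) le_rfl).trans h)⟩
      monotone' := fun i j hij => hf i j hij (Nat.lt_succ_iff.1 j.2) }

lemma ev_ofNat {n m : ℕ} {f : ℕ → ℕ} {hf : ∀ i j, i ≤ j → j ≤ n → f i ≤ f j} {h : f n ≤ m} {i : ℕ}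
    (hi : i ≤ n) : ev (ofNat n m f hf h) i = f i := by
  have := ev_val (ofNat n m f hf h) ⟨i, Nat.lt_succ_of_le hi⟩
  exact this

lemma ev_δ {n : ℕ} (j : Fin (n + 2)) {i : ℕ} (hi : i ≤ n) :
    ev (δ j) i = if i < j.val then i else i + 1 := by
  have := ev_val (δ j) ⟨i, Nat.lt_succ_of_le hi⟩
  refine this.trans ?_
  change (j.succAbove ⟨i, _⟩).val = _
  simp only [Fin.succAbove, Fin.lt_def]
  split_ifs <;> simp_all

lemma ev_σ {n : ℕ} (j : Fin (n + 1)) {i : ℕ} (hi : i ≤ n + 1) :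
    ev (σ j) i = if i ≤ j.val then i else i - 1 := by
  have := ev_val (σ j) ⟨i, Nat.lt_succ_of_le hi⟩
  refine this.trans ?_
  change (j.predAbove ⟨i, _⟩).val = _
  simp only [Fin.predAbove, Fin.lt_def, Fin.val_castSucc]
  split_ifs <;> simp <;> omega

/-- The extension of an operator to one more vertex, which goes to the last vertex. -/
def snocLast {n k : ℕ} (p : ⦋n⦌ ⟶ ⦋k⦌) : ⦋n + 1⦌ ⟶ ⦋k⦌ :=
  ofNat (n + 1) k (fun i => if i ≤ n then ev p i else k)
    (fun i j hij hj => by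
      split_ifs
      · exact ev_mono p hij
      · exact ev_le p i
      · omega
      · exact le_rfl)
    (by simp)

lemma ev_snocLast {n k : ℕ} (p : ⦋n⦌ ⟶ ⦋k⦌) {i : ℕ} (hi : i ≤ n) : ev (snocLast p) i = ev p i := by
  rw [snocLast, ev_ofNat (by omega), if_pos hi]

lemma ev_snocLast_last {n k : ℕ} (p : ⦋n⦌ ⟶ ⦋k⦌) : ev (snocLast p) (n + 1) = k := by
  rw [snocLast, ev_ofNat le_rfl, if_neg (by omega)]

lemma ev_snocLast_eq {n k : ℕ} (p : ⦋n⦌ ⟶ ⦋k⦌) {i : ℕ} (hi : i ≤ n + 1) :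
    ev (snocLast p) i = if i ≤ n then ev p i else k := by
  rw [snocLast, ev_ofNat hi]

/-- A face that keeps the appended vertex acts on the old vertices only; the one that deletes it is
treated in `δ_last_snocLast`. This dichotomy drives the induction for the boundary of the shuffle
chain. -/
lemma δ_castSucc_snocLast {n k : ℕ} (j : Fin (n + 2)) (p : ⦋n + 1⦌ ⟶ ⦋k⦌) :
    δ j.castSucc ≫ snocLast p = snocLast (δ j ≫ p) := by
  have hj := j.2
  refine hom_ext_ev fun i hi => ?_
  rw [ev_comp, ev_δ _ hi, ev_snocLast_eq _ hi, Fin.val_castSucc]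
  by_cases h : i ≤ n
  · rw [if_pos h, ev_comp, ev_δ _ h, ev_snocLast_eq _ (by split_ifs <;> omega),
      if_pos (by split_ifs <;> omega)]
  · rw [if_neg h, if_neg (by omega), ev_snocLast_eq _ (by omega), if_neg (by omega)]

lemma δ_last_snocLast {n k : ℕ} (p : ⦋n⦌ ⟶ ⦋k⦌) :
    δ (Fin.last (n + 1)) ≫ snocLast p = p := by
  refine hom_ext_ev fun i hi => ?_
  rw [ev_comp, ev_δ _ hi, if_pos (by simp; omega), ev_snocLast _ hi]

lemma snocLast_δ_castSucc {n k : ℕ} (p : ⦋n⦌ ⟶ ⦋k⦌) (j : Fin (k + 1)) :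
    snocLast p ≫ δ j.castSucc = snocLast (p ≫ δ j.castSucc) := by
  have hj := j.2
  refine hom_ext_ev fun i hi => ?_
  rw [ev_comp, ev_snocLast_eq _ hi, ev_snocLast_eq _ hi]
  split_ifs with h
  · rw [ev_comp]
  · rw [ev_δ _ le_rfl, if_neg (by simp; omega)]

lemma δ_last_δ_castSucc {k : ℕ} (j : Fin (k + 2)) :
    (δ (Fin.last (k + 1)) : ⦋k⦌ ⟶ _) ≫ δ j.castSucc = δ j ≫ δ (Fin.last (k + 2)) := by
  have hj := j.2
  refine hom_ext_ev fun i hi => ?_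
  rw [ev_comp, ev_comp, ev_δ _ hi, ev_δ _ hi, if_pos (by simp; omega), ev_δ _ (by omega),
    ev_δ _ (by split_ifs <;> omega)]
  simp
  split_ifs <;> omega

end SimplexCategory

/-! ## The universal shuffle chain -/

namespace ShuffleChain

open SimplexCategory

/-- The `n`-simplices of `Δ[k] × Δ[l]`. -/
abbrev Grid (n k l : ℕ) : Type := (⦋n⦌ ⟶ ⦋k⦌) × (⦋n⦌ ⟶ ⦋l⦌)

/-- A grid path in `Δ[k] × Δ[l + 1]` obtained by adding a last step in the second direction. -/
def snocSnd {n k l : ℕ} (z : Grid n k l) : Grid (n + 1) k (l + 1) :=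
  (snocLast z.1, snocLast (z.2 ≫ δ (Fin.last (l + 1))))

/-- A grid path in `Δ[k + 1] × Δ[l]` obtained by adding a last step in the first direction. -/
def snocFst {n k l : ℕ} (z : Grid n k l) : Grid (n + 1) (k + 1) l :=
  (snocLast (z.1 ≫ δ (Fin.last (k + 1))), snocLast z.2)

/-- The faces of a simplex of `Δ[k] × Δ[l]`. -/
def face {n k l : ℕ} (j : Fin (n + 2)) (z : Grid (n + 1) k l) : Grid n k l :=
  (δ j ≫ z.1, δ j ≫ z.2)

/-- The inclusion `Δ[k] × Δ[l] → Δ[k + 1] × Δ[l]` of a face. -/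
def cofaceFst {n k l : ℕ} (j : Fin (k + 2)) (z : Grid n k l) : Grid n (k + 1) l :=
  (z.1 ≫ δ j, z.2)

/-- The inclusion `Δ[k] × Δ[l] → Δ[k] × Δ[l + 1]` of a face. -/
def cofaceSnd {n k l : ℕ} (j : Fin (l + 2)) (z : Grid n k l) : Grid n k (l + 1) :=
  (z.1, z.2 ≫ δ j)

section identities

variable {n k l : ℕ}

lemma face_castSucc_snocSnd (j : Fin (n + 2)) (z : Grid (n + 1) k l) :
    face j.castSucc (snocSnd z) = snocSnd (face j z) := by
  simp only [face, snocSnd, δ_castSucc_snocLast, Category.assoc]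

lemma face_castSucc_snocFst (j : Fin (n + 2)) (z : Grid (n + 1) k l) :
    face j.castSucc (snocFst z) = snocFst (face j z) := by
  simp only [face, snocFst, δ_castSucc_snocLast, Category.assoc]

lemma face_last_snocSnd (z : Grid n k l) :
    face (Fin.last (n + 1)) (snocSnd z) = cofaceSnd (Fin.last (l + 1)) z := by
  simp only [face, snocSnd, δ_last_snocLast, cofaceSnd]

lemma face_last_snocFst (z : Grid n k l) :
    face (Fin.last (n + 1)) (snocFst z) = cofaceFst (Fin.last (k + 1)) z := by
  simp only [face, snocFst, δ_last_snocLast, cofaceFst]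

lemma cofaceFst_castSucc_snocSnd (j : Fin (k + 1)) (z : Grid n k l) :
    cofaceFst j.castSucc (snocSnd z) = snocSnd (cofaceFst j.castSucc z) := by
  simp only [cofaceFst, snocSnd, snocLast_δ_castSucc]

lemma cofaceSnd_castSucc_snocFst (j : Fin (l + 1)) (z : Grid n k l) :
    cofaceSnd j.castSucc (snocFst z) = snocFst (cofaceSnd j.castSucc z) := by
  simp only [cofaceSnd, snocFst, snocLast_δ_castSucc]

lemma cofaceFst_castSucc_snocFst (j : Fin (k + 2)) (z : Grid n k l) :
    cofaceFst j.castSucc (snocFst z) = snocFst (cofaceFst j z) := by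
  simp only [cofaceFst, snocFst, snocLast_δ_castSucc, Category.assoc, δ_last_δ_castSucc]

lemma cofaceSnd_castSucc_snocSnd (j : Fin (l + 2)) (z : Grid n k l) :
    cofaceSnd j.castSucc (snocSnd z) = snocSnd (cofaceSnd j z) := by
  simp only [cofaceSnd, snocSnd, snocLast_δ_castSucc, Category.assoc, δ_last_δ_castSucc]

end identities

variable (K : Type u) [CommRing K]

/-- Chains of grid simplices. -/
abbrev Chain (n k l : ℕ) : Type u := Grid n k l →₀ K

/-- The linear map of chains induced by a map of grid simplices. -/
abbrev push {n k l n' k' l' : ℕ} (f : Grid n k l → Grid n' k' l') :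
    Chain K n k l →ₗ[K] Chain K n' k' l' :=
  Finsupp.lmapDomain K K f

/-- The boundary of a grid chain. -/
def bd {n k l : ℕ} : Chain K (n + 1) k l →ₗ[K] Chain K n k l :=
  ∑ j : Fin (n + 2), (-1 : K) ^ (j : ℕ) • push K (face j)

/-- The alternating sum of the face inclusions in the first direction. -/
def cobdFst {n k l : ℕ} : Chain K n k l →ₗ[K] Chain K n (k + 1) l :=
  ∑ j : Fin (k + 2), (-1 : K) ^ (j : ℕ) • push K (cofaceFst j)

/-- The alternating sum of the face inclusions in the second direction. -/
def cobdSnd {n k l : ℕ} : Chain K n k l →ₗ[K] Chain K n k (l + 1) :=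
  ∑ j : Fin (l + 2), (-1 : K) ^ (j : ℕ) • push K (cofaceSnd j)

/-- The alternating sum of all but the last face inclusion in the first direction. -/
def cobdFstInit {n k l : ℕ} : Chain K n k l →ₗ[K] Chain K n (k + 1) l :=
  ∑ j : Fin (k + 1), (-1 : K) ^ (j : ℕ) • push K (cofaceFst j.castSucc)

/-- The alternating sum of all but the last face inclusion in the second direction. -/
def cobdSndInit {n k l : ℕ} : Chain K n k l →ₗ[K] Chain K n k (l + 1) :=
  ∑ j : Fin (l + 1), (-1 : K) ^ (j : ℕ) • push K (cofaceSnd j.castSucc)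

section formulas

variable {n k l : ℕ}

lemma push_push {n k l n' k' l' n'' k'' l'' : ℕ} (f : Grid n k l → Grid n' k' l')
    (g : Grid n' k' l' → Grid n'' k'' l'') (x : Chain K n k l) :
    push K g (push K f x) = push K (fun z => g (f z)) x :=
  (LinearMap.congr_fun (Finsupp.lmapDomain_comp K K f g) x).symm

lemma bd_snocSnd (x : Chain K (n + 1) k l) :
    bd K (push K snocSnd x) = push K snocSnd (bd K x) +
      (-1 : K) ^ n • push K (cofaceSnd (Fin.last (l + 1))) x := by
  simp only [bd, LinearMap.sum_apply, LinearMap.smul_apply, push_push, map_sum, map_smul]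
  rw [Fin.sum_univ_castSucc]
  simp only [face_castSucc_snocSnd, face_last_snocSnd, Fin.val_castSucc, Fin.val_last, pow_add]
  simp

lemma bd_snocFst (x : Chain K (n + 1) k l) :
    bd K (push K snocFst x) = push K snocFst (bd K x) +
      (-1 : K) ^ n • push K (cofaceFst (Fin.last (k + 1))) x := by
  simp only [bd, LinearMap.sum_apply, LinearMap.smul_apply, push_push, map_sum, map_smul]
  rw [Fin.sum_univ_castSucc]
  simp only [face_castSucc_snocFst, face_last_snocFst, Fin.val_castSucc, Fin.val_last, pow_add]
  simp

lemma cobdFst_eq (x : Chain K n k l) :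
    cobdFst K x = cobdFstInit K x + (-1 : K) ^ (k + 1) • push K (cofaceFst (Fin.last (k + 1))) x := by
  simp only [cobdFst, cobdFstInit, LinearMap.sum_apply, LinearMap.smul_apply]
  rw [Fin.sum_univ_castSucc]
  simp only [Fin.val_castSucc, Fin.val_last]

lemma cobdSnd_eq (x : Chain K n k l) :
    cobdSnd K x = cobdSndInit K x + (-1 : K) ^ (l + 1) • push K (cofaceSnd (Fin.last (l + 1))) x := by
  simp only [cobdSnd, cobdSndInit, LinearMap.sum_apply, LinearMap.smul_apply]
  rw [Fin.sum_univ_castSucc]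
  simp only [Fin.val_castSucc, Fin.val_last]

lemma cobdFstInit_snocSnd (x : Chain K n k l) :
    cobdFstInit K (push K snocSnd x) = push K snocSnd (cobdFstInit K x) := by
  simp only [cobdFstInit, LinearMap.sum_apply, LinearMap.smul_apply, push_push, map_sum, map_smul,
    cofaceFst_castSucc_snocSnd]

lemma cobdSndInit_snocFst (x : Chain K n k l) :
    cobdSndInit K (push K snocFst x) = push K snocFst (cobdSndInit K x) := by
  simp only [cobdSndInit, LinearMap.sum_apply, LinearMap.smul_apply, push_push, map_sum, map_smul,
    cofaceSnd_castSucc_snocFst]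

lemma cobdFstInit_snocFst (x : Chain K n k l) :
    cobdFstInit K (push K snocFst x) = push K snocFst (cobdFst K x) := by
  simp only [cobdFst, cobdFstInit, LinearMap.sum_apply, LinearMap.smul_apply, push_push, map_sum,
    map_smul, cofaceFst_castSucc_snocFst]

lemma cobdSndInit_snocSnd (x : Chain K n k l) :
    cobdSndInit K (push K snocSnd x) = push K snocSnd (cobdSnd K x) := by
  simp only [cobdSnd, cobdSndInit, LinearMap.sum_apply, LinearMap.smul_apply, push_push, map_sum,
    map_smul, cofaceSnd_castSucc_snocSnd]

/-- Both sides append a diagonal step to `z`. The terms of this form cancel in the boundary of the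
shuffle chain. -/
lemma snocSnd_cofaceFst_last (z : Grid n k l) :
    snocSnd (cofaceFst (Fin.last (k + 1)) z) = snocFst (cofaceSnd (Fin.last (l + 1)) z) := rfl

lemma snocSnd_cofaceFst_last_push (x : Chain K n k l) :
    push K snocSnd (push K (cofaceFst (Fin.last (k + 1))) x) =
      push K snocFst (push K (cofaceSnd (Fin.last (l + 1))) x) := by
  simp only [push_push, snocSnd_cofaceFst_last]

end formulas

/-- The signed sum of all shuffle paths in `Δ[k] × Δ[l]`; it is zero unless `n = k + l`. -/
def shuffles (n k l : ℕ) : Chain K n k l :=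
  match n, k, l with
  | 0, 0, 0 => Finsupp.single (𝟙 _, 𝟙 _) 1
  | 0, 0, _ + 1 => 0
  | 0, _ + 1, _ => 0
  | _ + 1, 0, 0 => 0
  | n + 1, 0, l + 1 => push K snocSnd (shuffles n 0 l)
  | n + 1, k + 1, 0 => push K snocFst (shuffles n k 0)
  -- The sign counts the `l + 1` steps in the second direction that precede the appended step in the
  -- first direction.
  | n + 1, k + 1, l + 1 => push K snocSnd (shuffles n (k + 1) l) +
      (-1 : K) ^ (l + 1) • push K snocFst (shuffles n k (l + 1))

/-- The sum of the first-direction faces of the shuffle chains. -/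
def facesFst (n k l : ℕ) : Chain K n k l :=
  match k, l with
  | 0, _ => 0
  | k + 1, l => cobdFst K (shuffles K n k l)

/-- The sum of the second-direction faces of the shuffle chains. -/
def facesSnd (n k l : ℕ) : Chain K n k l :=
  match k, l with
  | _, 0 => 0
  | k, l + 1 => cobdSnd K (shuffles K n k l)

/-- The last coface is split off. The others commute with appending a step in the second direction,
and under `snocFst` they reassemble to the full coface sum one dimension lower. -/
lemma facesFst_succ (n k l : ℕ) :
    facesFst K (n + 1) (k + 1) (l + 1) = push K snocSnd (cobdFstInit K (shuffles K n k l)) +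
      (-1 : K) ^ (l + 1) • push K snocFst (facesFst K n k (l + 1)) +
      (-1 : K) ^ (k + 1) • push K (cofaceFst (Fin.last (k + 1))) (shuffles K (n + 1) k (l + 1)) := by
  rw [facesFst, cobdFst_eq]
  congr 1
  cases k with
  | zero => simp only [shuffles, facesFst, map_zero, smul_zero, add_zero, cobdFstInit_snocSnd]
  | succ k => simp only [shuffles, facesFst, map_add, map_smul, cobdFstInit_snocSnd,
      cobdFstInit_snocFst]

lemma facesSnd_succ (n k l : ℕ) :
    facesSnd K (n + 1) (k + 1) (l + 1) = push K snocSnd (facesSnd K n (k + 1) l) +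
      (-1 : K) ^ l • push K snocFst (cobdSndInit K (shuffles K n k l)) +
      (-1 : K) ^ (l + 1) • push K (cofaceSnd (Fin.last (l + 1))) (shuffles K (n + 1) (k + 1) l) := by
  rw [facesSnd, cobdSnd_eq]
  congr 1
  cases l with
  | zero => simp only [shuffles, facesSnd, map_zero, zero_add, cobdSndInit_snocFst, pow_zero,
      one_smul]
  | succ l => simp only [shuffles, facesSnd, map_add, map_smul, cobdSndInit_snocSnd,
      cobdSndInit_snocFst]

lemma facesFst_succ_zero (n k : ℕ) :
    facesFst K (n + 1) (k + 1) 0 = push K snocFst (facesFst K n k 0) +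
      (-1 : K) ^ (k + 1) • push K (cofaceFst (Fin.last (k + 1))) (shuffles K (n + 1) k 0) := by
  rw [facesFst, cobdFst_eq]
  congr 1
  cases k with
  | zero => simp [shuffles, facesFst]
  | succ k => simp only [shuffles, facesFst, cobdFstInit_snocFst]

lemma facesSnd_zero_succ (n l : ℕ) :
    facesSnd K (n + 1) 0 (l + 1) = push K snocSnd (facesSnd K n 0 l) +
      (-1 : K) ^ (l + 1) • push K (cofaceSnd (Fin.last (l + 1))) (shuffles K (n + 1) 0 l) := by
  rw [facesSnd, cobdSnd_eq]
  congr 1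
  cases l with
  | zero => simp [shuffles, facesSnd]
  | succ l => simp only [shuffles, facesSnd, cobdSndInit_snocSnd]

/-- The boundary of the shuffle chain of `Δ[k] × Δ[l]`. -/
lemma bd_shuffles (n : ℕ) : ∀ k l : ℕ, k + l = n + 1 →
    bd K (shuffles K (n + 1) k l) = facesFst K n k l + (-1 : K) ^ k • facesSnd K n k l := by
  induction n with
  | zero =>
    intro k l h
    obtain ⟨rfl, rfl⟩ | ⟨rfl, rfl⟩ : (k = 0 ∧ l = 1) ∨ (k = 1 ∧ l = 0) := by omega
    -- `face_castSucc_snocSnd` needs a simplex of positive dimension, so the first face of a single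
    -- step is computed by hand.
    · have h0 (z : Grid 0 0 0) : face 0 (snocSnd z) = cofaceSnd 0 z :=
        Prod.ext (Subsingleton.elim _ _) (hom_ext_ev fun i hi => by
          obtain rfl : i = 0 := by omega
          have := ev_le z.2 0
          simp only [face, snocSnd, cofaceSnd, ev_comp]
          rw [ev_δ _ le_rfl, if_neg (by simp), ev_snocLast_last, ev_δ _ this, if_neg (by simp)]
          omega)
      have h1 (z : Grid 0 0 0) : face 1 (snocSnd z) = cofaceSnd 1 z := face_last_snocSnd z
      simp [facesFst, facesSnd, shuffles, bd, cobdSnd, Fin.sum_univ_two, h0, h1]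
    · have h0 (z : Grid 0 0 0) : face 0 (snocFst z) = cofaceFst 0 z :=
        Prod.ext (hom_ext_ev fun i hi => by
          obtain rfl : i = 0 := by omega
          have := ev_le z.1 0
          simp only [face, snocFst, cofaceFst, ev_comp]
          rw [ev_δ _ le_rfl, if_neg (by simp), ev_snocLast_last, ev_δ _ this, if_neg (by simp)]
          omega) (Subsingleton.elim _ _)
      have h1 (z : Grid 0 0 0) : face 1 (snocFst z) = cofaceFst 1 z := face_last_snocFst z
      simp [facesFst, facesSnd, shuffles, bd, cobdFst, Fin.sum_univ_two, h0, h1]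
  | succ n ih =>
    intro k l h
    rcases k with _ | k <;> rcases l with _ | l
    · omega
    · rw [facesSnd_zero_succ, facesFst, shuffles, bd_snocSnd, ih 0 l (by omega), facesFst]
      obtain rfl : l = n + 1 := by omega
      simp [pow_add]
    · rw [facesFst_succ_zero, facesSnd, shuffles, bd_snocFst, ih k 0 (by omega), facesSnd]
      obtain rfl : k = n + 1 := by omega
      simp [pow_add]
    · rw [shuffles, map_add, map_smul, bd_snocSnd, bd_snocFst, ih (k + 1) l (by omega),
        ih k (l + 1) (by omega), facesFst_succ, facesSnd_succ]
      -- The sum over paths with appended diagonal step appears once from each summand of the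
      -- recursion, with opposite signs. Since `n = k + l`, all signs depend only on the parities of
      -- `k` and `l`.
      simp only [facesFst, facesSnd, cobdFst_eq, cobdSnd_eq, map_add, map_smul,
        snocSnd_cofaceFst_last_push]
      obtain rfl : n = k + l := by omega
      have h1 : ((-1 : K) ^ k) * (-1) ^ k = 1 := by rw [← pow_add, ← two_mul]; simp
      have h2 : ((-1 : K) ^ l) * (-1) ^ l = 1 := by rw [← pow_add, ← two_mul]; simp
      rcases neg_one_pow_eq_or K k with hk | hk <;> rcases neg_one_pow_eq_or K l with hl | hl <;>
      · simp only [pow_succ, pow_add, hk, hl]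
        module

/-- A simplex of `Δ[k] × Δ[l]` is a shuffle path if each of its steps moves by one in exactly one of
the two directions. -/
def IsPath {n k l : ℕ} (z : Grid n k l) : Prop :=
  k + l = n ∧ ∀ j ≤ n, ev z.1 j + ev z.2 j = j

lemma ev_comp_δ_last {n k : ℕ} (p : ⦋n⦌ ⟶ ⦋k⦌) (i : ℕ) :
    ev (p ≫ δ (Fin.last (k + 1))) i = ev p i := by
  have := ev_le p i
  rw [ev_comp, ev_δ _ this, if_pos (by simp; omega)]

lemma comp_δ_last_injective {n k : ℕ} {p q : ⦋n⦌ ⟶ ⦋k⦌}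
    (h : p ≫ δ (Fin.last (k + 1)) = q ≫ δ (Fin.last (k + 1))) : p = q :=
  hom_ext_ev fun i _ => by rw [← ev_comp_δ_last p, h, ev_comp_δ_last]

lemma snocLast_injective {n k : ℕ} {p q : ⦋n⦌ ⟶ ⦋k⦌} (h : snocLast p = snocLast q) : p = q := by
  rw [← δ_last_snocLast p, h, δ_last_snocLast]

lemma IsPath.snocSnd {n k l : ℕ} {z : Grid n k l} (h : IsPath z) : IsPath (snocSnd z) := by
  refine ⟨by rw [← h.1, add_assoc], fun j hj => ?_⟩
  have h1 := h.1
  simp only [ShuffleChain.snocSnd, ev_snocLast_eq _ hj, ev_comp_δ_last]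
  split_ifs with hn
  · exact h.2 j hn
  · omega

lemma IsPath.snocFst {n k l : ℕ} {z : Grid n k l} (h : IsPath z) : IsPath (snocFst z) := by
  refine ⟨by rw [← h.1, add_right_comm], fun j hj => ?_⟩
  have h1 := h.1
  simp only [ShuffleChain.snocFst, ev_snocLast_eq _ hj, ev_comp_δ_last]
  split_ifs with hn
  · exact h.2 j hn
  · omega

lemma push_mem_supported {n k l n' k' l' : ℕ} {f : Grid n k l → Grid n' k' l'}
    {s : Set (Grid n k l)} {t : Set (Grid n' k' l')} (h : ∀ z ∈ s, f z ∈ t) {x : Chain K n k l}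
    (hx : x ∈ Finsupp.supported K K s) : push K f x ∈ Finsupp.supported K K t := by
  have h1 : push K f x ∈ (Finsupp.supported K K s).map (Finsupp.lmapDomain K K f) := ⟨x, hx, rfl⟩
  rw [Finsupp.lmapDomain_supported] at h1
  exact Finsupp.supported_mono (Set.image_subset_iff.2 h) h1

/-- The shuffle chain is a combination of shuffle paths. -/
lemma shuffles_mem_supported (n : ℕ) : ∀ k l : ℕ,
    shuffles K n k l ∈ Finsupp.supported K K {z | IsPath z} := by
  induction n with
  | zero =>
    intro k l
    rcases k with _ | k <;> rcases l with _ | l <;> simp only [shuffles, Submodule.zero_mem]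
    refine Finsupp.single_mem_supported _ _ ⟨rfl, fun j hj => ?_⟩
    obtain rfl : j = 0 := by omega
    rfl
  | succ n ih =>
    intro k l
    rcases k with _ | k <;> rcases l with _ | l <;> simp only [shuffles, Submodule.zero_mem]
    · exact push_mem_supported K (fun z hz => IsPath.snocSnd hz) (ih 0 l)
    · exact push_mem_supported K (fun z hz => IsPath.snocFst hz) (ih k 0)
    · exact Submodule.add_mem _
        (push_mem_supported K (fun z hz => IsPath.snocSnd hz) (ih (k + 1) l))
        (Submodule.smul_mem _ _
          (push_mem_supported K (fun z hz => IsPath.snocFst hz) (ih k (l + 1))))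

lemma IsPath.of_mem_support {n k l : ℕ} {z : Grid n k l} (h : z ∈ (shuffles K n k l).support) :
    IsPath z :=
  (Finsupp.mem_supported K _).1 (shuffles_mem_supported K n k l) h

/-- The path that first makes all steps in the first direction. -/
def stdPath (n k l : ℕ) (h : k + l = n) : Grid n k l :=
  (ofNat n k (fun i => min i k) (fun i j hij _ => min_le_min_right k hij) (min_le_right n k),
    ofNat n l (fun i => i - k) (fun i j hij _ => Nat.sub_le_sub_right hij k) (by omega))

lemma stdPath_snd {n k l : ℕ} (h : k + l = n) :
    stdPath (n + 1) k (l + 1) (by omega) = snocSnd (stdPath n k l h) := by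
  refine Prod.ext (hom_ext_ev fun i hi => ?_) (hom_ext_ev fun i hi => ?_)
  · simp only [stdPath, snocSnd, ev_snocLast_eq _ hi, ev_ofNat hi]
    split_ifs with h1
    · rw [ev_ofNat h1]
    · omega
  · simp only [stdPath, snocSnd, ev_snocLast_eq _ hi, ev_ofNat hi]
    split_ifs with h1
    · rw [ev_comp_δ_last, ev_ofNat h1]
    · omega

lemma stdPath_fst {n k : ℕ} (h : k + 0 = n) :
    stdPath (n + 1) (k + 1) 0 (by omega) = snocFst (stdPath n k 0 h) := by
  refine Prod.ext (hom_ext_ev fun i hi => ?_) (hom_ext_ev fun i hi => ?_)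
  · simp only [stdPath, snocFst, ev_snocLast_eq _ hi, ev_ofNat hi]
    split_ifs with h1
    · rw [ev_comp_δ_last, ev_ofNat h1]
      omega
    · omega
  · have h1 := ev_le (stdPath (n + 1) (k + 1) 0 (by omega)).2 i
    have h2 := ev_le (snocFst (stdPath n k 0 h)).2 i
    omega

/-- The standard path has coefficient one in the shuffle chain. -/
lemma shuffles_stdPath (n : ℕ) : ∀ (k l : ℕ) (h : k + l = n),
    shuffles K n k l (stdPath n k l h) = 1 := by
  have hinjS (n k l : ℕ) : Function.Injective (snocSnd (n := n) (k := k) (l := l)) := by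
    intro z z' hz
    exact Prod.ext (snocLast_injective (congrArg Prod.fst hz))
      (comp_δ_last_injective (snocLast_injective (congrArg Prod.snd hz)))
  have hinjF (n k l : ℕ) : Function.Injective (snocFst (n := n) (k := k) (l := l)) := by
    intro z z' hz
    exact Prod.ext (comp_δ_last_injective (snocLast_injective (congrArg Prod.fst hz)))
      (snocLast_injective (congrArg Prod.snd hz))
  induction n with
  | zero =>
    intro k l h
    obtain ⟨rfl, rfl⟩ : k = 0 ∧ l = 0 := by omega
    rw [shuffles, show stdPath 0 0 0 h = (𝟙 _, 𝟙 _) from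
      Prod.ext (Subsingleton.elim _ _) (Subsingleton.elim _ _), Finsupp.single_eq_same]
  | succ n ih =>
    intro k l h
    rcases k with _ | k <;> rcases l with _ | l
    · omega
    · rw [shuffles, stdPath_snd (show 0 + l = n by omega)]
      exact (Finsupp.mapDomain_apply (hinjS _ _ _) _ _).trans (ih 0 l (by omega))
    · rw [shuffles, stdPath_fst (show k + 0 = n by omega)]
      exact (Finsupp.mapDomain_apply (hinjF _ _ _) _ _).trans (ih k 0 (by omega))
    · rw [shuffles, stdPath_snd (show k + 1 + l = n by omega), Finsupp.add_apply,
        Finsupp.smul_apply]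
      -- A path whose last step is in the first direction has first coordinate at most `k` at the
      -- vertex `n`, whereas the standard path is already at `k + 1` there.
      have h1 : push K snocFst (shuffles K n k (l + 1)) (snocSnd (stdPath n (k + 1) l (by omega))) =
          0 := by
        refine Finsupp.mapDomain_of_notMem_range _ _ ?_
        rintro ⟨z, hz⟩
        have h2 := congrArg (fun y => ev y.1 n) hz
        simp only [snocFst, snocSnd, ev_snocLast _ le_rfl, ev_comp_δ_last, stdPath,
          ev_ofNat le_rfl] at h2
        have := ev_le z.1 n
        omega
      rw [h1, smul_zero, add_zero]
      exact (Finsupp.mapDomain_apply (hinjS _ _ _) _ _).trans (ih (k + 1) l (by omega))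

end ShuffleChain

/-! ## Flat steps of simplices -/

section FlatAt

open SimplexCategory

variable {X : SSet.{u}}

/-- The simplex `x` is constant along the `i`-th step of its vertices, i.e. it lies in the image of
the `i`-th degeneracy map. -/
def FlatAt {n : ℕ} (x : X _⦋n⦌) (i : ℕ) : Prop :=
  ∃ (m : ℕ) (c : X _⦋m⦌) (θ : ⦋n⦌ ⟶ ⦋m⦌), x = X.map θ.op c ∧ i < n ∧ ev θ i = ev θ (i + 1)

lemma SSet_map_map (X : SSet.{u}) {a b c : ℕ} (f : ⦋a⦌ ⟶ ⦋b⦌) (g : ⦋b⦌ ⟶ ⦋c⦌) (y : X _⦋c⦌) :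
    X.map f.op (X.map g.op y) = X.map (f ≫ g).op y :=
  SSet_map_eq X rfl y

lemma SSet_map_id (X : SSet.{u}) {a : ℕ} (y : X _⦋a⦌) : X.map (𝟙 ⦋a⦌).op y = y := by
  rw [op_id, X.map_id]
  rfl

lemma FlatAt.lt {n i : ℕ} {x : X _⦋n⦌} (h : FlatAt x i) : i < n := by
  obtain ⟨m, c, θ, -, h, -⟩ := h
  exact h

lemma flatAt_map {n m : ℕ} (θ : ⦋n⦌ ⟶ ⦋m⦌) (c : X _⦋m⦌) {i : ℕ} (hi : i < n)
    (h : ev θ i = ev θ (i + 1)) : FlatAt (X.map θ.op c) i :=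
  ⟨m, c, θ, rfl, hi, h⟩

/-- The operator `ψ` sends the step `j` into the step `i`, along which `x` is constant. -/
lemma FlatAt.map {n m i j : ℕ} {x : X _⦋n⦌} (h : FlatAt x i) (ψ : ⦋m⦌ ⟶ ⦋n⦌) (hj : j < m)
    (h1 : i ≤ ev ψ j) (h2 : ev ψ (j + 1) ≤ i + 1) : FlatAt (X.map ψ.op x) j := by
  obtain ⟨k, c, θ, rfl, hi, h⟩ := h
  rw [SSet_map_map]
  refine flatAt_map _ _ hj ?_
  rw [ev_comp, ev_comp]
  have h3 := ev_mono ψ (Nat.le_succ j)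
  have h4 := ev_mono θ h1
  have h5 := ev_mono θ h2
  have h6 := ev_mono θ h3
  simp only [Nat.succ_eq_add_one] at h6
  omega

lemma flatAt_σ {n : ℕ} (j : Fin (n + 1)) (c : X _⦋n⦌) : FlatAt (X.map (σ j).op c) j := by
  have := j.2
  refine flatAt_map _ _ j.2 ?_
  rw [ev_σ _ (by omega), ev_σ _ (by omega)]
  simp

/-- The composite `f ≫ g` may move vertices only between `i` and `i + 1`, which `x` does not
distinguish. This recovers a simplex from a face of it. -/
lemma FlatAt.eq_map {n m i : ℕ} {x : X _⦋n⦌} (h : FlatAt x i) (f : ⦋n⦌ ⟶ ⦋m⦌) (g : ⦋m⦌ ⟶ ⦋n⦌)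
    (hfg : ∀ j ≤ n, ev (f ≫ g) j = j ∨ i ≤ ev (f ≫ g) j ∧ i ≤ j ∧ ev (f ≫ g) j ≤ i + 1 ∧ j ≤ i + 1) :
    X.map f.op (X.map g.op x) = x := by
  obtain ⟨k, c, θ, rfl, hi, h⟩ := h
  rw [SSet_map_map, SSet_map_map]
  congr 3
  refine congrArg Quiver.Hom.op (hom_ext_ev fun j hj => ?_)
  rw [ev_comp]
  rcases hfg j hj with h1 | ⟨h1, h2, h3, h4⟩
  · rw [h1]
  · have h5 := ev_mono θ h1
    have h6 := ev_mono θ h2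
    have h7 := ev_mono θ h3
    have h8 := ev_mono θ h4
    omega

lemma FlatAt.exists_σ {n i : ℕ} {x : X _⦋n + 1⦌} (h : FlatAt x i) :
    ∃ (j : Fin (n + 1)) (c : X _⦋n⦌), j.val = i ∧ x = X.map (σ j).op c := by
  have hi := h.lt
  refine ⟨⟨i, hi⟩, X.map (δ (⟨i, by omega⟩ : Fin (n + 2))).op x, rfl, ?_⟩
  refine (h.eq_map _ _ fun j hj => ?_).symm
  rw [ev_comp, ev_σ _ hj, ev_δ _ (by dsimp only; split_ifs <;> omega)]
  dsimp only
  split_ifs <;> omega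

/-- A simplex without flat steps. -/
def NonFlat {n : ℕ} (x : X _⦋n⦌) : Prop := ∀ i, ¬ FlatAt x i

lemma NonFlat.ev_lt {n m : ℕ} {θ : ⦋n⦌ ⟶ ⦋m⦌} {c : X _⦋m⦌} (h : NonFlat (X.map θ.op c)) {i : ℕ}
    (hi : i < n) : ev θ i < ev θ (i + 1) :=
  lt_of_le_of_ne (ev_mono θ (Nat.le_succ i)) fun h1 => h i (flatAt_map _ _ hi h1)

end FlatAt

/-! ## The normalized chains of a simplicial set -/

section NormalizedChains

open SimplexCategory

variable (K : Type u) [CommRing K] (X : SSet.{u})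

/-- The normalized chain complex of a simplicial set. -/
abbrev normalizedChains : ChainComplex (ModuleCat.{u} K) ℕ :=
  normalizedComplex (freeSimplicialModule K X)

variable {X}

/-- The class of a simplex in the normalized chains. -/
def cls {n : ℕ} (x : X _⦋n⦌) : (normalizedChains K X).X n :=
  normalizedProj (freeSimplicialModule K X) n (simplexBasis K X x)

lemma cls_eq_zero {n i : ℕ} {x : X _⦋n⦌} (h : FlatAt x i) : cls K x = 0 := by
  cases n with
  | zero => exact absurd h.lt (Nat.not_lt_zero i)
  | succ n =>
    obtain ⟨j, c, -, rfl⟩ := h.exists_σ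
    refine (Submodule.Quotient.mk_eq_zero _).2 ?_
    refine Submodule.mem_iSup_of_mem (p := fun i : Fin (n + 1) =>
      LinearMap.range ((freeSimplicialModule K X).σ i).hom) j ?_
    exact ⟨simplexBasis K X c, freeSimplicialModule_map_basis K X (σ j) c⟩

/-- A linear map out of the normalized chains, from its values on simplices. -/
def normalizedLift {M : Type*} [AddCommGroup M] [Module K M] {n : ℕ} (f : X _⦋n⦌ → M)
    (hf : ∀ x i, FlatAt x i → f x = 0) : (normalizedChains K X).X n →ₗ[K] M :=
  Submodule.liftQ (degenerateSubmodule (freeSimplicialModule K X) n)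
    (Finsupp.linearCombination K f : (X _⦋n⦌ →₀ K) →ₗ[K] M) (by
      cases n with
      | zero => exact bot_le
      | succ n =>
        refine iSup_le fun i => ?_
        rintro _ ⟨y, rfl⟩
        refine LinearMap.mem_ker.2 ?_
        have h : (Finsupp.linearCombination K f : (X _⦋n + 1⦌ →₀ K) →ₗ[K] M) ∘ₗ
            (Finsupp.lmapDomain K K (X.map (σ i).op) :
              (X _⦋n⦌ →₀ K) →ₗ[K] (X _⦋n + 1⦌ →₀ K)) = 0 := by
          refine Finsupp.lhom_ext' fun x => LinearMap.ext_ring ?_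
          simpa using hf _ _ (flatAt_σ i x)
        exact LinearMap.congr_fun h y)

lemma normalizedLift_cls {M : Type*} [AddCommGroup M] [Module K M] {n : ℕ} (f : X _⦋n⦌ → M)
    (hf : ∀ x i, FlatAt x i → f x = 0) (x : X _⦋n⦌) : normalizedLift K f hf (cls K x) = f x := by
  refine (Submodule.liftQ_apply _ _ _).trans ?_
  exact (Finsupp.linearCombination_single K (1 : K) x).trans (one_smul K _)

/-- The class of a chain in the normalized chains. -/
def clsMap (X : SSet.{u}) (n : ℕ) : (X _⦋n⦌ →₀ K) →ₗ[K] (normalizedChains K X).X n :=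
  Finsupp.linearCombination K (cls K)

lemma clsMap_single {n : ℕ} (x : X _⦋n⦌) (a : K) :
    clsMap K X n (Finsupp.single x a) = a • cls K x :=
  Finsupp.linearCombination_single K a x

lemma clsMap_eq_normalizedProj {n : ℕ} (w : freeSimplicialModule K X _⦋n⦌) :
    clsMap K X n w = normalizedProj (freeSimplicialModule K X) n w := by
  have h : clsMap K X n = (normalizedProj (freeSimplicialModule K X) n :
      (X _⦋n⦌ →₀ K) →ₗ[K] (normalizedChains K X).X n) := by
    refine Finsupp.lhom_ext' fun x => LinearMap.ext_ring ?_
    simp only [LinearMap.comp_apply, Finsupp.lsingle_apply, clsMap_single, one_smul]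
    rfl
  exact LinearMap.congr_fun h w

lemma clsMap_surjective (n : ℕ) : Function.Surjective (clsMap K X n) := by
  intro y
  obtain ⟨w, rfl⟩ := Submodule.mkQ_surjective (degenerateSubmodule (freeSimplicialModule K X) n) y
  exact ⟨w, clsMap_eq_normalizedProj K w⟩

lemma normalizedChains_hom_ext {M : Type*} [AddCommGroup M] [Module K M] {n : ℕ}
    {f g : (normalizedChains K X).X n →ₗ[K] M} (h : ∀ x : X _⦋n⦌, f (cls K x) = g (cls K x)) :
    f = g := by
  have h1 : f ∘ₗ clsMap K X n = g ∘ₗ clsMap K X n := by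
    refine Finsupp.lhom_ext' fun x => LinearMap.ext_ring ?_
    simpa [clsMap_single] using h x
  refine LinearMap.ext fun y => ?_
  obtain ⟨w, rfl⟩ := clsMap_surjective K n y
  exact LinearMap.congr_fun h1 w

lemma normalizedChains_d_cls {n : ℕ} (x : X _⦋n + 1⦌) :
    ((normalizedChains K X).d (n + 1) n).hom (cls K x) =
      ∑ i : Fin (n + 2), (-1 : K) ^ (i : ℕ) • cls K (X.map (SimplexCategory.δ i).op x) := by
  have h1 : ((normalizedChains K X).d (n + 1) n).hom (cls K x) =
      normalizedProj (freeSimplicialModule K X) n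
        (((AlgebraicTopology.alternatingFaceMapComplex _).obj (freeSimplicialModule K X)).d
          (n + 1) n (simplexBasis K X x)) := rfl
  rw [h1, AlgebraicTopology.alternatingFaceMapComplex_obj_d,
    AlgebraicTopology.AlternatingFaceMapComplex.objD]
  have h2 : (∑ i : Fin (n + 2), (-1 : ℤ) ^ (i : ℕ) • (freeSimplicialModule K X).δ i).hom
      (simplexBasis K X x) = ∑ i : Fin (n + 2), (-1 : K) ^ (i : ℕ) •
        simplexBasis K X (X.map (SimplexCategory.δ i).op x) := by
    rw [ModuleCat.hom_sum, LinearMap.sum_apply]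
    refine Finset.sum_congr rfl fun i _ => ?_
    have h3 : ((freeSimplicialModule K X).δ i).hom (simplexBasis K X x) =
      simplexBasis K X (X.map (SimplexCategory.δ i).op x) :=
      freeSimplicialModule_map_basis K X (SimplexCategory.δ i) x
    rw [ModuleCat.hom_zsmul, LinearMap.smul_apply, h3]
    -- The alternating face map complex carries integer signs; parity turns them into scalars of
    -- `K`.
    rcases neg_one_pow_eq_or ℤ (i : ℕ) with h | h
    · have h' : (-1 : K) ^ (i : ℕ) = 1 := by exact_mod_cast congrArg (Int.cast (R := K)) h
      rw [h, h', one_smul, one_smul]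
    · have h' : (-1 : K) ^ (i : ℕ) = -1 := by exact_mod_cast congrArg (Int.cast (R := K)) h
      rw [h, h', neg_smul, neg_smul, one_smul, one_smul]
  refine (congrArg (normalizedProj (freeSimplicialModule K X) n) h2).trans ?_
  rw [map_sum]
  refine Finset.sum_congr rfl fun i _ => ?_
  rw [map_smul]
  rfl

open Classical in
/-- The coefficient of a simplex without flat steps. -/
def clsCoeff {n : ℕ} (x : X _⦋n⦌) (hx : NonFlat x) : (normalizedChains K X).X n →ₗ[K] K :=
  normalizedLift K (fun y => if y = x then 1 else 0) fun y i hy =>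
    if_neg fun h : y = x => hx i (h ▸ hy)

open Classical in
lemma clsCoeff_cls {n : ℕ} (x : X _⦋n⦌) (hx : NonFlat x) (y : X _⦋n⦌) :
    clsCoeff K x hx (cls K y) = if y = x then 1 else 0 :=
  normalizedLift_cls K _ _ y

open Classical in
open Classical in
variable (X) in
/-- The normalized chains are free on the simplices without flat steps. -/
def normalizedBasis (n : ℕ) :
    Module.Basis {x : X _⦋n⦌ // NonFlat x} K ((normalizedChains K X).X n) :=
  .ofRepr <| LinearEquiv.ofLinearMap
    (normalizedLift K (fun y => if h : NonFlat y then Finsupp.single ⟨y, h⟩ 1 else 0)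
      fun y i hy => dif_neg fun h => h i hy)
    (Finsupp.linearCombination K fun y => cls K y.1)
    (Finsupp.lhom_ext' fun y => LinearMap.ext_ring (by simp [normalizedLift_cls, y.2]))
    (normalizedChains_hom_ext K fun y => by
      rw [LinearMap.comp_apply, normalizedLift_cls]
      by_cases h : NonFlat y
      · simp [h]
      · rw [dif_neg h, map_zero]
        rw [NonFlat, _root_.not_forall_not] at h
        obtain ⟨i, hi⟩ := h
        exact (cls_eq_zero K hi).symm)

lemma normalizedBasis_apply {n : ℕ} (x : {x : X _⦋n⦌ // NonFlat x}) :
    normalizedBasis K X n x = cls K x.1 := by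
  simp [normalizedBasis]

instance (n : ℕ) : Module.Free K ((normalizedChains K X).X n) :=
  Module.Free.of_basis (normalizedBasis K X n)

/-- The span of the classes of a set of simplices. -/
def clsSpan {n : ℕ} (Y : Set (X _⦋n⦌)) : Submodule K ((normalizedChains K X).X n) :=
  Submodule.span K (cls K '' Y)

/-- Members of `Y` with a flat step have class zero, so only basis elements contribute. -/
lemma clsSpan_eq_basis {n : ℕ} (Y : Set (X _⦋n⦌)) :
    clsSpan K Y = Submodule.span K (normalizedBasis K X n '' {x | x.1 ∈ Y}) := by
  refine le_antisymm (Submodule.span_le.2 ?_) (Submodule.span_mono ?_)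
  · rintro _ ⟨y, hy, rfl⟩
    by_cases h : NonFlat y
    · exact Submodule.subset_span ⟨⟨y, h⟩, hy, normalizedBasis_apply K ⟨y, h⟩⟩
    · rw [NonFlat, _root_.not_forall_not] at h
      obtain ⟨i, hi⟩ := h
      rw [cls_eq_zero K hi]
      exact Submodule.zero_mem _
  · rintro _ ⟨y, hy, rfl⟩
    exact ⟨y.1, hy, (normalizedBasis_apply K y).symm⟩

lemma clsMap_mem_clsSpan {n : ℕ} {Y : Set (X _⦋n⦌)} {y : (normalizedChains K X).X n}
    (hy : y ∈ clsSpan K Y) : ∃ w ∈ Finsupp.supported K K Y, clsMap K X n w = y :=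
  (Finsupp.mem_span_image_iff_linearCombination K).1 hy

/-- The submodule is spanned by part of a basis, so membership means that the other coordinates
vanish, and these lie in a domain. Torsion-freeness supplies the flatness of the quotients used for
`mem_range_mapIncl_inf_ker`. -/
instance [IsDomain K] {n : ℕ} (Y : Set (X _⦋n⦌)) :
    Module.IsTorsionFree K ((normalizedChains K X).X n ⧸ clsSpan K Y) := by
  refine Module.IsTorsionFree.of_smul_eq_zero fun a m h => ?_
  obtain ⟨c, rfl⟩ := Submodule.mkQ_surjective _ m
  rw [or_iff_not_imp_left]
  intro ha
  rw [← map_smul] at h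
  simp only [Submodule.mkQ_apply, Submodule.Quotient.mk_eq_zero] at h ⊢
  rw [clsSpan_eq_basis, Module.Basis.mem_span_image] at h ⊢
  intro x hx
  refine h ?_
  simp only [Finset.mem_coe, Finsupp.mem_support_iff, map_smul, Finsupp.smul_apply] at hx ⊢
  exact smul_ne_zero ha hx

end NormalizedChains

/-! ## The shuffle map and the front and back faces -/

section Shuffle

open SimplexCategory ShuffleChain

variable (K : Type u) [CommRing K] {X X' : SSet.{u}}

/-- The simplex of `X × X'` with the given components. -/
def simplexPair {n : ℕ} (x : X _⦋n⦌) (x' : X' _⦋n⦌) : (X ⊗ X' : SSet.{u}) _⦋n⦌ := (x, x')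

lemma exists_simplexPair {n : ℕ} (z : (X ⊗ X' : SSet.{u}) _⦋n⦌) :
    ∃ (x : X _⦋n⦌) (x' : X' _⦋n⦌), z = simplexPair x x' := ⟨z.1, z.2, rfl⟩

lemma simplexPair_inj {n : ℕ} {x y : X _⦋n⦌} {x' y' : X' _⦋n⦌} :
    simplexPair x x' = simplexPair y y' ↔ x = y ∧ x' = y' := Prod.mk_inj

/-- The simplex of `X × X'` given by a simplex of `Δ[k] × Δ[l]` and simplices of `X` and `X'`. -/
def cross {n k l : ℕ} (z : Grid n k l) (x : X _⦋k⦌) (x' : X' _⦋l⦌) : (X ⊗ X' : SSet.{u}) _⦋n⦌ :=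
  simplexPair (X.map z.1.op x) (X'.map z.2.op x')

lemma map_simplexPair {n m : ℕ} (θ : ⦋n⦌ ⟶ ⦋m⦌) (x : X _⦋m⦌) (x' : X' _⦋m⦌) :
    (X ⊗ X' : SSet.{u}).map θ.op (simplexPair x x') =
      simplexPair (X.map θ.op x) (X'.map θ.op x') := rfl

/-- The two flatness hypotheses may come with unrelated operators; `exists_σ` replaces both by the
same degeneracy, which then acts on the pair. -/
lemma FlatAt.pair {n i : ℕ} {x : X _⦋n⦌} {x' : X' _⦋n⦌} (h : FlatAt x i) (h' : FlatAt x' i) :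
    FlatAt (simplexPair x x') i := by
  cases n with
  | zero => exact absurd h.lt (Nat.not_lt_zero i)
  | succ n =>
    obtain ⟨j, c, rfl, rfl⟩ := h.exists_σ
    obtain ⟨j', c', hj, rfl⟩ := h'.exists_σ
    obtain rfl := Fin.ext hj
    exact flatAt_σ (X := (X ⊗ X' : SSet.{u})) j' (c, c')

lemma FlatAt.of_pair {n i : ℕ} {x : X _⦋n⦌} {x' : X' _⦋n⦌}
    (h : FlatAt (simplexPair x x') i) : FlatAt x i ∧ FlatAt x' i := by
  obtain ⟨m, c, θ, hx, hi, hθ⟩ := h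
  exact ⟨⟨m, c.1, θ, congrArg Prod.fst hx, hi, hθ⟩, ⟨m, c.2, θ, congrArg Prod.snd hx, hi, hθ⟩⟩

/-- The linear extension of `cross` to chains, with values in the normalized chains. -/
def crossChain {n k l : ℕ} (x : X _⦋k⦌) (x' : X' _⦋l⦌) :
    Chain K n k l →ₗ[K] (normalizedChains K (X ⊗ X')).X n :=
  Finsupp.linearCombination K fun z => cls K (cross z x x')

lemma crossChain_single {n k l : ℕ} (x : X _⦋k⦌) (x' : X' _⦋l⦌) (z : Grid n k l) (a : K) :
    crossChain K x x' (Finsupp.single z a) = a • cls K (cross z x x') :=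
  Finsupp.linearCombination_single K a z

lemma crossChain_push {n k l n' k' l' : ℕ} (f : Grid n k l → Grid n' k' l')
    {x : X _⦋k⦌} {x' : X' _⦋l⦌} {y : X _⦋k'⦌} {y' : X' _⦋l'⦌} {g : (normalizedChains K (X ⊗ X')).X n
      →ₗ[K] (normalizedChains K (X ⊗ X')).X n'}
    (h : ∀ z, cls K (cross (f z) y y') = g (cls K (cross z x x'))) (e : Chain K n k l) :
    crossChain K y y' (push K f e) = g (crossChain K x x' e) := by
  have h1 : crossChain K y y' ∘ₗ push K f = g ∘ₗ crossChain K x x' := by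
    refine Finsupp.lhom_ext' fun z => LinearMap.ext_ring ?_
    simp [crossChain_single, h]
  exact LinearMap.congr_fun h1 e

/-- Cofaces of the grid act on its target, so they turn into faces of `x`; faces of the grid act on
its source and turn into faces of the product simplex (`d_crossChain`). -/
lemma crossChain_cobdFst {n k l : ℕ} (x : X _⦋k + 1⦌) (x' : X' _⦋l⦌) (e : Chain K n k l) :
    crossChain K x x' (cobdFst K e) =
      ∑ j : Fin (k + 2), (-1 : K) ^ (j : ℕ) • crossChain K (X.map (δ j).op x) x' e := by
  simp only [cobdFst, LinearMap.sum_apply, LinearMap.smul_apply, map_sum, map_smul]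
  refine Finset.sum_congr rfl fun j _ => congrArg _ ?_
  refine crossChain_push K (cofaceFst j) (g := LinearMap.id) (fun z => congrArg _ ?_) e
  exact Prod.ext (SSet_map_map X z.1 (δ j) x).symm rfl

lemma crossChain_cobdSnd {n k l : ℕ} (x : X _⦋k⦌) (x' : X' _⦋l + 1⦌) (e : Chain K n k l) :
    crossChain K x x' (cobdSnd K e) =
      ∑ j : Fin (l + 2), (-1 : K) ^ (j : ℕ) • crossChain K x (X'.map (δ j).op x') e := by
  simp only [cobdSnd, LinearMap.sum_apply, LinearMap.smul_apply, map_sum, map_smul]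
  refine Finset.sum_congr rfl fun j _ => congrArg _ ?_
  refine crossChain_push K (cofaceSnd j) (g := LinearMap.id) (fun z => congrArg _ ?_) e
  exact Prod.ext rfl (SSet_map_map X' z.2 (δ j) x').symm

lemma d_crossChain {n k l : ℕ} (x : X _⦋k⦌) (x' : X' _⦋l⦌) (e : Chain K (n + 1) k l) :
    ((normalizedChains K (X ⊗ X')).d (n + 1) n).hom (crossChain K x x' e) =
      crossChain K x x' (bd K e) := by
  have h1 : ((normalizedChains K (X ⊗ X')).d (n + 1) n).hom ∘ₗ crossChain K x x' =
      crossChain K x x' ∘ₗ bd K := by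
    refine Finsupp.lhom_ext' fun z => LinearMap.ext_ring ?_
    simp only [LinearMap.comp_apply, Finsupp.lsingle_apply, crossChain_single, one_smul,
      normalizedChains_d_cls, bd, LinearMap.sum_apply, LinearMap.smul_apply, map_sum, map_smul]
    refine Finset.sum_congr rfl fun j _ => congrArg _ ?_
    rw [push, Finsupp.lmapDomain_apply, Finsupp.mapDomain_single, crossChain_single, one_smul]
    exact congrArg _ (Prod.ext (SSet_map_map X (δ j) z.1 x) (SSet_map_map X' (δ j) z.2 x'))
  exact LinearMap.congr_fun h1 e

lemma crossChain_eq_zero {n k l : ℕ} {x : X _⦋k⦌} {x' : X' _⦋l⦌} {e : Chain K n k l}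
    (h : ∀ z ∈ e.support, cls K (cross z x x') = 0) : crossChain K x x' e = 0 := by
  rw [crossChain, Finsupp.linearCombination_apply]
  exact Finset.sum_eq_zero fun z hz => by dsimp only; rw [h z hz, smul_zero]

/-- Discrete intermediate values: the required step ends at the first vertex where `p` exceeds `i`.
-/
lemma exists_step {n k i : ℕ} {p : ⦋n⦌ ⟶ ⦋k⦌} (h0 : ev p 0 ≤ i) (hn : i < ev p n) :
    ∃ j < n, ev p j ≤ i ∧ i < ev p (j + 1) := by
  induction n using Nat.strong_induction_on with
  | _ n _ =>
    classical
    have hex : ∃ m, i < ev p m := ⟨n, hn⟩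
    have h1 := Nat.find_spec hex
    have h2 : ∀ m, m < Nat.find hex → ev p m ≤ i := fun m hm => not_lt.1 (Nat.find_min hex hm)
    have h3 : Nat.find hex ≤ n := Nat.find_min' hex hn
    generalize Nat.find hex = m at h1 h2 h3
    cases m with
    | zero => omega
    | succ m => exact ⟨m, by omega, h2 m (by omega), h1⟩

/-- A shuffle path runs through every unit step of its first coordinate, and the second coordinate
rests meanwhile because the coordinates sum to the position. -/
lemma ShuffleChain.IsPath.exists_fst {n k l i : ℕ} {z : Grid n k l} (h : IsPath z) (hi : i < k) :
    ∃ j < n, i ≤ ev z.1 j ∧ ev z.1 (j + 1) ≤ i + 1 ∧ ev z.2 j = ev z.2 (j + 1) := by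
  have h0 := h.2 0 (Nat.zero_le n)
  have hn := h.2 n le_rfl
  have h1 := h.1
  have h2 := ev_le z.2 n
  obtain ⟨j, hj, h3, h4⟩ := exists_step (p := z.1) (i := i) (by omega) (by omega)
  have h5 := h.2 j hj.le
  have h6 := h.2 (j + 1) hj
  have h7 := ev_mono z.2 (Nat.le_succ j)
  simp only [Nat.succ_eq_add_one] at h7
  exact ⟨j, hj, by omega, by omega, by omega⟩

lemma ShuffleChain.IsPath.exists_snd {n k l i : ℕ} {z : Grid n k l} (h : IsPath z) (hi : i < l) :
    ∃ j < n, i ≤ ev z.2 j ∧ ev z.2 (j + 1) ≤ i + 1 ∧ ev z.1 j = ev z.1 (j + 1) := by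
  have h0 := h.2 0 (Nat.zero_le n)
  have hn := h.2 n le_rfl
  have h1 := h.1
  have h2 := ev_le z.1 n
  obtain ⟨j, hj, h3, h4⟩ := exists_step (p := z.2) (i := i) (by omega) (by omega)
  have h5 := h.2 j hj.le
  have h6 := h.2 (j + 1) hj
  have h7 := ev_mono z.1 (Nat.le_succ j)
  simp only [Nat.succ_eq_add_one] at h7
  exact ⟨j, hj, by omega, by omega, by omega⟩

/-- While the path runs through the flat step of `x`, the other component rests, so the product
simplex is flat there. With `cls_cross_snd` this makes the shuffle map well defined on normalized
chains. -/
lemma ShuffleChain.IsPath.cls_cross_fst {n k l i : ℕ} {z : Grid n k l} (h : IsPath z) {x : X _⦋k⦌}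
    (hx : FlatAt x i) (x' : X' _⦋l⦌) : cls K (cross z x x') = 0 := by
  obtain ⟨j, hj, h1, h2, h3⟩ := h.exists_fst hx.lt
  exact cls_eq_zero K ((hx.map z.1 hj h1 h2).pair (flatAt_map z.2 x' hj h3))

lemma ShuffleChain.IsPath.cls_cross_snd {n k l i : ℕ} {z : Grid n k l} (h : IsPath z) (x : X _⦋k⦌) {x' : X' _⦋l⦌}
    (hx' : FlatAt x' i) : cls K (cross z x x') = 0 := by
  obtain ⟨j, hj, h1, h2, h3⟩ := h.exists_snd hx'.lt
  exact cls_eq_zero K ((flatAt_map z.1 x hj h3).pair (hx'.map z.2 hj h1 h2))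

/-- The shuffle map, the Eilenberg–Zilber cross product on normalized chains. It is zero unless
`n = k + l`. -/
def nabla (X X' : SSet.{u}) (n k l : ℕ) : (normalizedChains K X).X k →ₗ[K]
    (normalizedChains K X').X l →ₗ[K] (normalizedChains K (X ⊗ X')).X n :=
  normalizedLift K
    (fun x => normalizedLift K (fun x' => crossChain K x x' (shuffles K n k l)) fun _ _ hx' =>
      crossChain_eq_zero K fun _ hz => (IsPath.of_mem_support K hz).cls_cross_snd K x hx')
    fun _ _ hx => normalizedChains_hom_ext K fun x' => by
      rw [normalizedLift_cls, LinearMap.zero_apply]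
      exact crossChain_eq_zero K fun _ hz => (IsPath.of_mem_support K hz).cls_cross_fst K hx x'

lemma nabla_cls {n k l : ℕ} (x : X _⦋k⦌) (x' : X' _⦋l⦌) :
    nabla K X X' n k l (cls K x) (cls K x') = crossChain K x x' (shuffles K n k l) := by
  rw [nabla, normalizedLift_cls, normalizedLift_cls]

lemma normalizedChains_hom_ext₂ {M : Type*} [AddCommGroup M] [Module K M] {k l : ℕ}
    {f g : (normalizedChains K X).X k →ₗ[K] (normalizedChains K X').X l →ₗ[K] M}
    (h : ∀ (x : X _⦋k⦌) (x' : X' _⦋l⦌), f (cls K x) (cls K x') = g (cls K x) (cls K x')) : f = g :=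
  normalizedChains_hom_ext K fun x => normalizedChains_hom_ext K fun x' => h x x'

/-- The shuffle map is a chain map. -/
lemma d_nabla {n k l : ℕ} (h : k + l = n + 1) (a : (normalizedChains K X).X k)
    (b : (normalizedChains K X').X l) :
    ((normalizedChains K (X ⊗ X')).d (n + 1) n).hom (nabla K X X' (n + 1) k l a b) =
      nabla K X X' n (k - 1) l (((normalizedChains K X).d k (k - 1)).hom a) b +
        (-1 : K) ^ k • nabla K X X' n k (l - 1) a
          (((normalizedChains K X').d l (l - 1)).hom b) := by
  have key : (nabla K X X' (n + 1) k l).compr₂ ((normalizedChains K (X ⊗ X')).d (n + 1) n).hom =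
      (nabla K X X' n (k - 1) l).comp ((normalizedChains K X).d k (k - 1)).hom +
      (-1 : K) ^ k • (nabla K X X' n k (l - 1)).compl₂ ((normalizedChains K X').d l (l - 1)).hom := by
    refine normalizedChains_hom_ext₂ K fun x x' => ?_
    simp only [LinearMap.compr₂_apply, LinearMap.add_apply, LinearMap.comp_apply,
      LinearMap.smul_apply, LinearMap.compl₂_apply, nabla_cls, d_crossChain, bd_shuffles K n k l h,
      map_add, map_smul]
    congr 1
    · cases k with
      | zero =>
        -- For `k = 0` the truncated index gives `d 0 0`, which is zero by shape, matching the empty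
        -- coface sum.
        rw [facesFst, map_zero, (normalizedChains K X).shape 0 (0 - 1) (by simp)]
        simp
      | succ k =>
        rw [facesFst, crossChain_cobdFst]
        refine Eq.trans ?_ (congrArg (fun y => nabla K X X' n k l y (cls K x'))
          (normalizedChains_d_cls K x)).symm
        simp only [map_sum, map_smul, LinearMap.sum_apply, LinearMap.smul_apply, nabla_cls]
    · congr 1
      cases l with
      | zero =>
        rw [facesSnd, map_zero, (normalizedChains K X').shape 0 (0 - 1) (by simp)]
        simp
      | succ l =>
        rw [facesSnd, crossChain_cobdSnd]
        refine Eq.trans ?_ (congrArg (fun y => nabla K X X' n k l (cls K x) y)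
          (normalizedChains_d_cls K x')).symm
        simp only [map_sum, map_smul, nabla_cls]
  exact LinearMap.congr_fun₂ key a b

end Shuffle

/-! ### The Alexander–Whitney components and their effect on shuffle products. -/

section FrontBack

open SimplexCategory ShuffleChain

variable (K : Type u) [CommRing K] {X X' : SSet.{u}}

/-- The front `k`-face. -/
def frontFace {k l n : ℕ} (h : k + l = n) : ⦋k⦌ ⟶ ⦋n⦌ :=
  ofNat k n (fun i => i) (fun _ _ hij _ => hij) (by omega)

/-- The back `l`-face. -/
def backFace {k l n : ℕ} (h : k + l = n) : ⦋l⦌ ⟶ ⦋n⦌ :=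
  ofNat l n (fun i => k + i) (fun _ _ hij _ => by omega) h.le

lemma ev_frontFace {k l n : ℕ} (h : k + l = n) {i : ℕ} (hi : i ≤ k) : ev (frontFace h) i = i :=
  ev_ofNat hi

lemma ev_backFace {k l n : ℕ} (h : k + l = n) {i : ℕ} (hi : i ≤ l) : ev (backFace h) i = k + i :=
  ev_ofNat hi

/-- The component of the Alexander–Whitney map on normalized chains. -/
def frontBack (X X' : SSet.{u}) {k l n : ℕ} (h : k + l = n) :
    (normalizedChains K (X ⊗ X')).X n →ₗ[K]
      ((normalizedChains K X).X k : ModuleCat.{u} K) ⊗[K] (normalizedChains K X').X l :=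
  normalizedLift K (fun z => cls K (X.map (frontFace h).op z.1) ⊗ₜ[K]
      cls K (X'.map (backFace h).op z.2)) fun z i hz => by
    obtain ⟨h1, h2⟩ := FlatAt.of_pair (x := z.1) (x' := z.2) hz
    have hi := hz.lt
    -- A common flat step of both components lies in the front face of the first or in the back face
    -- of the second.
    by_cases hk : i < k
    · rw [cls_eq_zero K (h1.map (frontFace h) hk (ev_frontFace h hk.le).ge (ev_frontFace h hk).le),
        TensorProduct.zero_tmul]
    · rw [cls_eq_zero K (h2.map (j := i - k) (backFace h) (by omega)
        (by rw [ev_backFace h (by omega)]; omega) (by rw [ev_backFace h (by omega)]; omega)),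
        TensorProduct.tmul_zero]

lemma frontBack_cls {k l n : ℕ} (h : k + l = n) (x : X _⦋n⦌) (x' : X' _⦋n⦌) :
    frontBack K X X' h (cls K (simplexPair x x')) =
      cls K (X.map (frontFace h).op x) ⊗ₜ[K] cls K (X'.map (backFace h).op x') :=
  normalizedLift_cls K _ _ _

/-- Nonvanishing forces the first coordinate to increase strictly on the front face and the second
on the back face. As the coordinates of a path sum to the position, this pins down both. -/
lemma frontBack_cross_ne_zero {k l k' l' n : ℕ} (h : k + l = n) {z : Grid n k' l'} (hz : IsPath z)
    {x : X _⦋k'⦌} {x' : X' _⦋l'⦌} (h0 : frontBack K X X' h (cls K (cross z x x')) ≠ 0) :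
    (∀ j ≤ k, ev z.1 j = j) ∧ ∀ j ≤ l, ev z.2 (k + j) = j := by
  rw [cross, frontBack_cls, SSet_map_map, SSet_map_map] at h0
  have h1 : ∀ j < k, ev z.1 j < ev z.1 (j + 1) := by
    intro j hj
    refine lt_of_le_of_ne (ev_mono _ (Nat.le_succ j)) fun h2 => h0 ?_
    rw [cls_eq_zero K (flatAt_map (frontFace h ≫ z.1) x hj ?_), TensorProduct.zero_tmul]
    rw [ev_comp, ev_comp, ev_frontFace h hj.le, ev_frontFace h hj, h2]
  have h2 : ∀ j < l, ev z.2 (k + j) < ev z.2 (k + (j + 1)) := by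
    intro j hj
    refine lt_of_le_of_ne (ev_mono _ (by omega)) fun h2 => h0 ?_
    rw [cls_eq_zero K (flatAt_map (backFace h ≫ z.2) x' hj ?_), TensorProduct.tmul_zero]
    rw [ev_comp, ev_comp, ev_backFace h hj.le, ev_backFace h hj, h2]
  have h3 : ∀ j ≤ k, ev z.1 j = j := by
    intro j
    induction j with
    | zero =>
      intro _
      have := hz.2 0 (Nat.zero_le n)
      omega
    | succ j ih =>
      intro hj
      have h4 := h1 j hj
      have h5 := ih (by omega)
      have h6 := hz.2 (j + 1) (by omega)
      omega
  refine ⟨h3, fun j => ?_⟩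
  induction j with
  | zero =>
    intro _
    have h4 := h3 k le_rfl
    have h5 := hz.2 k (by omega)
    simp only [add_zero]
    omega
  | succ j ih =>
    intro hj
    have h4 := h2 j hj
    have h5 := ih (by omega)
    have h6 := hz.2 (k + (j + 1)) (by omega)
    have h7 := h3 k le_rfl
    have h8 := ev_mono z.1 (show k ≤ k + (j + 1) by omega)
    omega

/-- Once the first coordinate has reached `k` it must stay there, and the second coordinate is
determined by the sum. -/
lemma ShuffleChain.IsPath.eq_stdPath {n k l : ℕ} (h : k + l = n) {z : Grid n k l} (hz : IsPath z)
    (h1 : ∀ j ≤ k, ev z.1 j = j) : z = stdPath n k l h := by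
  have h2 : ∀ i ≤ n, ev z.1 i = min i k := by
    intro i hi
    rcases le_total i k with h3 | h3
    · rw [h1 i h3, min_eq_left h3]
    · have h4 := ev_mono z.1 h3
      have h5 := ev_le z.1 i
      rw [h1 k le_rfl] at h4
      omega
  refine Prod.ext (hom_ext_ev fun i hi => ?_) (hom_ext_ev fun i hi => ?_)
  · rw [h2 i hi, stdPath, ev_ofNat hi]
  · have h3 := hz.2 i hi
    rw [h2 i hi] at h3
    rw [stdPath, ev_ofNat hi]
    omega

/-- Only the standard path survives, with coefficient one, and its front and back faces are the
original simplices. -/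
lemma frontBack_nabla_self {k l n : ℕ} (h : k + l = n) (a : (normalizedChains K X).X k)
    (b : (normalizedChains K X').X l) :
    frontBack K X X' h (nabla K X X' n k l a b) = a ⊗ₜ[K] b := by
  have key : (nabla K X X' n k l).compr₂ (frontBack K X X' h) = TensorProduct.mk K _ _ := by
    refine normalizedChains_hom_ext₂ K fun x x' => ?_
    rw [LinearMap.compr₂_apply, nabla_cls, crossChain, Finsupp.linearCombination_apply,
      Finsupp.sum, map_sum, Finset.sum_eq_single (stdPath n k l h)]
    · rw [shuffles_stdPath, one_smul, cross, frontBack_cls, SSet_map_map, SSet_map_map,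
        TensorProduct.mk_apply]
      congr 2
      · have : frontFace h ≫ (stdPath n k l h).1 = 𝟙 _ := hom_ext_ev fun i hi => by
          rw [ev_comp, ev_frontFace h hi, stdPath, ev_ofNat (by omega), ev_id hi]
          omega
        rw [this, SSet_map_id]
      · have : backFace h ≫ (stdPath n k l h).2 = 𝟙 _ := hom_ext_ev fun i hi => by
          rw [ev_comp, ev_backFace h hi, stdPath, ev_ofNat (by omega), ev_id hi]
          omega
        rw [this, SSet_map_id]
    · intro z hz hne
      rw [map_smul]
      by_contra h0
      have hz' := IsPath.of_mem_support K hz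
      exact hne (hz'.eq_stdPath h
        (frontBack_cross_ne_zero K h hz' fun h1 => h0 (by rw [h1, smul_zero])).1)
    · intro h0
      rw [Finsupp.notMem_support_iff.1 h0, zero_smul, map_zero]
  exact LinearMap.congr_fun₂ key a b

/-- The path attains the values `k` and `l`, so `k ≤ k'` and `l ≤ l'`, while both pairs have sum
`n`. -/
lemma frontBack_cross_eq {k l k' l' n : ℕ} (h : k + l = n) {z : Grid n k' l'} (hz : IsPath z)
    {x : X _⦋k'⦌} {x' : X' _⦋l'⦌} (h0 : frontBack K X X' h (cls K (cross z x x')) ≠ 0) :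
    k = k' ∧ l = l' := by
  obtain ⟨h1, h2⟩ := frontBack_cross_ne_zero K h hz h0
  have h3 := ev_le z.1 k
  have h4 := ev_le z.2 (k + l)
  have h5 := hz.1
  rw [h1 k le_rfl] at h3
  rw [h2 l le_rfl] at h4
  omega

lemma frontBack_nabla_ne {k l k' l' n : ℕ} (h : k + l = n) (hne : k ≠ k')
    (a : (normalizedChains K X).X k') (b : (normalizedChains K X').X l') :
    frontBack K X X' h (nabla K X X' n k' l' a b) = 0 := by
  have key : (nabla K X X' n k' l').compr₂ (frontBack K X X' h) = 0 := by
    refine normalizedChains_hom_ext₂ K fun x x' => ?_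
    rw [LinearMap.compr₂_apply, nabla_cls, crossChain, Finsupp.linearCombination_apply,
      Finsupp.sum, map_sum]
    refine Finset.sum_eq_zero fun z hz => ?_
    rw [map_smul]
    by_contra h0
    exact hne (frontBack_cross_eq K h (IsPath.of_mem_support K hz)
      fun h1 => h0 (by rw [h1, smul_zero])).1
  exact LinearMap.congr_fun₂ key a b

end FrontBack

/-! ### Shuffles as grid paths. -/

section Diamond

open SimplexCategory ShuffleChain

lemma ev_jumpMap {n k : ℕ} (ν : Finset (Fin n)) (h : ν.card = k) {i : ℕ} (hi : i ≤ n) :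
    ev (jumpMap ν h) i = (Finset.univ.filter fun j : Fin n => j ∈ ν ∧ j.val < i).card :=
  (ev_val (jumpMap ν h) ⟨i, Nat.lt_succ_of_le hi⟩).trans rfl

/-- The set of steps along which an operator moves. -/
def jumpSet {n k : ℕ} (p : ⦋n⦌ ⟶ ⦋k⦌) : Finset (Fin n) :=
  Finset.univ.filter fun j => ev p j < ev p (j + 1)

/-- An operator that starts at zero and moves by at most one at a time equals the number of its
moves so far. -/
lemma card_jumpSet_filter {n k : ℕ} (p : ⦋n⦌ ⟶ ⦋k⦌) (h0 : ev p 0 = 0)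
    (h1 : ∀ i < n, ev p (i + 1) ≤ ev p i + 1) (i : ℕ) (hi : i ≤ n) :
    (Finset.univ.filter fun j : Fin n => j ∈ jumpSet p ∧ j.val < i).card = ev p i := by
  induction i with
  | zero => simp [h0]
  | succ i ih =>
    have ih := ih (by omega)
    have h2 := h1 i hi
    have h3 := ev_mono p (Nat.le_succ i)
    simp only [Nat.succ_eq_add_one] at h3
    by_cases h4 : ev p i < ev p (i + 1)
    · have : (Finset.univ.filter fun j : Fin n => j ∈ jumpSet p ∧ j.val < i + 1) =
          insert ⟨i, hi⟩ (Finset.univ.filter fun j : Fin n => j ∈ jumpSet p ∧ j.val < i) := by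
        ext j
        simp only [Finset.mem_filter, Finset.mem_univ, true_and, Finset.mem_insert, jumpSet,
          Fin.ext_iff]
        constructor
        · rintro ⟨h5, h6⟩
          rcases Nat.lt_succ_iff_lt_or_eq.1 h6 with h7 | h7
          · exact Or.inr ⟨h5, h7⟩
          · exact Or.inl h7
        · rintro (h5 | ⟨h5, h6⟩)
          · rw [h5]
            exact ⟨h4, Nat.lt_succ_self i⟩
          · exact ⟨h5, by omega⟩
      rw [this, Finset.card_insert_of_notMem (by simp), ih]
      omega
    · have : (Finset.univ.filter fun j : Fin n => j ∈ jumpSet p ∧ j.val < i + 1) =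
          (Finset.univ.filter fun j : Fin n => j ∈ jumpSet p ∧ j.val < i) := by
        ext j
        simp only [Finset.mem_filter, Finset.mem_univ, true_and, jumpSet]
        refine and_congr_right fun h5 => ⟨fun h6 => ?_, fun h6 => by omega⟩
        rcases Nat.lt_succ_iff_lt_or_eq.1 h6 with h7 | h7
        · exact h7
        · rw [h7] at h5
          exact absurd h5 h4
      rw [this, ih]
      omega

/-- The sets `μ` and `ν` partition the steps, so the numbers of their elements below `j` add up to
`j`. -/
lemma isPath_shuffle {l k n : ℕ} (s : Shuffle l k n) : IsPath ((s.sMu, s.sNu) : Grid n k l) := by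
  refine ⟨s.add_eq, fun j hj => ?_⟩
  rw [Shuffle.sMu, Shuffle.sNu, ev_jumpMap _ _ hj, ev_jumpMap _ _ hj, ← Finset.card_union_of_disjoint]
  · have : ((Finset.univ.filter fun i : Fin n => i ∈ s.ν ∧ i.val < j) ∪
        Finset.univ.filter fun i : Fin n => i ∈ s.μ ∧ i.val < j) =
        Finset.univ.filter fun i : Fin n => i.val < j := by
      ext i
      have h1 : i ∈ s.μ ∪ s.ν := by rw [s.union_eq]; exact Finset.mem_univ i
      rw [Finset.mem_union] at h1
      simp only [Finset.mem_union, Finset.mem_filter, Finset.mem_univ, true_and]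
      tauto
    rw [this, Fin.card_filter_val_lt]
    omega
  · rw [Finset.disjoint_filter]
    rintro i - ⟨h1, -⟩ ⟨h2, -⟩
    exact Finset.disjoint_left.1 s.disjoint h2 h1

lemma ShuffleChain.IsPath.exists_shuffle {l k n : ℕ} {z : Grid n k l} (h : IsPath z) :
    ∃ s : Shuffle l k n, s.sMu = z.1 ∧ s.sNu = z.2 := by
  have h0 := h.2 0 (Nat.zero_le n)
  have hn := h.2 n le_rfl
  have hkl := h.1
  have hk := ev_le z.1 n
  have hl := ev_le z.2 n
  have step : ∀ i < n, ev z.1 i ≤ ev z.1 (i + 1) ∧ ev z.2 i ≤ ev z.2 (i + 1) ∧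
      ev z.1 (i + 1) + ev z.2 (i + 1) = ev z.1 i + ev z.2 i + 1 := fun i hi =>
    ⟨ev_mono _ (Nat.le_succ i), ev_mono _ (Nat.le_succ i), by
      rw [h.2 i hi.le, h.2 (i + 1) hi]⟩
  have c1 := card_jumpSet_filter z.1 (by omega) fun i hi => by have := step i hi; omega
  have c2 := card_jumpSet_filter z.2 (by omega) fun i hi => by have := step i hi; omega
  have card {m : ℕ} (p : ⦋n⦌ ⟶ ⦋m⦌) : (Finset.univ.filter fun j : Fin n =>
      j ∈ jumpSet p ∧ j.val < n) = jumpSet p := by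
    ext j
    simp
  refine ⟨⟨jumpSet z.2, jumpSet z.1, h.1, ?_, ?_, ?_⟩, hom_ext_ev fun i hi => ?_,
    hom_ext_ev fun i hi => ?_⟩
  · rw [← card z.2, c2 n le_rfl]
    omega
  · rw [← card z.1, c1 n le_rfl]
    omega
  · ext j
    have := step j j.2
    simp only [jumpSet, Finset.mem_union, Finset.mem_filter, Finset.mem_univ, true_and, iff_true]
    omega
  · rw [Shuffle.sMu, ev_jumpMap _ _ hi, c1 i hi]
  · rw [Shuffle.sNu, ev_jumpMap _ _ hi, c2 i hi]

/-- Replaces the sets of a shuffle by the coordinates of a path, the form used in all later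
arguments. -/
lemma mem_diamond_iff {S S' : SetPathPair.{u}} {n : ℕ} {p : (S.X ⊗ S'.X : SSet.{u}) _⦋n⦌} :
    p ∈ diamond S S' n ↔ ∃ (k l : ℕ) (z : Grid n k l), IsPath z ∧ ∃ y ∈ S.Y k, ∃ y' ∈ S'.Y l,
      p = cross z y y' := by
  constructor
  · rintro ⟨k, l, s, y, hy, y', hy', h, h'⟩
    exact ⟨k, l, _, isPath_shuffle s, y, hy, y', hy', Prod.ext h h'⟩
  · rintro ⟨k, l, z, hz, y, hy, y', hy', rfl⟩
    obtain ⟨s, h1, h2⟩ := hz.exists_shuffle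
    exact ⟨k, l, s, y, hy, y', hy', by rw [h1]; rfl, by rw [h2]; rfl⟩

end Diamond

/-! ### Step-like simplices and the corner relation between their coefficients. -/

section StepLike

open SimplexCategory ShuffleChain

variable {X X' : SSet.{u}}

/-- A degeneracy inserts a flat step at `q` and shifts the later steps by one. It is undone by the
face `q + 1`, which leaves the steps before `q` in place, and by the face `q`, which restores the
positions of the steps after `q`. -/
lemma flatAt_σ_iff {n : ℕ} (q : Fin (n + 1)) (a : X _⦋n⦌) (j : ℕ) :
    FlatAt (X.map (σ q).op a) j ↔
      j = q ∨ (j < q ∧ FlatAt a j) ∨ ((q : ℕ) < j ∧ FlatAt a (j - 1)) := by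
  have hq := q.2
  constructor
  · intro h
    have hj := h.lt
    rcases lt_trichotomy j q.val with h1 | h1 | h1
    · refine Or.inr (Or.inl ⟨h1, ?_⟩)
      have h2 := h.map (δ q.succ) (j := j) (by omega)
        (by rw [ev_δ _ (by omega)]; simp; split_ifs <;> omega)
        (by rw [ev_δ _ (by omega), if_pos (by simp; omega)])
      rwa [SSet_map_map, δ_comp_σ_succ, SSet_map_id] at h2
    · exact Or.inl h1
    · refine Or.inr (Or.inr ⟨h1, ?_⟩)
      have h2 := h.map (δ q.castSucc) (j := j - 1) (by omega)
        (by rw [ev_δ _ (by omega)]; simp; split_ifs <;> omega)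
        (by rw [ev_δ _ (by omega)]; simp; split_ifs <;> omega)
      rwa [SSet_map_map, δ_comp_σ_self, SSet_map_id] at h2
  · rintro (rfl | ⟨h1, h⟩ | ⟨h1, h⟩)
    · exact flatAt_σ q a
    · have hj := h.lt
      exact h.map (σ q) (by omega) (by rw [ev_σ _ (by omega)]; split_ifs <;> omega)
        (by rw [ev_σ _ (by omega)]; split_ifs <;> omega)
    · have hj := h.lt
      exact h.map (σ q) (by omega) (by rw [ev_σ _ (by omega)]; split_ifs <;> omega)
        (by rw [ev_σ _ (by omega)]; split_ifs <;> omega)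

/-- The simplices of `X × X'` that are, along each step, constant in one of the two directions. -/
def stepLike (X X' : SSet.{u}) (n : ℕ) : Set ((X ⊗ X' : SSet.{u}) _⦋n⦌) :=
  {z | ∀ i < n, FlatAt (X := X) (n := n) z.1 i ∨ FlatAt (X := X') (n := n) z.2 i}

lemma mem_stepLike {n : ℕ} {x : X _⦋n⦌} {x' : X' _⦋n⦌} :
    simplexPair x x' ∈ stepLike X X' n ↔ ∀ i < n, FlatAt x i ∨ FlatAt x' i := Iff.rfl

lemma cross_mem_stepLike {n k l : ℕ} {z : Grid n k l} (hz : IsPath z) (x : X _⦋k⦌) (x' : X' _⦋l⦌) :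
    cross z x x' ∈ stepLike X X' n := by
  intro i hi
  have h1 := hz.2 i hi.le
  have h2 := hz.2 (i + 1) hi
  have h3 := ev_mono z.1 (Nat.le_succ i)
  have h4 := ev_mono z.2 (Nat.le_succ i)
  simp only [Nat.succ_eq_add_one] at h3 h4
  by_cases h : ev z.1 i = ev z.1 (i + 1)
  · exact Or.inl (flatAt_map _ _ hi h)
  · exact Or.inr (flatAt_map _ _ hi (by omega))

lemma diamond_subset_stepLike (S S' : SetPathPair.{u}) (n : ℕ) :
    diamond S S' n ⊆ stepLike S.X S'.X n := by
  intro p hp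
  obtain ⟨k, l, z, hz, y, -, y', -, rfl⟩ := mem_diamond_iff.1 hp
  exact cross_mem_stepLike hz y y'

/-- A face of a simplex that is constant along some step. -/
lemma FlatAt.δ {n i : ℕ} {x : X _⦋n + 1⦌} (j : Fin (n + 2)) (h : FlatAt x i) :
    (i + 1 < j → FlatAt (X.map (SimplexCategory.δ j).op x) i) ∧
      (j < i → FlatAt (X.map (SimplexCategory.δ j).op x) (i - 1)) := by
  have hi := h.lt
  have hj := j.2
  constructor
  · intro h1
    exact h.map _ (by omega) (by rw [ev_δ _ (by omega)]; split_ifs <;> omega)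
      (by rw [ev_δ _ (by omega)]; split_ifs <;> omega)
  · intro h1
    exact h.map (j := i - 1) _ (by omega) (by rw [ev_δ _ (by omega)]; split_ifs <;> omega)
      (by rw [ev_δ _ (by omega)]; split_ifs <;> omega)

lemma FlatAt.eq_σ_δ {n r : ℕ} {x : X _⦋n + 1⦌} (h : FlatAt x r) (q : Fin (n + 1)) (j : Fin (n + 2))
    (hq : q.val = r) (hj : j.val = r ∨ j.val = r + 1) :
    x = X.map (σ q).op (X.map (SimplexCategory.δ j).op x) := by
  have hr := h.lt
  refine (h.eq_map _ _ fun i hi => ?_).symm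
  have h1 : ev (σ q) i ≤ n := ev_le _ _
  rw [ev_comp, ev_δ _ h1, ev_σ _ hi]
  split_ifs <;> omega

/-- Two consecutive flat steps merge into one flat step when the vertex between them is deleted. -/
lemma FlatAt.δ_of_flatAt_succ {n r : ℕ} {x : X _⦋n + 1⦌} (h : FlatAt x r) (h' : FlatAt x (r + 1))
    (j : Fin (n + 2)) (hj : j.val = r + 1) : FlatAt (X.map (SimplexCategory.δ j).op x) r := by
  have hr := h'.lt
  rw [h.eq_σ_δ ⟨r, by omega⟩ j rfl (Or.inr hj), flatAt_σ_iff] at h'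
  dsimp only at h'
  rcases h' with h1 | ⟨h1, -⟩ | ⟨-, h1⟩
  · omega
  · omega
  · simpa using h1

lemma map_δ_map_σ {n : ℕ} (j : Fin (n + 2)) (q : Fin (n + 1)) (h : j.val = q ∨ j.val = q + 1)
    (a : X _⦋n⦌) : X.map (SimplexCategory.δ j).op (X.map (σ q).op a) = a := by
  have hq := q.2
  rw [SSet_map_map, show SimplexCategory.δ j ≫ σ q = 𝟙 _ from hom_ext_ev fun i hi => ?_, SSet_map_id]
  rw [ev_comp, ev_δ _ hi, ev_σ _ (by split_ifs <;> omega), ev_id hi]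
  split_ifs <;> omega

/-- A step along which a face of a step-like simplex moves in both directions comes from a corner. -/
lemma face_corner {n r : ℕ} {z : (X ⊗ X' : SSet.{u}) _⦋n + 1⦌} (hz : z ∈ stepLike X X' (n + 1))
    (j : Fin (n + 2)) {a : X _⦋n⦌} {b : X' _⦋n⦌}
    (hab : (X ⊗ X' : SSet.{u}).map (SimplexCategory.δ j).op z = simplexPair a b) (hr : r < n)
    (ha : ¬ FlatAt a r) (hb : ¬ FlatAt b r) {q₁ q₂ : Fin (n + 1)} (hq₁ : q₁.val = r)
    (hq₂ : q₂.val = r + 1) :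
    j.val = r + 1 ∧ (z = simplexPair (X.map (σ q₁).op a) (X'.map (σ q₂).op b) ∨
      z = simplexPair (X.map (σ q₂).op a) (X'.map (σ q₁).op b)) := by
  obtain ⟨x, x', rfl⟩ := exists_simplexPair z
  rw [map_simplexPair, simplexPair_inj] at hab
  obtain ⟨rfl, rfl⟩ := hab
  rw [mem_stepLike] at hz
  -- Unless the middle vertex `r + 1` is deleted, the step `r` of the face is an unchanged step of
  -- `z`, hence flat in one of the directions.
  have hj : j.val = r + 1 := by
    rcases lt_trichotomy j.val (r + 1) with h | h | h
    · rcases hz (r + 1) (by omega) with h1 | h1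
      · exact absurd ((h1.δ j).2 (by omega)) ha
      · exact absurd ((h1.δ j).2 (by omega)) hb
    · exact h
    · rcases hz r (by omega) with h1 | h1
      · exact absurd ((h1.δ j).1 (by omega)) ha
      · exact absurd ((h1.δ j).1 (by omega)) hb
  refine ⟨hj, ?_⟩
  simp only [simplexPair_inj]
  -- If both steps at the corner were flat in the same direction, so would be the step `r` of the
  -- face. The two mixed cases are the two ways around the corner.
  rcases hz r (by omega) with h1 | h1 <;> rcases hz (r + 1) (by omega) with h2 | h2
  · exact absurd (h1.δ_of_flatAt_succ h2 j hj) ha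
  · exact Or.inl ⟨h1.eq_σ_δ _ j hq₁ (Or.inr hj), h2.eq_σ_δ _ j hq₂ (Or.inl hj)⟩
  · exact Or.inr ⟨h2.eq_σ_δ _ j hq₂ (Or.inl hj), h1.eq_σ_δ _ j hq₁ (Or.inr hj)⟩
  · exact absurd (h1.δ_of_flatAt_succ h2 j hj) hb

variable (K : Type u) [CommRing K]

lemma clsCoeff_clsSpan {n : ℕ} {Y : Set (X _⦋n⦌)} {x : X _⦋n⦌} (hx : NonFlat x) (hxY : x ∉ Y)
    {y : (normalizedChains K X).X n} (hy : y ∈ clsSpan K Y) : clsCoeff K x hx y = 0 := by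
  have : clsSpan K Y ≤ LinearMap.ker (clsCoeff K x hx) := by
    refine Submodule.span_le.2 ?_
    rintro _ ⟨y, hy, rfl⟩
    rw [SetLike.mem_coe, LinearMap.mem_ker, clsCoeff_cls, if_neg]
    rintro rfl
    exact hxY hy
  exact this hy

lemma clsMap_d_apply {n : ℕ} (w : X _⦋n + 1⦌ →₀ K) {M : Type*} [AddCommGroup M] [Module K M]
    (f : (normalizedChains K X).X n →ₗ[K] M) :
    f (((normalizedChains K X).d (n + 1) n).hom (clsMap K X (n + 1) w)) =
      ∑ z ∈ w.support, w z • ∑ j : Fin (n + 2), (-1 : K) ^ (j : ℕ) •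
        f (cls K (X.map (SimplexCategory.δ j).op z)) := by
  rw [clsMap, Finsupp.linearCombination_apply, Finsupp.sum, map_sum, map_sum]
  refine Finset.sum_congr rfl fun z _ => ?_
  rw [map_smul, map_smul, normalizedChains_d_cls, map_sum]
  simp only [map_smul]

/-- The two step-like simplices with a common diagonal face have opposite coefficients. -/
lemma coeff_flip {n r : ℕ} {w : (X ⊗ X' : SSet.{u}) _⦋n + 1⦌ →₀ K}
    (hw : w ∈ Finsupp.supported K K (stepLike X X' (n + 1)))
    (hd : ((normalizedChains K (X ⊗ X')).d (n + 1) n).hom (clsMap K (X ⊗ X') (n + 1) w) ∈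
      clsSpan K (stepLike X X' n))
    {a : X _⦋n⦌} {b : X' _⦋n⦌} (hab : NonFlat (simplexPair a b)) (hr : r < n)
    (ha : ¬ FlatAt a r) (hb : ¬ FlatAt b r) {q₁ q₂ : Fin (n + 1)} (hq₁ : q₁.val = r)
    (hq₂ : q₂.val = r + 1) :
    w (simplexPair (X.map (σ q₁).op a) (X'.map (σ q₂).op b)) +
      w (simplexPair (X.map (σ q₂).op a) (X'.map (σ q₁).op b)) = 0 := by
  classical
  have hne : simplexPair (X.map (σ q₁).op a) (X'.map (σ q₂).op b) ≠
      simplexPair (X.map (σ q₂).op a) (X'.map (σ q₁).op b) := by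
    intro h
    have h1 := flatAt_σ q₁ a
    rw [(simplexPair_inj.1 h).1, flatAt_σ_iff] at h1
    rcases h1 with h1 | ⟨-, h1⟩ | ⟨h1, -⟩
    · omega
    · exact ha (hq₁ ▸ h1)
    · omega
  have hc : ∀ z, z ∈ w.support → ∀ j : Fin (n + 2),
      (X ⊗ X' : SSet.{u}).map (SimplexCategory.δ j).op z = simplexPair a b → _ := fun z hz j h =>
    face_corner ((Finsupp.mem_supported K w).1 hw hz) j h hr ha hb hq₁ hq₂
  have hf (z₁ z₂ : (X ⊗ X' : SSet.{u}) _⦋n + 1⦌) (j : Fin (n + 2)) (hj : j.val = r + 1)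
      (hz₁ : z₁ = simplexPair (X.map (σ q₁).op a) (X'.map (σ q₂).op b))
      (hz₂ : z₂ = simplexPair (X.map (σ q₂).op a) (X'.map (σ q₁).op b)) :
      (X ⊗ X' : SSet.{u}).map (SimplexCategory.δ j).op z₁ = simplexPair a b ∧
      (X ⊗ X' : SSet.{u}).map (SimplexCategory.δ j).op z₂ = simplexPair a b := by
    subst hz₁ hz₂
    rw [map_simplexPair, map_simplexPair, map_δ_map_σ _ _ (by omega), map_δ_map_σ _ _ (by omega),
      map_δ_map_σ _ _ (by omega), map_δ_map_σ _ _ (by omega)]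
    exact ⟨rfl, rfl⟩
  -- The diagonal simplex is not step-like, so its coefficient in the boundary is zero.
  have h0 := clsCoeff_clsSpan K hab (fun h => (mem_stepLike.1 h r hr).elim ha hb) hd
  rw [clsMap_d_apply] at h0
  simp only [clsCoeff_cls] at h0
  generalize simplexPair (X.map (σ q₁).op a) (X'.map (σ q₂).op b) = z₁ at *
  generalize simplexPair (X.map (σ q₂).op a) (X'.map (σ q₁).op b) = z₂ at *
  generalize simplexPair a b = y at *
  have hf := fun j hj => hf z₁ z₂ j hj rfl rfl
  -- Each of the two corner simplices has the diagonal simplex as its face `r + 1` and as no other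
  -- face, so both contribute with the same sign.
  have hs : ∀ z, z = z₁ ∨ z = z₂ → w z • (∑ j : Fin (n + 2), (-1 : K) ^ (j : ℕ) •
      (if (X ⊗ X' : SSet.{u}).map (SimplexCategory.δ j).op z = y then (1 : K) else 0)) =
        w z * (-1) ^ (r + 1) := by
    intro z hz12
    by_cases hz : z ∈ w.support
    · rw [Finset.sum_eq_single (⟨r + 1, by omega⟩ : Fin (n + 2)), if_pos, smul_eq_mul, smul_eq_mul,
        mul_one]
      · rcases hz12 with rfl | rfl
        · exact (hf _ rfl).1
        · exact (hf _ rfl).2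
      · intro j _ hj
        rw [if_neg, smul_zero]
        intro h
        exact hj (Fin.ext (hc z hz j h).1)
      · simp
    · rw [Finsupp.notMem_support_iff.1 hz, zero_smul, zero_mul]
  rw [Finset.sum_eq_add z₁ z₂ hne, hs z₁ (Or.inl rfl), hs z₂ (Or.inr rfl), ← add_mul] at h0
  · rcases neg_one_pow_eq_or K (r + 1) with h1 | h1
    · rwa [h1, mul_one] at h0
    · rwa [h1, mul_neg_one, neg_eq_zero] at h0
  · intro z hz hzz
    rw [Finset.sum_eq_zero, smul_zero]
    intro j _
    rw [if_neg, smul_zero]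
    intro h
    rcases (hc z hz j h).2 with h1 | h1
    · exact hzz.1 h1
    · exact hzz.2 h1
  · intro h
    rw [Finsupp.notMem_support_iff.1 h, zero_smul]
  · intro h
    rw [Finsupp.notMem_support_iff.1 h, zero_smul]

end StepLike

/-! ### Flipping corners: step-like chains are detected by front and back faces. -/

section Flip

open SimplexCategory ShuffleChain

variable {X X' : SSet.{u}}

lemma FlatAt.map_eq_self {n r : ℕ} {x : X _⦋n⦌} (h : FlatAt x r) (s : ⦋n⦌ ⟶ ⦋n⦌)
    (hs : ∀ j ≤ n, ev s j = j ∨ r ≤ ev s j ∧ r ≤ j ∧ ev s j ≤ r + 1 ∧ j ≤ r + 1) :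
    X.map s.op x = x := by
  have := h.eq_map s (𝟙 _) (by simpa using hs)
  rwa [SSet_map_id] at this

/-- The operator collapsing everything after the vertex `k`. -/
def collapseAfter {k l n : ℕ} (h : k + l = n) : ⦋n⦌ ⟶ ⦋k⦌ :=
  ofNat n k (fun i => min i k) (fun _ _ hij _ => by omega) (by omega)

/-- The operator collapsing everything before the vertex `k`. -/
def collapseBefore {k l n : ℕ} (h : k + l = n) : ⦋n⦌ ⟶ ⦋l⦌ :=
  ofNat n l (fun i => i - k) (fun _ _ hij _ => by omega) (by omega)

/-- The vertices after `k` are collapsed one at a time from the end, each across a flat step of `x`.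
-/
lemma map_collapseAfter {k l n : ℕ} (h : k + l = n) {x : X _⦋n⦌}
    (hx : ∀ i, k ≤ i → i < n → FlatAt x i) :
    X.map (collapseAfter h).op (X.map (frontFace h).op x) = x := by
  have key : ∀ j, ∀ hj : j ≤ l, ∀ f : ⦋n⦌ ⟶ ⦋n⦌, (∀ i ≤ n, ev f i = min i (n - j)) →
      X.map f.op x = x := by
    intro j
    induction j with
    | zero =>
      intro _ f hf
      rw [show f = 𝟙 _ from hom_ext_ev fun i hi => by rw [hf i hi, ev_id hi]; omega, SSet_map_id]
    | succ j ih =>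
      intro hj f hf
      have hs := (hx (n - (j + 1)) (by omega) (by omega)).map_eq_self
        (ofNat n n (fun i => if i = n - j then n - (j + 1) else i)
          (fun a b hab _ => by split_ifs <;> omega) (by split_ifs <;> omega))
        (fun i hi => by rw [ev_ofNat hi]; split_ifs <;> omega)
      have ht := ih (by omega) (ofNat n n (fun i => min i (n - j)) (fun a b hab _ => by omega)
        (by omega)) (fun i hi => ev_ofNat hi)
      rw [← hs, SSet_map_map] at ht
      refine Eq.trans ?_ (ht.trans hs)
      congr 3
      refine congrArg Quiver.Hom.op (hom_ext_ev fun i hi => ?_)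
      rw [ev_comp, hf i hi, ev_ofNat hi, ev_ofNat (by omega)]
      split_ifs <;> omega
  rw [SSet_map_map]
  refine key l le_rfl _ fun i hi => ?_
  rw [ev_comp, collapseAfter, ev_ofNat hi, ev_frontFace h (by omega)]
  omega

lemma map_collapseBefore {k l n : ℕ} (h : k + l = n) {x : X _⦋n⦌}
    (hx : ∀ i < k, FlatAt x i) :
    X.map (collapseBefore h).op (X.map (backFace h).op x) = x := by
  have key : ∀ j, ∀ hj : j ≤ k, ∀ f : ⦋n⦌ ⟶ ⦋n⦌, (∀ i ≤ n, ev f i = max i j) →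
      X.map f.op x = x := by
    intro j
    induction j with
    | zero =>
      intro _ f hf
      rw [show f = 𝟙 _ from hom_ext_ev fun i hi => by rw [hf i hi, ev_id hi]; omega, SSet_map_id]
    | succ j ih =>
      intro hj f hf
      have hs := (hx j (by omega)).map_eq_self
        (ofNat n n (fun i => if i = j then j + 1 else i)
          (fun a b hab _ => by split_ifs <;> omega) (by split_ifs <;> omega))
        (fun i hi => by rw [ev_ofNat hi]; split_ifs <;> omega)
      have ht := ih (by omega) (ofNat n n (fun i => max i j) (fun a b hab _ => by omega)
        (by omega)) (fun i hi => ev_ofNat hi)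
      rw [← hs, SSet_map_map] at ht
      refine Eq.trans ?_ (ht.trans hs)
      congr 3
      refine congrArg Quiver.Hom.op (hom_ext_ev fun i hi => ?_)
      rw [ev_comp, hf i hi, ev_ofNat hi, ev_ofNat (by omega)]
      split_ifs <;> omega
  rw [SSet_map_map]
  refine key k le_rfl _ fun i hi => ?_
  rw [ev_comp, collapseBefore, ev_ofNat hi, ev_backFace h (by omega)]
  omega

variable (K : Type u) [CommRing K]

/-- The coefficient of a step-like simplex moving first in `X` and then in `X'` is read off from
the front and back faces. -/
lemma coeff_eq_zero_of_frontBack {n k l : ℕ} (h : k + l = n) {w : (X ⊗ X' : SSet.{u}) _⦋n⦌ →₀ K}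
    (hw : w ∈ Finsupp.supported K K (stepLike X X' n))
    (h0 : frontBack K X X' h (clsMap K (X ⊗ X') n w) = 0) {x : X _⦋n⦌} {x' : X' _⦋n⦌}
    (hx : ∀ i, k ≤ i → i < n → FlatAt x i) (hx' : ∀ i < k, FlatAt x' i)
    (hz : NonFlat (simplexPair x x')) : w (simplexPair x x') = 0 := by
  classical
  -- A flat step of the front face would be a flat step of `x`, which is recovered from that face,
  -- and `x'` is flat there too, contrary to `hz`.
  have hf : NonFlat (X.map (frontFace h).op x) := by
    intro i hi
    have hik := hi.lt
    refine hz i (FlatAt.pair ?_ (hx' i hik))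
    rw [← map_collapseAfter h hx]
    exact hi.map _ (by omega) (by rw [collapseAfter, ev_ofNat (by omega)]; omega)
      (by rw [collapseAfter, ev_ofNat (by omega)]; omega)
  have hb : NonFlat (X'.map (backFace h).op x') := by
    intro i hi
    have hik := hi.lt
    refine hz (k + i) (FlatAt.pair (hx _ (by omega) (by omega)) ?_)
    rw [← map_collapseBefore h hx']
    exact hi.map _ (by omega) (by rw [collapseBefore, ev_ofNat (by omega)]; omega)
      (by rw [collapseBefore, ev_ofNat (by omega)]; omega)
  -- The product of the coefficient functionals of the two faces isolates the coefficient of the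
  -- simplex.
  have h1 := congrArg (LinearMap.mul' K K ∘ₗ
    TensorProduct.map (clsCoeff K _ hf) (clsCoeff K _ hb)) h0
  rw [map_zero, clsMap, Finsupp.linearCombination_apply, Finsupp.sum, map_sum, map_sum,
    Finset.sum_eq_single (simplexPair x x')] at h1
  · simpa [frontBack_cls, clsCoeff_cls] using h1
  · intro z hz' hne
    obtain ⟨y, y', rfl⟩ := exists_simplexPair z
    have hy := mem_stepLike.1 ((Finsupp.mem_supported K w).1 hw hz')
    rw [map_smul, map_smul, frontBack_cls, LinearMap.comp_apply, TensorProduct.map_tmul,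
      LinearMap.mul'_apply, clsCoeff_cls, clsCoeff_cls]
    by_cases e1 : X.map (frontFace h).op y = X.map (frontFace h).op x
    swap
    · simp [e1]
    by_cases e2 : X'.map (backFace h).op y' = X'.map (backFace h).op x'
    swap
    · simp [e2]
    -- A step-like simplex with the same front and back faces agrees with the given one: since these
    -- faces have no flat step, its first component must be flat after `k` and its second before
    -- `k`, so both components are recovered from the faces.
    refine absurd (simplexPair_inj.2 ⟨?_, ?_⟩) hne
    · rw [← map_collapseAfter h hx, ← e1, map_collapseAfter h]
      intro i hi hin
      refine (hy i hin).resolve_right fun h2 => hb (i - k) ?_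
      rw [← e2]
      exact h2.map _ (by omega) (by rw [ev_backFace h (by omega)]; omega)
        (by rw [ev_backFace h (by omega)]; omega)
    · rw [← map_collapseBefore h hx', ← e2, map_collapseBefore h]
      intro i hi
      refine (hy i (by omega)).resolve_left fun h2 => hf i ?_
      rw [← e1]
      exact h2.map _ hi (ev_frontFace h hi.le).ge (ev_frontFace h hi).le
  · intro h2
    rw [Finsupp.notMem_support_iff.1 h2, zero_smul, map_zero, map_zero]

open Classical in
/-- The sum of the positions of the flat steps. -/
def flatSum {n : ℕ} (x : X _⦋n⦌) : ℕ := ∑ j ∈ Finset.range n, if FlatAt x j then j else 0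

/-- The flip moves one flat step from `r + 1` to `r` and keeps the others, so the sum drops by one.
It is the measure for the induction over flips. -/
lemma flatSum_flip {n r : ℕ} {b : X _⦋n⦌} (hb : ¬ FlatAt b r) {q₁ q₂ : Fin (n + 1)}
    (hq₁ : q₁.val = r) (hq₂ : q₂.val = r + 1) :
    flatSum (X.map (σ q₁).op b) < flatSum (X.map (σ q₂).op b) := by
  classical
  have hr := q₂.2
  have h : ∀ j ∈ Finset.range (n + 1), (if FlatAt (X.map (σ q₁).op b) j then j else 0) +
      (if j = r + 1 then r + 1 else 0) = (if FlatAt (X.map (σ q₂).op b) j then j else 0) +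
      (if j = r then r else 0) := by
    intro j _
    have e1 := flatAt_σ_iff q₁ b j
    have e2 := flatAt_σ_iff q₂ b j
    rw [hq₁] at e1
    rw [hq₂] at e2
    generalize FlatAt (X.map (σ q₁).op b) j = A at *
    generalize FlatAt (X.map (σ q₂).op b) j = B at *
    rcases lt_trichotomy j r with h1 | rfl | h1
    · have h2 : A ↔ B := by grind
      simp only [h2, if_neg h1.ne, if_neg (show ¬ j = r + 1 by omega)]
    · have h2 : A := by grind
      have h3 : ¬ B := by grind
      simp [h2, h3]
    · rcases Nat.eq_or_lt_of_le h1 with rfl | h2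
      · have h2 : ¬ A := by grind
        have h3 : B := by grind
        simp [h2, h3]
      · have h3 : A ↔ B := by grind
        simp only [h3, if_neg h1.ne', if_neg (show ¬ j = r + 1 by omega)]
  have h1 := Finset.sum_congr rfl h
  rw [Finset.sum_add_distrib, Finset.sum_add_distrib, Finset.sum_ite_eq', Finset.sum_ite_eq',
    if_pos (Finset.mem_range.2 (by omega)), if_pos (Finset.mem_range.2 (by omega))] at h1
  rw [flatSum, flatSum]
  omega

/-- A step-like chain with step-like boundary is determined by its front and back faces. -/
lemma clsMap_eq_zero_of_frontBack {n : ℕ} {w : (X ⊗ X' : SSet.{u}) _⦋n⦌ →₀ K}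
    (hw : w ∈ Finsupp.supported K K (stepLike X X' n))
    (hd : ((normalizedChains K (X ⊗ X')).d n (n - 1)).hom (clsMap K (X ⊗ X') n w) ∈
      clsSpan K (stepLike X X' (n - 1)))
    (h0 : ∀ (k l : ℕ) (h : k + l = n), frontBack K X X' h (clsMap K (X ⊗ X') n w) = 0) :
    clsMap K (X ⊗ X') n w = 0 := by
  classical
  -- Induction on the positions of the flat steps of `x'`: pushing them to the front means moving in
  -- `X` as early as possible.
  suffices H : ∀ (m : ℕ) (x : X _⦋n⦌) (x' : X' _⦋n⦌), flatSum x' = m → NonFlat (simplexPair x x') →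
      w (simplexPair x x') = 0 by
    rw [clsMap, Finsupp.linearCombination_apply, Finsupp.sum]
    refine Finset.sum_eq_zero fun z _ => ?_
    obtain ⟨x, x', rfl⟩ := exists_simplexPair z
    by_cases hz : NonFlat (simplexPair x x')
    · rw [H _ x x' rfl hz, zero_smul]
    · rw [NonFlat, _root_.not_forall_not] at hz
      obtain ⟨i, hi⟩ := hz
      rw [cls_eq_zero K hi, smul_zero]
  intro m
  induction m using Nat.strong_induction_on with
  | _ m ih =>
  intro x x' hm hz
  by_cases hzs : simplexPair x x' ∈ w.support
  swap
  · exact Finsupp.notMem_support_iff.1 hzs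
  have hs := mem_stepLike.1 ((Finsupp.mem_supported K w).1 hw hzs)
  -- Such an `r` marks a corner where the simplex moves in `X'` before it moves in `X`.
  by_cases hc : ∃ r, FlatAt x r ∧ FlatAt x' (r + 1)
  · obtain ⟨r, h1, h2⟩ := hc
    have hrn := h2.lt
    obtain _ | n := n
    · omega
    let q₁ : Fin (n + 1) := ⟨r, by omega⟩
    let q₂ : Fin (n + 1) := ⟨r + 1, by omega⟩
    have e1 := h1.eq_σ_δ q₁ ⟨r + 1, by omega⟩ rfl (Or.inr rfl)
    have e2 := h2.eq_σ_δ q₂ ⟨r + 1, by omega⟩ rfl (Or.inl rfl)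
    generalize X.map (SimplexCategory.δ _).op x = a at e1
    generalize X'.map (SimplexCategory.δ _).op x' = b at e2
    subst e1 e2
    have hf1 := flatAt_σ_iff q₁ a
    have hf2 := flatAt_σ_iff q₂ a
    have hf1' := flatAt_σ_iff q₁ b
    have hf2' := flatAt_σ_iff q₂ b
    simp only [q₁, q₂] at hf1 hf2 hf1' hf2'
    have hz' : ∀ j, FlatAt (X.map (σ q₁).op a) j → ¬ FlatAt (X'.map (σ q₂).op b) j :=
      fun j h3 h4 => hz j (h3.pair h4)
    have ha : ¬ FlatAt a r := fun h3 => hz' (r + 1) ((hf1 _).2 (by simp [h3])) h2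
    have hb : ¬ FlatAt b r := fun h3 => hz' r h1 ((hf2' _).2 (by simp [h3]))
    have hab : ∀ j, FlatAt a j → ¬ FlatAt b j := by
      intro j h3 h4
      rcases lt_trichotomy j r with h5 | rfl | h5
      · exact hz' j ((hf1 _).2 (by simp [h3, h5])) ((hf2' _).2 (by simp [h4]; omega))
      · exact ha h3
      · exact hz' (j + 1) ((hf1 _).2 (by simp [h3]; omega)) ((hf2' _).2 (by simp [h4]; omega))
    -- Up to sign the coefficient equals that of the flipped simplex, which has a smaller flat sum.
    have hflip := coeff_flip K hw hd (fun j h3 => hab j h3.of_pair.1 h3.of_pair.2) (r := r)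
      (by omega) ha hb (q₁ := q₁) (q₂ := q₂) rfl rfl
    rw [ih _ (hm ▸ flatSum_flip hb (q₁ := q₁) (q₂ := q₂) rfl rfl) (X.map (σ q₂).op a)
      (X'.map (σ q₁).op b) rfl, add_zero] at hflip
    · exact hflip
    -- The flip creates no common flat step: `a` and `b` share none, and neither of them is flat at
    -- `r`, where the two new steps could interfere.
    · intro j h3
      obtain ⟨h4, h5⟩ := h3.of_pair
      rw [hf2] at h4
      rw [hf1'] at h5
      have h6 := hab j
      have h7 := hab (j - 1)
      clear hf1 hf2 hf1' hf2' hz' hflip ih hz hw hzs hd h0 hs hab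
      rcases h4 with rfl | ⟨h8, h4⟩ | ⟨h8, h4⟩ <;> rcases h5 with h9 | ⟨h9, h5⟩ | ⟨h9, h5⟩
      · omega
      · omega
      · exact hb h5
      · exact ha (h9 ▸ h4)
      · exact h6 h4 h5
      · omega
      · omega
      · omega
      · exact h7 h4 h5
  -- Without such a corner the flat steps of `x` form a final segment. Its beginning `k`, equal to
  -- `n` if `x` has no flat step, splits the simplex into a part moving in `X` and a part moving in
  -- `X'`.
  · have hup : ∀ i, FlatAt x i → ∀ j, i ≤ j → j < n → FlatAt x j := by
      intro i hi j hij
      induction j, hij using Nat.le_induction with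
      | base => exact fun _ => hi
      | succ j hij ih' => 
        intro hj
        exact (hs _ hj).resolve_right fun h1 => hc ⟨j, ih' (by omega), h1⟩
    have hex : ∃ k, FlatAt x k ∨ k = n := ⟨n, Or.inr rfl⟩
    have hk : Nat.find hex ≤ n := Nat.find_min' hex (Or.inr rfl)
    have hk1 := Nat.find_spec hex
    have hk2 := fun i (hi : i < Nat.find hex) => Nat.find_min hex hi
    generalize Nat.find hex = k at hk hk1 hk2
    refine coeff_eq_zero_of_frontBack K (Nat.add_sub_cancel' hk) hw (h0 _ _ _) ?_ ?_ hz
    · intro i hi hin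
      exact hup k (hk1.resolve_right (by omega)) i hi hin
    · intro i hi
      exact (hs i (by omega)).resolve_left fun h1 => hk2 i hi (Or.inl h1)

end Flip

instance antidiagonalFintype (n : ℕ) : Fintype {p : ℕ × ℕ // p.1 + p.2 = n} :=
  Fintype.subtype (Finset.HasAntidiagonal.antidiagonal n) fun _ =>
    Finset.HasAntidiagonal.mem_antidiagonal

/-! ### Reconstruction of step-like chains from their front and back faces. -/

section Decomposition

open SimplexCategory ShuffleChain

variable (K : Type u) [CommRing K] {X X' : SSet.{u}}

lemma cls_cross_mem {n k l : ℕ} {z : Grid n k l} (hz : IsPath z) {S S' : SetPathPair.{u}}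
    {y : S.X _⦋k⦌} (hy : y ∈ S.Y k) {y' : S'.X _⦋l⦌} (hy' : y' ∈ S'.Y l) :
    cls K (cross z y y') ∈ clsSpan K (diamond S S' n) :=
  Submodule.subset_span ⟨_, mem_diamond_iff.2 ⟨k, l, z, hz, y, hy, y', hy', rfl⟩, rfl⟩

lemma nabla_mem_stepLike {n k l : ℕ} (a : (normalizedChains K X).X k)
    (b : (normalizedChains K X').X l) :
    nabla K X X' n k l a b ∈ clsSpan K (stepLike X X' n) := by
  have key : (nabla K X X' n k l).compr₂ (clsSpan K (stepLike X X' n)).mkQ = 0 := by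
    refine normalizedChains_hom_ext₂ K fun x x' => ?_
    rw [LinearMap.compr₂_apply, nabla_cls, Submodule.mkQ_apply, LinearMap.zero_apply,
      LinearMap.zero_apply, Submodule.Quotient.mk_eq_zero, crossChain,
      Finsupp.linearCombination_apply]
    refine Submodule.sum_mem _ fun z hz => Submodule.smul_mem _ _ ?_
    exact Submodule.subset_span ⟨_, cross_mem_stepLike (IsPath.of_mem_support K hz) x x', rfl⟩
  have := LinearMap.congr_fun₂ key a b
  rwa [LinearMap.compr₂_apply, Submodule.mkQ_apply, LinearMap.zero_apply,
      LinearMap.zero_apply, Submodule.Quotient.mk_eq_zero] at this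

lemma lift_nabla_mem_diamond (S S' : SetPathPair.{u}) {n k l : ℕ}
    (t : clsSpan K (S.Y k) ⊗[K] clsSpan K (S'.Y l)) :
    TensorProduct.lift (nabla K S.X S'.X n k l) (TensorProduct.mapIncl _ _ t) ∈
      clsSpan K (diamond S S' n) := by
  have h : Submodule.map₂ (nabla K S.X S'.X n k l) (clsSpan K (S.Y k)) (clsSpan K (S'.Y l)) ≤
      clsSpan K (diamond S S' n) := by
    rw [clsSpan, clsSpan, Submodule.map₂_span_span, Submodule.span_le]
    rintro _ ⟨_, ⟨y, hy, rfl⟩, _, ⟨y', hy', rfl⟩, rfl⟩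
    change nabla K S.X S'.X n k l (cls K y) (cls K y') ∈ _
    rw [nabla_cls, crossChain, Finsupp.linearCombination_apply]
    exact Submodule.sum_mem _ fun z hz => Submodule.smul_mem _ _
      (cls_cross_mem K (IsPath.of_mem_support K hz) hy hy')
  rw [TensorProduct.map₂_eq_range_lift_comp_mapIncl] at h
  exact h ⟨t, rfl⟩

/-- A generator contributes only if its bidegree is `(k, l)` and its path is the standard one; its
front and back faces are then the elements of `Y` and `Y'` it was built from. -/
lemma frontBack_mem_of_diamond (S S' : SetPathPair.{u}) {n k l : ℕ} (h : k + l = n)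
    {y : (normalizedChains K (S.X ⊗ S'.X)).X n} (hy : y ∈ clsSpan K (diamond S S' n)) :
    frontBack K S.X S'.X h y ∈
      LinearMap.range (TensorProduct.mapIncl (clsSpan K (S.Y k)) (clsSpan K (S'.Y l))) := by
  have : clsSpan K (diamond S S' n) ≤ (LinearMap.range (TensorProduct.mapIncl
      (clsSpan K (S.Y k)) (clsSpan K (S'.Y l)))).comap (frontBack K S.X S'.X h) := by
    refine Submodule.span_le.2 ?_
    rintro _ ⟨p, hp, rfl⟩
    obtain ⟨k', l', z, hz, x, hx, x', hx', rfl⟩ := mem_diamond_iff.1 hp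
    rw [Submodule.comap_coe, Set.mem_preimage, SetLike.mem_coe]
    by_cases h0 : frontBack K S.X S'.X h (cls K (cross z x x')) = 0
    · rw [h0]
      exact Submodule.zero_mem _
    · obtain ⟨rfl, rfl⟩ := frontBack_cross_eq K h hz h0
      obtain ⟨h1, h2⟩ := frontBack_cross_ne_zero K h hz h0
      rw [cross, frontBack_cls, SSet_map_map, SSet_map_map,
        show frontFace h ≫ z.1 = 𝟙 _ from hom_ext_ev fun i hi => by
          rw [ev_comp, ev_frontFace h hi, h1 i hi, ev_id hi],
        show backFace h ≫ z.2 = 𝟙 _ from hom_ext_ev fun i hi => by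
          rw [ev_comp, ev_backFace h hi, h2 i hi, ev_id hi], SSet_map_id, SSet_map_id]
      exact ⟨⟨cls K x, Submodule.subset_span ⟨x, hx, rfl⟩⟩ ⊗ₜ
        ⟨cls K x', Submodule.subset_span ⟨x', hx', rfl⟩⟩, rfl⟩
  exact this hy

lemma frontBack_lift_nabla_self {k l n : ℕ} (h : k + l = n)
    (t : ((normalizedChains K X).X k : ModuleCat.{u} K) ⊗[K] (normalizedChains K X').X l) :
    frontBack K X X' h (TensorProduct.lift (nabla K X X' n k l) t) = t := by
  have : frontBack K X X' h ∘ₗ TensorProduct.lift (nabla K X X' n k l) = LinearMap.id :=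
    TensorProduct.ext' fun a b => by simp [frontBack_nabla_self]
  exact LinearMap.congr_fun this t

lemma frontBack_lift_nabla_ne {k l k' l' n : ℕ} (h : k + l = n) (hne : k ≠ k')
    (t : ((normalizedChains K X).X k' : ModuleCat.{u} K) ⊗[K] (normalizedChains K X').X l') :
    frontBack K X X' h (TensorProduct.lift (nabla K X X' n k' l') t) = 0 := by
  have : frontBack K X X' h ∘ₗ TensorProduct.lift (nabla K X X' n k' l') = 0 :=
    TensorProduct.ext' fun a b => by simp [frontBack_nabla_ne K h hne]
  exact LinearMap.congr_fun this t

lemma d_lift_nabla {n k l : ℕ} (h : k + l = n + 1)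
    (t : ((normalizedChains K X).X k : ModuleCat.{u} K) ⊗[K] (normalizedChains K X').X l) :
    ((normalizedChains K (X ⊗ X')).d (n + 1) n).hom
        (TensorProduct.lift (nabla K X X' (n + 1) k l) t) =
      TensorProduct.lift (nabla K X X' n (k - 1) l)
        (((normalizedChains K X).d k (k - 1)).hom.rTensor _ t) +
      (-1 : K) ^ k • TensorProduct.lift (nabla K X X' n k (l - 1))
        (((normalizedChains K X').d l (l - 1)).hom.lTensor _ t) := by
  have : ((normalizedChains K (X ⊗ X')).d (n + 1) n).hom ∘ₗ
        TensorProduct.lift (nabla K X X' (n + 1) k l) =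
      TensorProduct.lift (nabla K X X' n (k - 1) l) ∘ₗ
        ((normalizedChains K X).d k (k - 1)).hom.rTensor _ +
      (-1 : K) ^ k • TensorProduct.lift (nabla K X X' n k (l - 1)) ∘ₗ
        ((normalizedChains K X').d l (l - 1)).hom.lTensor _ :=
    TensorProduct.ext' fun a b => by simpa using d_nabla K h a b
  exact LinearMap.congr_fun this t

/-- Assembles a family of tensors to a chain of the product. -/
def nablaSum (X X' : SSet.{u}) (n : ℕ)
    (t : ∀ p : {p : ℕ × ℕ // p.1 + p.2 = n},
      ((normalizedChains K X).X p.1.1 : ModuleCat.{u} K) ⊗[K] (normalizedChains K X').X p.1.2) :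
    (normalizedChains K (X ⊗ X')).X n :=
  ∑ p, TensorProduct.lift (nabla K X X' n p.1.1 p.1.2) (t p)

lemma frontBack_nablaSum {n : ℕ}
    (t : ∀ p : {p : ℕ × ℕ // p.1 + p.2 = n},
      ((normalizedChains K X).X p.1.1 : ModuleCat.{u} K) ⊗[K] (normalizedChains K X').X p.1.2)
    {k l : ℕ} (h : k + l = n) :
    frontBack K X X' h (nablaSum K X X' n t) = t ⟨(k, l), h⟩ := by
  rw [nablaSum, map_sum, Finset.sum_eq_single ⟨(k, l), h⟩]
  · exact frontBack_lift_nabla_self K h _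
  · rintro ⟨⟨k', l'⟩, h'⟩ - hne
    refine frontBack_lift_nabla_ne K h ?_ _
    rintro rfl
    dsimp only at h'
    exact hne (Subtype.ext (Prod.ext rfl (by dsimp only; omega)))
  · exact fun h => absurd (Finset.mem_univ _) h

/-- The boundary of an assembled chain. -/
lemma frontBack_d_nablaSum {n : ℕ}
    (t : ∀ p : {p : ℕ × ℕ // p.1 + p.2 = n + 1},
      ((normalizedChains K X).X p.1.1 : ModuleCat.{u} K) ⊗[K] (normalizedChains K X').X p.1.2)
    {k l : ℕ} (h : k + l = n) :
    frontBack K X X' h (((normalizedChains K (X ⊗ X')).d (n + 1) n).hom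
        (nablaSum K X X' (n + 1) t)) =
      ((normalizedChains K X).d (k + 1) k).hom.rTensor _ (t ⟨(k + 1, l), by omega⟩) +
      (-1 : K) ^ k • ((normalizedChains K X').d (l + 1) l).hom.lTensor _
        (t ⟨(k, l + 1), by omega⟩) := by
  rw [nablaSum, map_sum, Finset.sum_congr rfl fun p _ => d_lift_nabla K p.2 (t p),
    Finset.sum_add_distrib, map_add, map_sum, map_sum, Finset.sum_eq_single ⟨(k + 1, l), by omega⟩,
    Finset.sum_eq_single ⟨(k, l + 1), by omega⟩]
  · congr 1
    · exact frontBack_lift_nabla_self K h _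
    · rw [map_smul]
      exact congrArg _ (frontBack_lift_nabla_self K h _)
  · rintro ⟨⟨k', l'⟩, h'⟩ - hne
    dsimp only at h' ⊢
    rw [map_smul, frontBack_lift_nabla_ne K h, smul_zero]
    rintro rfl
    exact hne (Subtype.ext (Prod.ext rfl (by dsimp only; omega)))
  · exact fun h => absurd (Finset.mem_univ _) h
  · rintro ⟨⟨k', l'⟩, h'⟩ - hne
    dsimp only at h' ⊢
    -- For `k' = 0` the truncated index `k' - 1` could coincide with `k`, but then the differential
    -- is zero.
    by_cases h1 : k' = 0
    · subst h1
      rw [HomologicalComplex.shape _ _ _ (by simp), ModuleCat.hom_zero, LinearMap.rTensor_zero,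
        LinearMap.zero_apply, map_zero, map_zero]
    · refine frontBack_lift_nabla_ne K h ?_ _
      rintro rfl
      exact hne (Subtype.ext (Prod.ext (by dsimp only; omega) (by dsimp only; omega)))
  · exact fun h => absurd (Finset.mem_univ _) h

lemma d_nablaSum_mem_stepLike {n : ℕ}
    (t : ∀ p : {p : ℕ × ℕ // p.1 + p.2 = n},
      ((normalizedChains K X).X p.1.1 : ModuleCat.{u} K) ⊗[K] (normalizedChains K X').X p.1.2) :
    nablaSum K X X' n t ∈ clsSpan K (stepLike X X' n) ∧
    ((normalizedChains K (X ⊗ X')).d n (n - 1)).hom (nablaSum K X X' n t) ∈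
      clsSpan K (stepLike X X' (n - 1)) := by
  have key : ∀ (m k l : ℕ) (t : ((normalizedChains K X).X k : ModuleCat.{u} K) ⊗[K]
      (normalizedChains K X').X l),
      TensorProduct.lift (nabla K X X' m k l) t ∈ clsSpan K (stepLike X X' m) := by
    intro m k l t
    induction t with
    | zero => rw [map_zero]; exact Submodule.zero_mem _
    | tmul a b => exact nabla_mem_stepLike K a b
    | add a b ha hb => rw [map_add]; exact Submodule.add_mem _ ha hb
  refine ⟨Submodule.sum_mem _ fun p _ => key _ _ _ _, ?_⟩
  cases n with
  | zero =>
    rw [HomologicalComplex.shape _ _ _ (by simp)]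
    exact Submodule.zero_mem _
  | succ n =>
    rw [nablaSum, map_sum]
    refine Submodule.sum_mem _ fun p _ => ?_
    refine (d_lift_nabla K p.2 (t p)).symm ▸ ?_
    exact Submodule.add_mem _ (key _ _ _ _) (Submodule.smul_mem _ _ (key _ _ _ _))

/-- A step-like chain with step-like boundary is assembled from its front and back faces. -/
lemma eq_nablaSum {n : ℕ} {y : (normalizedChains K (X ⊗ X')).X n}
    (hy : y ∈ clsSpan K (stepLike X X' n))
    (hd : ((normalizedChains K (X ⊗ X')).d n (n - 1)).hom y ∈ clsSpan K (stepLike X X' (n - 1))) :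
    y = nablaSum K X X' n fun p => frontBack K X X' p.2 y := by
  obtain ⟨h1, h2⟩ := d_nablaSum_mem_stepLike K fun p : {p : ℕ × ℕ // p.1 + p.2 = n} =>
    frontBack K X X' p.2 y
  -- The difference of the two sides is step-like with step-like boundary, and all its front and
  -- back faces vanish.
  obtain ⟨w, hw, hwy⟩ := clsMap_mem_clsSpan K (Submodule.sub_mem _ hy h1)
  rw [← sub_eq_zero, ← hwy]
  refine clsMap_eq_zero_of_frontBack K hw ?_ ?_
  · rw [hwy, map_sub]
    exact Submodule.sub_mem _ hd h2
  · intro k l h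
    rw [hwy, map_sub, frontBack_nablaSum, sub_self]

end Decomposition

/-! ### Tensor products of intersections over flat modules. -/

section OmegaTensor

variable {K : Type u} [CommRing K]

/-- Exhibits ω as a kernel inside `D n`, so that flatness applies. For `n = 0` the map involved is
`d 0 0 = 0` and imposes nothing. -/
lemma omegaSubmodule_eq (C : ChainComplex (ModuleCat.{u} K) ℕ) (D : ∀ n, Submodule K (C.X n))
    (n : ℕ) : omegaSubmodule C D n =
      D n ⊓ LinearMap.ker ((D (n - 1)).mkQ ∘ₗ (C.d n (n - 1)).hom) := by
  rw [omegaSubmodule, LinearMap.ker_comp, Submodule.ker_mkQ]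
  congr 1
  refine le_antisymm (iInf_le _ _) (le_iInf fun m => ?_)
  by_cases h : m + 1 = n
  · subst h
    exact le_rfl
  · rw [C.shape n m (by simpa using h)]
    intro x _
    exact Submodule.zero_mem _

variable {A A' Q Q' : Type*} [AddCommGroup A] [AddCommGroup A'] [AddCommGroup Q] [AddCommGroup Q']
  [Module K A] [Module K A'] [Module K Q] [Module K Q']

/-- The intersection `D ⊓ ker g` is the kernel of `g` on `D`, and tensoring with a flat module
preserves kernels; this is applied to one factor after the other. Flatness of `Q` and `Q'` makes the
vanishing tested in the ambient modules hold already over the submodules. -/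
lemma mem_range_mapIncl_inf_ker {D : Submodule K A} {D' : Submodule K A'} {g : A →ₗ[K] Q}
    {g' : A' →ₗ[K] Q'} [Module.Flat K D'] [Module.Flat K Q] [Module.Flat K Q']
    [Module.Flat K ↥(D ⊓ LinearMap.ker g)] {u : A ⊗[K] A'}
    (hu : u ∈ LinearMap.range (TensorProduct.mapIncl D D')) (h : g.rTensor A' u = 0)
    (h' : g'.lTensor A u = 0) :
    u ∈ LinearMap.range
      (TensorProduct.mapIncl (D ⊓ LinearMap.ker g) (D' ⊓ LinearMap.ker g')) := by
  obtain ⟨v, rfl⟩ := hu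
  have e1 : Function.Exact (Submodule.inclusion (inf_le_left : D ⊓ LinearMap.ker g ≤ D))
      (g ∘ₗ D.subtype) := by
    intro x
    constructor
    · exact fun hx => ⟨⟨x.1, x.2, hx⟩, rfl⟩
    · rintro ⟨y, rfl⟩
      exact y.2.2
  have e2 : Function.Exact (Submodule.inclusion (inf_le_left : D' ⊓ LinearMap.ker g' ≤ D'))
      (g' ∘ₗ D'.subtype) := by
    intro x
    constructor
    · exact fun hx => ⟨⟨x.1, x.2, hx⟩, rfl⟩
    · rintro ⟨y, rfl⟩
      exact y.2.2
  have h1 : (g ∘ₗ D.subtype).rTensor D' v = 0 := by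
    apply Module.Flat.lTensor_preserves_injective_linearMap (M := Q) D'.subtype D'.injective_subtype
    rw [map_zero, ← h]
    exact LinearMap.congr_fun (f := (D'.subtype.lTensor Q) ∘ₗ (g ∘ₗ D.subtype).rTensor D')
      (g := g.rTensor A' ∘ₗ TensorProduct.mapIncl D D') (TensorProduct.ext' fun a b => rfl) v
  obtain ⟨v, rfl⟩ := (Module.Flat.rTensor_exact D' e1 v).1 h1
  have h2 : (g' ∘ₗ D'.subtype).lTensor _ v = 0 := by
    apply Module.Flat.rTensor_preserves_injective_linearMap (M := Q') (D ⊓ LinearMap.ker g).subtype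
      (Submodule.injective_subtype _)
    rw [map_zero, ← h']
    exact LinearMap.congr_fun (f := (D ⊓ LinearMap.ker g).subtype.rTensor Q' ∘ₗ
      (g' ∘ₗ D'.subtype).lTensor _) (g := g'.lTensor A ∘ₗ TensorProduct.mapIncl D D' ∘ₗ
      (Submodule.inclusion (inf_le_left : D ⊓ LinearMap.ker g ≤ D)).rTensor D') (TensorProduct.ext' fun a b => rfl) v
  obtain ⟨v, rfl⟩ := (Module.Flat.lTensor_exact _ e2 v).1 h2
  refine ⟨v, ?_⟩
  exact LinearMap.congr_fun (f := TensorProduct.mapIncl _ _) (g := TensorProduct.mapIncl D D' ∘ₗ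
    (Submodule.inclusion inf_le_left).rTensor _ ∘ₗ (Submodule.inclusion inf_le_left).lTensor _)
    (TensorProduct.ext' fun a b => rfl) v

end OmegaTensor

/-! ## The tensor product of chain complexes of modules -/

section TensorObj

open HomologicalComplex

variable {K : Type u} [CommRing K] (C D : ChainComplex (ModuleCat.{u} K) ℕ)

/-- The inclusion of a summand of the tensor product, zero for the wrong total degree. -/
def tensorι (i j n : ℕ) : (C.X i : ModuleCat.{u} K) ⊗[K] D.X j →ₗ[K] (HomologicalComplex.tensorObj C D).X n :=
  if h : i + j = n then (ιTensorObj C D i j n h).hom else 0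

lemma tensorι_eq {i j n : ℕ} (h : i + j = n) :
    tensorι C D i j n = (ιTensorObj C D i j n h).hom := dif_pos h

lemma tensorι_eq_zero {i j n : ℕ} (h : i + j ≠ n) : tensorι C D i j n = 0 := dif_neg h

variable {C D}

lemma tensorObj_hom_ext {M : Type u} [AddCommGroup M] [Module K M] {n : ℕ}
    {f g : (HomologicalComplex.tensorObj C D).X n →ₗ[K] M}
    (h : ∀ i j, i + j = n → ∀ t, f (tensorι C D i j n t) = g (tensorι C D i j n t)) : f = g := by
  have : ModuleCat.ofHom f = ModuleCat.ofHom g := by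
    refine mapBifunctor.hom_ext fun i j hij => ModuleCat.hom_ext (LinearMap.ext fun t => ?_)
    have := h i j hij t
    rwa [tensorι_eq C D hij] at this
  exact congrArg ModuleCat.Hom.hom this

/-- A linear map out of the tensor product, from its values on the summands. -/
def tensorDesc {M : Type u} [AddCommGroup M] [Module K M] {n : ℕ}
    (f : ∀ i j, i + j = n → (C.X i : ModuleCat.{u} K) ⊗[K] D.X j →ₗ[K] M) :
    (HomologicalComplex.tensorObj C D).X n →ₗ[K] M :=
  (mapBifunctorDesc (K₁ := C) (K₂ := D) (F := curriedTensor (ModuleCat.{u} K))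
    (c := ComplexShape.down ℕ) (A := ModuleCat.of K M) fun i j h =>
      ModuleCat.ofHom (f i j h)).hom

lemma tensorDesc_ι {M : Type u} [AddCommGroup M] [Module K M] {n : ℕ}
    (f : ∀ i j, i + j = n → (C.X i : ModuleCat.{u} K) ⊗[K] D.X j →ₗ[K] M) {i j : ℕ}
    (h : i + j = n) (t : (C.X i : ModuleCat.{u} K) ⊗[K] D.X j) :
    tensorDesc f (tensorι C D i j n t) = f i j h t := by
  rw [tensorι_eq C D h]
  exact LinearMap.congr_fun (congrArg ModuleCat.Hom.hom
    (ι_mapBifunctorDesc (K₁ := C) (K₂ := D) (F := curriedTensor (ModuleCat.{u} K))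
      (c := ComplexShape.down ℕ) (A := ModuleCat.of K M) (fun i j h => ModuleCat.ofHom (f i j h))
        i j h)) t

variable (C D) in
/-- The tensor product in degree `n`, as a product of tensor products of modules. -/
def tensorEquiv (n : ℕ) : (HomologicalComplex.tensorObj C D).X n ≃ₗ[K]
    (∀ p : {p : ℕ × ℕ // p.1 + p.2 = n}, (C.X p.1.1 : ModuleCat.{u} K) ⊗[K] D.X p.1.2) :=
  LinearEquiv.ofLinearMap
    (tensorDesc fun i j h => LinearMap.single K
      (fun p : {p : ℕ × ℕ // p.1 + p.2 = n} => (C.X p.1.1 : ModuleCat.{u} K) ⊗[K] D.X p.1.2)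
        ⟨(i, j), h⟩)
    (∑ p : {p : ℕ × ℕ // p.1 + p.2 = n}, tensorι C D p.1.1 p.1.2 n ∘ₗ LinearMap.proj p)
    (by
      refine LinearMap.ext fun t => ?_
      simp only [LinearMap.comp_apply, LinearMap.sum_apply, map_sum, LinearMap.proj_apply,
        LinearMap.id_apply]
      rw [Finset.sum_congr rfl fun p _ => tensorDesc_ι _ p.2 (t p)]
      exact Finset.univ_sum_single t)
    (tensorObj_hom_ext fun i j h t => by
      rw [LinearMap.comp_apply, tensorDesc_ι _ h, LinearMap.sum_apply,
        Finset.sum_eq_single ⟨(i, j), h⟩]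
      · simp
      · intro p _ hp
        rw [LinearMap.comp_apply, LinearMap.proj_apply, LinearMap.single_apply,
          Pi.single_eq_of_ne hp, map_zero]
      · exact fun h => absurd (Finset.mem_univ _) h)

lemma tensorEquiv_symm_apply {n : ℕ} (t : ∀ p : {p : ℕ × ℕ // p.1 + p.2 = n},
    (C.X p.1.1 : ModuleCat.{u} K) ⊗[K] D.X p.1.2) :
    (tensorEquiv C D n).symm t = ∑ p, tensorι C D p.1.1 p.1.2 n (t p) := by
  simp [tensorEquiv]

lemma tensorEquiv_ι_self {n i j : ℕ} (h : i + j = n)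
    (t : (C.X i : ModuleCat.{u} K) ⊗[K] D.X j) :
    tensorEquiv C D n (tensorι C D i j n t) ⟨(i, j), h⟩ = t := by
  refine (congrFun (tensorDesc_ι _ h t) _).trans ?_
  exact Pi.single_eq_same _ _

lemma tensorEquiv_ι_ne {n i j k l : ℕ} (h : k + l = n) (hne : k ≠ i)
    (t : (C.X i : ModuleCat.{u} K) ⊗[K] D.X j) :
    tensorEquiv C D n (tensorι C D i j n t) ⟨(k, l), h⟩ = 0 := by
  by_cases h' : i + j = n
  · refine (congrFun (tensorDesc_ι _ h' t) _).trans ?_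
    refine Pi.single_eq_of_ne (fun e => hne ?_) _
    exact congrArg (fun p => p.1.1) e
  · rw [tensorι_eq_zero C D h', LinearMap.zero_apply, map_zero, Pi.zero_apply]

/-- The Leibniz rule with Koszul sign. The truncated indices are harmless, since in degree zero the
differential in question is `d 0 0 = 0`. -/
lemma d_tensorι {n i j : ℕ} (h : i + j = n + 1) (t : (C.X i : ModuleCat.{u} K) ⊗[K] D.X j) :
    ((HomologicalComplex.tensorObj C D).d (n + 1) n).hom (tensorι C D i j (n + 1) t) =
      tensorι C D (i - 1) j n ((C.d i (i - 1)).hom.rTensor _ t) +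
      (-1 : K) ^ i • tensorι C D i (j - 1) n ((D.d j (j - 1)).hom.lTensor _ t) := by
  rw [tensorι_eq C D h]
  have key : ιTensorObj C D i j (n + 1) h ≫ (HomologicalComplex.tensorObj C D).d (n + 1) n =
      ModuleCat.ofHom (tensorι C D (i - 1) j n ∘ₗ (C.d i (i - 1)).hom.rTensor _) +
      (-1 : K) ^ i • ModuleCat.ofHom
        (tensorι C D i (j - 1) n ∘ₗ (D.d j (j - 1)).hom.lTensor _) := by
    rw [mapBifunctor.d_eq, Preadditive.comp_add, mapBifunctor.ι_D₁, mapBifunctor.ι_D₂]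
    congr 1
    · cases i with
      | zero =>
        rw [mapBifunctor.d₁_eq_zero _ _ _ _ _ _ _ (by simp),
          HomologicalComplex.shape _ _ _ (by simp), ModuleCat.hom_zero, LinearMap.rTensor_zero,
          LinearMap.comp_zero]
        rfl
      | succ i =>
        rw [mapBifunctor.d₁_eq C D (curriedTensor (ModuleCat.{u} K)) (ComplexShape.down ℕ)
          (show (ComplexShape.down ℕ).Rel (i + 1) i from rfl) j n (show i + j = n by omega), Nat.add_sub_cancel, tensorι_eq C D (by omega)]
        exact one_smul _ _
    · cases j with
      | zero =>
        rw [mapBifunctor.d₂_eq_zero _ _ _ _ _ _ _ (by simp),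
          HomologicalComplex.shape _ _ _ (by simp), ModuleCat.hom_zero, LinearMap.lTensor_zero,
          LinearMap.comp_zero]
        exact (smul_zero _).symm
      | succ j =>
        rw [mapBifunctor.d₂_eq C D (curriedTensor (ModuleCat.{u} K)) (ComplexShape.down ℕ) i
          (show (ComplexShape.down ℕ).Rel (j + 1) j from rfl) n (show i + j = n by omega), Nat.add_sub_cancel, tensorι_eq C D (by omega)]
        -- The sign of the total complex is a power of the integer unit `-1`; parity compares it
        -- with the scalar sign.
        change ((-1 : ℤˣ) ^ i) • _ = _
        rcases Nat.even_or_odd i with hi | hi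
        · rw [hi.neg_one_pow, hi.neg_one_pow, one_smul, one_smul]
          rfl
        · rw [hi.neg_one_pow, hi.neg_one_pow, Units.neg_smul, neg_smul, one_smul, one_smul]
          rfl
  exact LinearMap.congr_fun (congrArg ModuleCat.Hom.hom key) t

lemma tensorEquiv_d {n : ℕ} (x : (HomologicalComplex.tensorObj C D).X (n + 1)) {k l : ℕ} (h : k + l = n) :
    tensorEquiv C D n (((HomologicalComplex.tensorObj C D).d (n + 1) n).hom x) ⟨(k, l), h⟩ =
      (C.d (k + 1) k).hom.rTensor _ (tensorEquiv C D (n + 1) x ⟨(k + 1, l), by omega⟩) +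
      (-1 : K) ^ k • (D.d (l + 1) l).hom.lTensor _
        (tensorEquiv C D (n + 1) x ⟨(k, l + 1), by omega⟩) := by
  obtain ⟨t, rfl⟩ := (tensorEquiv C D (n + 1)).symm.surjective x
  rw [LinearEquiv.apply_symm_apply, tensorEquiv_symm_apply, map_sum,
    Finset.sum_congr rfl fun p _ => d_tensorι p.2 (t p), Finset.sum_add_distrib, map_add, map_sum,
    map_sum, Pi.add_apply, Finset.sum_apply, Finset.sum_apply,
    Finset.sum_eq_single ⟨(k + 1, l), by omega⟩, Finset.sum_eq_single ⟨(k, l + 1), by omega⟩]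
  · congr 1
    · exact tensorEquiv_ι_self h _
    · rw [map_smul]
      exact congrArg _ (tensorEquiv_ι_self h _)
  · rintro ⟨⟨k', l'⟩, h'⟩ - hne
    dsimp only at h' ⊢
    rw [map_smul, Pi.smul_apply, tensorEquiv_ι_ne h, smul_zero]
    rintro rfl
    exact hne (Subtype.ext (Prod.ext rfl (by dsimp only; omega)))
  · exact fun h => absurd (Finset.mem_univ _) h
  · rintro ⟨⟨k', l'⟩, h'⟩ - hne
    dsimp only at h' ⊢
    by_cases h1 : k' = 0
    · subst h1
      rw [HomologicalComplex.shape _ _ _ (by simp), ModuleCat.hom_zero, LinearMap.rTensor_zero,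
        LinearMap.zero_apply, map_zero, map_zero, Pi.zero_apply]
    · refine tensorEquiv_ι_ne h ?_ _
      rintro rfl
      exact hne (Subtype.ext (Prod.ext (by dsimp only; omega) (by dsimp only; omega)))
  · exact fun h => absurd (Finset.mem_univ _) h

end TensorObj

/-! ## The chains of a box product -/

section BoxIso

open SimplexCategory ShuffleChain

variable (K : Type u) [CommRing K]

/-- The complex `Ω` of a graded subset of a simplicial set. -/
abbrev omegaChains {X : SSet.{u}} (Y : ∀ n : ℕ, Set (X _⦋n⦌)) : ChainComplex (ModuleCat.{u} K) ℕ :=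
  omegaComplex (normalizedChains K X) fun n => clsSpan K (Y n)

lemma SetPathPair.Omega_eq (S : SetPathPair.{u}) : S.Omega K = omegaChains K S.Y := by
  have : (fun n => ((S.toModulePathPair K).B n).map
      (normalizedProj (S.toModulePathPair K).A n)) = fun n => clsSpan K (S.Y n) := by
    funext n
    refine (Submodule.map_span _ _).trans ?_
    exact congrArg (Submodule.span K) (Set.image_image _ (simplexBasis K S.X) (S.Y n))
  exact congrArg (omegaComplex (normalizedChains K S.X)) this

/-- A chain of the complex `Ω` as a normalized chain. -/
def omegaIncl {X : SSet.{u}} (Y : ∀ n : ℕ, Set (X _⦋n⦌)) (n : ℕ) :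
    (omegaChains K Y).X n →ₗ[K] (normalizedChains K X).X n :=
  (omegaSubmodule (normalizedChains K X) (fun n => clsSpan K (Y n)) n).subtype

lemma omegaIncl_injective {X : SSet.{u}} (Y : ∀ n : ℕ, Set (X _⦋n⦌)) (n : ℕ) :
    Function.Injective (omegaIncl K Y n) := Subtype.val_injective

lemma omegaIncl_d {X : SSet.{u}} (Y : ∀ n : ℕ, Set (X _⦋n⦌)) (n m : ℕ)
    (x : (omegaChains K Y).X n) : omegaIncl K Y m (((omegaChains K Y).d n m).hom x) =
      ((normalizedChains K X).d n m).hom (omegaIncl K Y n x) := rfl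

lemma range_omegaIncl {X : SSet.{u}} (Y : ∀ n : ℕ, Set (X _⦋n⦌)) (n : ℕ) :
    LinearMap.range (omegaIncl K Y n) = clsSpan K (Y n) ⊓
      LinearMap.ker ((clsSpan K (Y (n - 1))).mkQ ∘ₗ ((normalizedChains K X).d n (n - 1)).hom) := by
  rw [← omegaSubmodule_eq (normalizedChains K X) (fun n => clsSpan K (Y n))]
  exact Submodule.range_subtype _

lemma mem_range_omegaIncl {X : SSet.{u}} {Y : ∀ n : ℕ, Set (X _⦋n⦌)} {n : ℕ}
    {x : (normalizedChains K X).X n} : x ∈ LinearMap.range (omegaIncl K Y n) ↔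
      x ∈ clsSpan K (Y n) ∧
        ((normalizedChains K X).d n (n - 1)).hom x ∈ clsSpan K (Y (n - 1)) := by
  rw [range_omegaIncl, Submodule.mem_inf, LinearMap.mem_ker, LinearMap.comp_apply,
    Submodule.mkQ_apply, Submodule.Quotient.mk_eq_zero]

instance [IsDomain K] [IsPrincipalIdealRing K] {X : SSet.{u}} (Y : ∀ n : ℕ, Set (X _⦋n⦌)) (n : ℕ) :
    Module.Flat K ((omegaChains K Y).X n) :=
  inferInstanceAs (Module.Flat K
    ↥(omegaSubmodule (normalizedChains K X) (fun n => clsSpan K (Y n)) n))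

lemma nabla_eq_zero {X X' : SSet.{u}} {n k l : ℕ} (h : k + l ≠ n) : nabla K X X' n k l = 0 := by
  refine normalizedChains_hom_ext₂ K fun x x' => ?_
  rw [nabla_cls]
  exact crossChain_eq_zero K fun z hz => absurd (IsPath.of_mem_support K hz).1 h

variable (S S' : SetPathPair.{u})

/-- The inclusion of the tensor product of two complexes `Ω`. -/
abbrev omegaIncl₂ (k l : ℕ) : ((omegaChains K S.Y).X k : ModuleCat.{u} K) ⊗[K]
      (omegaChains K S'.Y).X l →ₗ[K]
    ((normalizedChains K S.X).X k : ModuleCat.{u} K) ⊗[K] (normalizedChains K S'.X).X l :=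
  TensorProduct.map (omegaIncl K S.Y k) (omegaIncl K S'.Y l)

lemma lift_nabla_omegaIncl₂_mem {n k l : ℕ} (t : ((omegaChains K S.Y).X k : ModuleCat.{u} K) ⊗[K]
      (omegaChains K S'.Y).X l) :
    TensorProduct.lift (nabla K S.X S'.X n k l) (omegaIncl₂ K S S' k l t) ∈
      clsSpan K (diamond S S' n) := by
  have h : ∀ (S : SetPathPair.{u}) (k : ℕ) (x : (omegaChains K S.Y).X k),
      omegaIncl K S.Y k x ∈ clsSpan K (S.Y k) := fun S k x => x.2.1
  have := lift_nabla_mem_diamond K S S' (n := n) (TensorProduct.map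
    ((omegaIncl K S.Y k).codRestrict _ (h S k)) ((omegaIncl K S'.Y l).codRestrict _ (h S' l)) t)
  rw [TensorProduct.mapIncl, ← LinearMap.comp_apply (TensorProduct.map _ _),
    ← TensorProduct.map_comp] at this
  exact this

lemma d_lift_nabla_omegaIncl₂ {n k l : ℕ} (h : k + l = n + 1)
    (t : ((omegaChains K S.Y).X k : ModuleCat.{u} K) ⊗[K] (omegaChains K S'.Y).X l) :
    ((normalizedChains K (S.X ⊗ S'.X)).d (n + 1) n).hom
      (TensorProduct.lift (nabla K S.X S'.X (n + 1) k l) (omegaIncl₂ K S S' k l t)) =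
    TensorProduct.lift (nabla K S.X S'.X n (k - 1) l) (omegaIncl₂ K S S' (k - 1) l
      (((omegaChains K S.Y).d k (k - 1)).hom.rTensor _ t)) +
    (-1 : K) ^ k • TensorProduct.lift (nabla K S.X S'.X n k (l - 1)) (omegaIncl₂ K S S' k (l - 1)
      (((omegaChains K S'.Y).d l (l - 1)).hom.lTensor _ t)) := by
  rw [d_lift_nabla K h]
  have h1 : ((normalizedChains K S.X).d k (k - 1)).hom.rTensor _ ∘ₗ omegaIncl₂ K S S' k l =
      omegaIncl₂ K S S' (k - 1) l ∘ₗ ((omegaChains K S.Y).d k (k - 1)).hom.rTensor _ :=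
    TensorProduct.ext' fun a b => rfl
  have h2 : ((normalizedChains K S'.X).d l (l - 1)).hom.lTensor _ ∘ₗ omegaIncl₂ K S S' k l =
      omegaIncl₂ K S S' k (l - 1) ∘ₗ ((omegaChains K S'.Y).d l (l - 1)).hom.lTensor _ :=
    TensorProduct.ext' fun a b => rfl
  exact congrArg₂ (fun v w => TensorProduct.lift (nabla K S.X S'.X n (k - 1) l) v +
    (-1 : K) ^ k • TensorProduct.lift (nabla K S.X S'.X n k (l - 1)) w)
    (LinearMap.congr_fun h1 t) (LinearMap.congr_fun h2 t)

lemma lift_nabla_mem_range {n k l : ℕ} (h : k + l = n)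
    (t : ((omegaChains K S.Y).X k : ModuleCat.{u} K) ⊗[K] (omegaChains K S'.Y).X l) :
    TensorProduct.lift (nabla K S.X S'.X n k l) (omegaIncl₂ K S S' k l t) ∈
      LinearMap.range (omegaIncl K (X := S.X ⊗ S'.X) (diamond S S') n) := by
  rw [mem_range_omegaIncl]
  refine ⟨lift_nabla_omegaIncl₂_mem K S S' t, ?_⟩
  cases n with
  | zero =>
    rw [HomologicalComplex.shape _ _ _ (by simp)]
    exact Submodule.zero_mem _
  | succ n =>
    rw [Nat.add_sub_cancel, d_lift_nabla_omegaIncl₂ K S S' h]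
    exact Submodule.add_mem _ (lift_nabla_omegaIncl₂_mem K S S' _)
      (Submodule.smul_mem _ _ (lift_nabla_omegaIncl₂_mem K S S' _))

/-- The shuffle map on the complexes `Ω`. -/
def shuffleMap (n : ℕ) : (HomologicalComplex.tensorObj (omegaChains K S.Y) (omegaChains K S'.Y)).X n
    →ₗ[K] (omegaChains K (X := S.X ⊗ S'.X) (diamond S S')).X n :=
  tensorDesc fun k l h => (LinearEquiv.ofInjective _ (omegaIncl_injective K _ n)).symm.toLinearMap ∘ₗ
    (TensorProduct.lift (nabla K S.X S'.X n k l) ∘ₗ omegaIncl₂ K S S' k l).codRestrict _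
      (lift_nabla_mem_range K S S' h)

lemma omegaIncl_shuffleMap_ι {n k l : ℕ}
    (t : ((omegaChains K S.Y).X k : ModuleCat.{u} K) ⊗[K] (omegaChains K S'.Y).X l) :
    omegaIncl K (X := S.X ⊗ S'.X) (diamond S S') n (shuffleMap K S S' n (tensorι _ _ k l n t)) =
      TensorProduct.lift (nabla K S.X S'.X n k l) (omegaIncl₂ K S S' k l t) := by
  by_cases h : k + l = n
  · rw [shuffleMap, tensorDesc_ι _ h]
    have := (LinearEquiv.ofInjective _ (omegaIncl_injective K (X := S.X ⊗ S'.X)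
      (diamond S S') n)).apply_symm_apply ⟨_, lift_nabla_mem_range K S S' h t⟩
    exact congrArg Subtype.val this
  · rw [tensorι_eq_zero _ _ h, nabla_eq_zero K h, LinearMap.zero_apply, map_zero, map_zero]
    have : TensorProduct.lift (0 : (normalizedChains K S.X).X k →ₗ[K]
      (normalizedChains K S'.X).X l →ₗ[K] (normalizedChains K (S.X ⊗ S'.X)).X n) = 0 :=
      TensorProduct.ext' fun a b => rfl
    rw [this, LinearMap.zero_apply]

lemma omegaIncl_shuffleMap {n : ℕ}
    (x : (HomologicalComplex.tensorObj (omegaChains K S.Y) (omegaChains K S'.Y)).X n) :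
    omegaIncl K (X := S.X ⊗ S'.X) (diamond S S') n (shuffleMap K S S' n x) =
      nablaSum K S.X S'.X n fun p => omegaIncl₂ K S S' p.1.1 p.1.2 (tensorEquiv _ _ n x p) := by
  obtain ⟨t, rfl⟩ := (tensorEquiv _ _ n).symm.surjective x
  rw [LinearEquiv.apply_symm_apply, tensorEquiv_symm_apply, map_sum, map_sum, nablaSum]
  exact Finset.sum_congr rfl fun p _ => omegaIncl_shuffleMap_ι K S S' (t p)

lemma shuffleMap_d {n : ℕ}
    (x : (HomologicalComplex.tensorObj (omegaChains K S.Y) (omegaChains K S'.Y)).X (n + 1)) :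
    ((omegaChains K (X := S.X ⊗ S'.X) (diamond S S')).d (n + 1) n).hom
        (shuffleMap K S S' (n + 1) x) =
      shuffleMap K S S' n (((HomologicalComplex.tensorObj (omegaChains K S.Y)
        (omegaChains K S'.Y)).d (n + 1) n).hom x) := by
  have : ((omegaChains K (X := S.X ⊗ S'.X) (diamond S S')).d (n + 1) n).hom ∘ₗ
      shuffleMap K S S' (n + 1) = shuffleMap K S S' n ∘ₗ
        ((HomologicalComplex.tensorObj (omegaChains K S.Y) (omegaChains K S'.Y)).d (n + 1) n).hom :=
    tensorObj_hom_ext fun k l h t => omegaIncl_injective K _ n (by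
      rw [LinearMap.comp_apply, LinearMap.comp_apply, d_tensorι h, omegaIncl_d,
        omegaIncl_shuffleMap_ι, d_lift_nabla_omegaIncl₂ K S S' h, map_add, map_add, map_smul,
        map_smul, omegaIncl_shuffleMap_ι, omegaIncl_shuffleMap_ι])
  exact LinearMap.congr_fun this x

variable [IsDomain K] [IsPrincipalIdealRing K]

/-- Flatness embeds ΩS ⊗ ΩS' into the tensor product of normalized chains, where the shuffle map and
its left inverse are defined. -/
lemma omegaIncl₂_injective (k l : ℕ) : Function.Injective (omegaIncl₂ K S S' k l) := by
  rw [omegaIncl₂, ← LinearMap.lTensor_comp_rTensor, LinearMap.coe_comp]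
  exact (Module.Flat.lTensor_preserves_injective_linearMap _ (omegaIncl_injective K _ _)).comp
    (Module.Flat.rTensor_preserves_injective_linearMap _ (omegaIncl_injective K _ _))

/-- The front and back faces recover every summand. -/
lemma shuffleMap_injective (n : ℕ) : Function.Injective (shuffleMap K S S' n) := by
  rw [injective_iff_map_eq_zero]
  intro x hx
  have h := omegaIncl_shuffleMap K S S' x
  rw [hx, map_zero] at h
  refine (tensorEquiv _ _ n).map_eq_zero_iff.1 (funext fun p => ?_)
  have h1 := frontBack_nablaSum K (fun p => omegaIncl₂ K S S' p.1.1 p.1.2 (tensorEquiv _ _ n x p)) p.2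
  rw [← h, map_zero] at h1
  exact omegaIncl₂_injective K S S' _ _ (h1.symm.trans (map_zero _).symm)

/-- Let t be the family of components of `y`. The component (k, l) of ∂y is (∂ ⊗ 1)tₖ₊₁,ₗ ± (1 ⊗
∂)tₖ,ₗ₊₁ and lies in K[Yₖ] ⊗ K[Y'ₗ]. Modulo K[Yₖ] in the first factor both it and the second term
vanish, hence so does the first term. The other factor is treated symmetrically, and
`mem_range_mapIncl_inf_ker` combines the two conditions. -/
lemma frontBack_mem_range_omegaIncl₂ {n k l : ℕ} (h : k + l = n)
    {y : (normalizedChains K (S.X ⊗ S'.X)).X n} (hy : y ∈ clsSpan K (diamond S S' n))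
    (hd : ((normalizedChains K (S.X ⊗ S'.X)).d n (n - 1)).hom y ∈
      clsSpan K (diamond S S' (n - 1))) :
    frontBack K S.X S'.X h y ∈ LinearMap.range (omegaIncl₂ K S S' k l) := by
  have hsub : ∀ m, clsSpan K (diamond S S' m) ≤ clsSpan K (stepLike S.X S'.X m) := fun m =>
    Submodule.span_mono (Set.image_mono (diamond_subset_stepLike S S' m))
  have hfb := fun (k l : ℕ) (h : k + l = n) => frontBack_mem_of_diamond K S S' h hy
  have hmap : LinearMap.range (omegaIncl₂ K S S' k l) = LinearMap.range (TensorProduct.mapIncl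
      (LinearMap.range (omegaIncl K S.Y k)) (LinearMap.range (omegaIncl K S'.Y l))) := by
    refine (TensorProduct.range_map _ _).trans ?_
    exact (TensorProduct.range_mapIncl _ _).symm
  rw [hmap, range_omegaIncl, range_omegaIncl]
  have hy' := eq_nablaSum K (hsub _ hy) (hsub _ hd)
  -- Tensors from both path submodules die modulo either of them, also after a differential has been
  -- applied to the other factor.
  have kill : ∀ (k l : ℕ) (v : ((normalizedChains K S.X).X k : ModuleCat.{u} K) ⊗[K]
      (normalizedChains K S'.X).X l),
      v ∈ LinearMap.range (TensorProduct.mapIncl (clsSpan K (S.Y k)) (clsSpan K (S'.Y l))) →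
      (clsSpan K (S.Y k)).mkQ.rTensor _ v = 0 ∧ (clsSpan K (S'.Y l)).mkQ.lTensor _ v = 0 ∧
      (∀ m, (clsSpan K (S.Y k)).mkQ.rTensor _
        (((normalizedChains K S'.X).d l m).hom.lTensor _ v) = 0) ∧
      (∀ m, (clsSpan K (S'.Y l)).mkQ.lTensor _
        (((normalizedChains K S.X).d k m).hom.rTensor _ v) = 0) := by
    rintro k l _ ⟨v, rfl⟩
    have h1 : ∀ a : clsSpan K (S.Y k), Submodule.Quotient.mk (p := clsSpan K (S.Y k)) a.1 = 0 :=
      fun a => (Submodule.Quotient.mk_eq_zero _).2 a.2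
    have h2 : ∀ a : clsSpan K (S'.Y l), Submodule.Quotient.mk (p := clsSpan K (S'.Y l)) a.1 = 0 :=
      fun a => (Submodule.Quotient.mk_eq_zero _).2 a.2
    induction v with
    | zero => simp
    | tmul a b => simp [TensorProduct.mapIncl, h1, h2]
    | add a b ha hb =>
      simp only [map_add, ha.1, hb.1, ha.2.1, hb.2.1, ha.2.2.1, hb.2.2.1, ha.2.2.2, hb.2.2.2,
        add_zero, implies_true, and_self]
  obtain _ | n := n
  -- In degree zero the boundary conditions are empty.
  · obtain ⟨rfl, rfl⟩ : k = 0 ∧ l = 0 := by omega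
    refine mem_range_mapIncl_inf_ker (hfb _ _ h) ?_ ?_ <;>
    simp [HomologicalComplex.shape]
  · rw [Nat.add_sub_cancel] at hd
    refine mem_range_mapIncl_inf_ker (hfb _ _ h) ?_ ?_
    · cases k with
      | zero => simp [HomologicalComplex.shape]
      | succ k =>
        have e := frontBack_d_nablaSum K (fun p => frontBack K S.X S'.X p.2 y)
          (show k + l = n by omega)
        rw [← hy'] at e
        have e1 := congrArg ((clsSpan K (S.Y k)).mkQ.rTensor _) e
        rw [(kill _ _ _ (frontBack_mem_of_diamond K S S' (by omega) hd)).1, map_add, map_smul,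
          (kill _ _ _ (hfb k (l + 1) (by omega))).2.2.1, smul_zero, add_zero] at e1
        rw [LinearMap.rTensor_comp]
        exact e1.symm
    · cases l with
      | zero => simp [HomologicalComplex.shape]
      | succ l =>
        have e := frontBack_d_nablaSum K (fun p => frontBack K S.X S'.X p.2 y)
          (show k + l = n by omega)
        rw [← hy'] at e
        have e1 := congrArg ((clsSpan K (S'.Y l)).mkQ.lTensor _) e
        rw [(kill _ _ _ (frontBack_mem_of_diamond K S S' (by omega) hd)).2.1, map_add, map_smul,
          (kill _ _ _ (hfb (k + 1) l (by omega))).2.2.2, zero_add] at e1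
        rw [LinearMap.lTensor_comp]
        have e2 := congrArg (fun v => (-1 : K) ^ k • v) e1
        simpa [smul_smul, ← mul_pow] using e2.symm

lemma shuffleMap_surjective (n : ℕ) : Function.Surjective (shuffleMap K S S' n) := by
  intro x
  have hx := (mem_range_omegaIncl K).1 (LinearMap.mem_range_self
    (omegaIncl K (X := S.X ⊗ S'.X) (diamond S S') n) x)
  have hsub : ∀ m, clsSpan K (diamond S S' m) ≤ clsSpan K (stepLike S.X S'.X m) := fun m =>
    Submodule.span_mono (Set.image_mono (diamond_subset_stepLike S S' m))
  choose t ht using fun p : {p : ℕ × ℕ // p.1 + p.2 = n} =>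
    frontBack_mem_range_omegaIncl₂ K S S' p.2 hx.1 hx.2
  refine ⟨(tensorEquiv _ _ n).symm t, omegaIncl_injective K _ n ?_⟩
  rw [omegaIncl_shuffleMap, LinearEquiv.apply_symm_apply,
    eq_nablaSum K (hsub _ hx.1) (hsub _ hx.2)]
  simp only [ht]

/-- The Eilenberg–Zilber isomorphism for the complexes `Ω`. -/
def shuffleIso : HomologicalComplex.tensorObj (omegaChains K S.Y) (omegaChains K S'.Y) ≅
    omegaChains K (X := S.X ⊗ S'.X) (diamond S S') :=
  HomologicalComplex.Hom.isoOfComponents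
    (fun n => (LinearEquiv.ofBijective (shuffleMap K S S' n)
      ⟨shuffleMap_injective K S S' n, shuffleMap_surjective K S S' n⟩).toModuleIso) (by
    rintro _ n rfl
    exact ModuleCat.hom_ext (LinearMap.ext fun x => shuffleMap_d K S S' x))

end BoxIso

/-! ## Regular path complexes as path pairs of sets -/

section Transport

variable (K : Type u) [CommRing K]

/-- Simplices with a flat step have class zero; hence allowing repetitions in a path complex leaves
Ω unchanged. -/
lemma clsSpan_congr {X : SSet.{u}} {n : ℕ} {Y Y' : Set (X _⦋n⦌)}
    (h : ∀ x, NonFlat x → (x ∈ Y ↔ x ∈ Y')) : clsSpan K Y = clsSpan K Y' := by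
  rw [clsSpan_eq_basis, clsSpan_eq_basis]
  congr 2
  exact Set.ext fun x => h x.1 x.2

variable {X X' : SSet.{u}} (e : X ≅ X')

/-- The map of normalized chains induced by a simplicial map. -/
def normalizedMap (f : X ⟶ X') (n : ℕ) :
    (normalizedChains K X).X n →ₗ[K] (normalizedChains K X').X n :=
  normalizedLift K (fun x => cls K (f.app (op ⦋n⦌) x)) fun x i hx => by
    refine cls_eq_zero K (i := i) ?_
    obtain ⟨m, c, θ, rfl, hi, h⟩ := hx
    exact ⟨m, f.app (op ⦋m⦌) c, θ, NatTrans.naturality_apply f θ.op c, hi, h⟩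

lemma normalizedMap_cls (f : X ⟶ X') {n : ℕ} (x : X _⦋n⦌) :
    normalizedMap K f n (cls K x) = cls K (f.app (op ⦋n⦌) x) :=
  normalizedLift_cls K _ _ _

lemma normalizedMap_d (f : X ⟶ X') {n m : ℕ} (x : (normalizedChains K X).X n) :
    ((normalizedChains K X').d n m).hom (normalizedMap K f n x) =
      normalizedMap K f m (((normalizedChains K X).d n m).hom x) := by
  by_cases h : m + 1 = n
  · subst h
    have : ((normalizedChains K X').d (m + 1) m).hom ∘ₗ normalizedMap K f (m + 1) =
        normalizedMap K f m ∘ₗ ((normalizedChains K X).d (m + 1) m).hom := by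
      refine normalizedChains_hom_ext K fun x => ?_
      rw [LinearMap.comp_apply, LinearMap.comp_apply, normalizedMap_cls, normalizedChains_d_cls,
        normalizedChains_d_cls, map_sum]
      refine Finset.sum_congr rfl fun i _ => ?_
      rw [map_smul, normalizedMap_cls]
      congr 2
      exact (NatTrans.naturality_apply f (SimplexCategory.δ i).op x).symm
    exact LinearMap.congr_fun this x
  · rw [HomologicalComplex.shape _ _ _ h, HomologicalComplex.shape _ _ _ h]
    exact (map_zero (normalizedMap K f m)).symm

/-- The isomorphism of normalized chains induced by an isomorphism of simplicial sets. -/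
def normalizedEquiv (n : ℕ) : (normalizedChains K X).X n ≃ₗ[K] (normalizedChains K X').X n :=
  LinearEquiv.ofLinearMap (normalizedMap K e.hom n) (normalizedMap K e.inv n)
    (normalizedChains_hom_ext K fun x => by
      rw [LinearMap.comp_apply, normalizedMap_cls, normalizedMap_cls, LinearMap.id_apply]
      exact congrArg (cls K) (ConcreteCategory.congr_hom
        (congrArg (fun g => NatTrans.app g (op ⦋n⦌)) e.inv_hom_id) x))
    (normalizedChains_hom_ext K fun x => by
      rw [LinearMap.comp_apply, normalizedMap_cls, normalizedMap_cls, LinearMap.id_apply]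
      exact congrArg (cls K) (ConcreteCategory.congr_hom
        (congrArg (fun g => NatTrans.app g (op ⦋n⦌)) e.hom_inv_id) x))

lemma normalizedEquiv_mem_clsSpan {n : ℕ} {Y' : Set (X' _⦋n⦌)}
    (x : (normalizedChains K X).X n) :
    normalizedEquiv K e n x ∈ clsSpan K Y' ↔
      x ∈ clsSpan K {x : X _⦋n⦌ | e.hom.app (op ⦋n⦌) x ∈ Y'} := by
  constructor
  · intro h
    have : clsSpan K Y' ≤ (clsSpan K {x : X _⦋n⦌ | e.hom.app (op ⦋n⦌) x ∈ Y'}).comap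
        (normalizedMap K e.inv n) := by
      refine Submodule.span_le.2 ?_
      rintro _ ⟨y, hy, rfl⟩
      rw [Submodule.comap_coe, Set.mem_preimage, SetLike.mem_coe, normalizedMap_cls]
      refine Submodule.subset_span ⟨_, ?_, rfl⟩
      have h1 : e.hom.app (op ⦋n⦌) (e.inv.app (op ⦋n⦌) y) = y := ConcreteCategory.congr_hom
        (congrArg (fun g => NatTrans.app g (op ⦋n⦌)) e.inv_hom_id) y
      rwa [Set.mem_ofPred_eq, h1]
    have h1 := this h
    have h2 : normalizedMap K e.inv n (normalizedEquiv K e n x) = x :=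
      (normalizedEquiv K e n).symm_apply_apply x
    rwa [Submodule.mem_comap, h2] at h1
  · intro h
    have : clsSpan K {x : X _⦋n⦌ | e.hom.app (op ⦋n⦌) x ∈ Y'} ≤ (clsSpan K Y').comap
        (normalizedMap K e.hom n) := by
      refine Submodule.span_le.2 ?_
      rintro _ ⟨y, hy, rfl⟩
      rw [Submodule.comap_coe, Set.mem_preimage, SetLike.mem_coe, normalizedMap_cls]
      exact Submodule.subset_span ⟨_, hy, rfl⟩
    exact this h

/-- The complex `Ω` depends only on the simplicial set and the set of its simplices without flat
steps. -/
def omegaChainsIso {Y : ∀ n : ℕ, Set (X _⦋n⦌)} {Y' : ∀ n : ℕ, Set (X' _⦋n⦌)}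
    (h : ∀ n (x : X _⦋n⦌), NonFlat x → (x ∈ Y n ↔ e.hom.app (op ⦋n⦌) x ∈ Y' n)) :
    omegaChains K Y ≅ omegaChains K Y' := by
  have hY : ∀ n x, normalizedEquiv K e n x ∈ clsSpan K (Y' n) ↔ x ∈ clsSpan K (Y n) := by
    intro n x
    have := clsSpan_congr K (Y := {x : X _⦋n⦌ | e.hom.app (op ⦋n⦌) x ∈ Y' n}) (Y' := Y n)
      fun x hx => (h n x hx).symm
    rw [normalizedEquiv_mem_clsSpan, this]
  refine HomologicalComplex.Hom.isoOfComponents (fun n => ((normalizedEquiv K e n).ofSubmodules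
    (omegaSubmodule (normalizedChains K X) (fun n => clsSpan K (Y n)) n)
    (omegaSubmodule (normalizedChains K X') (fun n => clsSpan K (Y' n)) n) ?_).toModuleIso) ?_
  · ext x
    obtain ⟨x, rfl⟩ := (normalizedEquiv K e n).surjective x
    rw [Submodule.mem_map_equiv, LinearEquiv.symm_apply_apply]
    simp only [omegaSubmodule, Submodule.mem_inf, Submodule.mem_iInf, Submodule.mem_comap, hY]
    refine and_congr_right fun _ => forall_congr' fun m => ?_
    rw [← hY]
    exact iff_of_eq (congrArg (· ∈ clsSpan K (Y' m)) (normalizedMap_d K e.hom x).symm)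
  · intro n m _
    refine ModuleCat.hom_ext (LinearMap.ext fun x => Subtype.ext ?_)
    exact normalizedMap_d K e.hom x.1

end Transport

/-! ### Regular path complexes as path pairs on coskeleta. -/

section Cosk

open SimplexCategory ShuffleChain

variable {V V' : Type u}

/-- The `i`-th vertex, where `i` is truncated to the dimension. -/
def coskVertex {n : ℕ} (v : (coskZero V) _⦋n⦌) (i : ℕ) : V :=
  (show Fin (n + 1) → V from v) ⟨min i n, Nat.lt_succ_of_le (min_le_right i n)⟩

lemma coskVertex_eq {n : ℕ} (v : Fin (n + 1) → V) (i : Fin (n + 1)) :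
    coskVertex (V := V) (n := n) v i.val = v i :=
  congrArg v (Fin.ext (min_eq_left (Nat.lt_succ_iff.1 i.2)))

lemma coskVertex_ext {n : ℕ} {v w : (coskZero V) _⦋n⦌}
    (h : ∀ i ≤ n, coskVertex v i = coskVertex w i) : v = w := by
  refine funext fun i : Fin (n + 1) => ?_
  have := h i.val (Nat.lt_succ_iff.1 i.2)
  exact (coskVertex_eq (V := V) v i).symm.trans (this.trans (coskVertex_eq (V := V) w i))

lemma coskVertex_map {n m : ℕ} (θ : ⦋n⦌ ⟶ ⦋m⦌) (v : (coskZero V) _⦋m⦌) (i : ℕ) :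
    coskVertex ((coskZero V).map θ.op v) i = coskVertex v (ev θ i) :=
  (coskVertex_eq (V := V) (n := m) v _).symm

/-- A repeated vertex is restored by deleting it and repeating its neighbour. So the simplices
without flat step are the regular sequences. -/
lemma flatAt_cosk_iff {n i : ℕ} {v : (coskZero V) _⦋n⦌} :
    FlatAt v i ↔ i < n ∧ coskVertex v i = coskVertex v (i + 1) := by
  constructor
  · rintro ⟨m, c, θ, rfl, hi, h⟩
    exact ⟨hi, by rw [coskVertex_map, coskVertex_map, h]⟩
  · rintro ⟨hi, h⟩
    obtain _ | n := n
    · omega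
    have : v = (coskZero V).map (σ (⟨i, hi⟩ : Fin (n + 1))).op
        ((coskZero V).map (SimplexCategory.δ (⟨i, by omega⟩ : Fin (n + 2))).op v) := by
      refine coskVertex_ext fun j hj => ?_
      rw [coskVertex_map, coskVertex_map, ev_σ _ hj, ev_δ _ (by split_ifs <;> omega)]
      dsimp only
      split_ifs with h1 h2 h2
      · rfl
      · rw [show j = i by omega, h]
      · omega
      · rw [show j - 1 + 1 = j by omega]
    rw [this]
    exact flatAt_σ _ _

/-- A monotone map that jumps over a value never returns to it, and one that moves by at most one
takes all values between its ends. -/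
lemma surjective_iff_ev {n k : ℕ} (θ : ⦋n⦌ ⟶ ⦋k⦌) :
    Function.Surjective (θ.toOrderHom : Fin (n + 1) → Fin (k + 1)) ↔
      ev θ 0 = 0 ∧ ev θ n = k ∧ ∀ j < n, ev θ (j + 1) ≤ ev θ j + 1 := by
  have hs : Function.Surjective (θ.toOrderHom : Fin (n + 1) → Fin (k + 1)) ↔
      ∀ a ≤ k, ∃ j ≤ n, ev θ j = a := by
    constructor
    · intro h a ha
      obtain ⟨b, hb⟩ := h ⟨a, Nat.lt_succ_of_le ha⟩
      exact ⟨b.val, Nat.lt_succ_iff.1 b.2, (ev_val θ b).trans (congrArg Fin.val hb)⟩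
    · intro h a
      obtain ⟨j, hj, hja⟩ := h a.val (Nat.lt_succ_iff.1 a.2)
      exact ⟨⟨j, Nat.lt_succ_of_le hj⟩, Fin.ext ((ev_val θ ⟨j, Nat.lt_succ_of_le hj⟩).symm.trans hja)⟩
  rw [hs]
  constructor
  · intro h
    refine ⟨?_, ?_, fun j hj => ?_⟩
    · obtain ⟨j, -, h1⟩ := h 0 (Nat.zero_le k)
      have := ev_mono θ (Nat.zero_le j)
      omega
    · obtain ⟨j, hj, h1⟩ := h k le_rfl
      have := ev_mono θ hj
      have := ev_le θ n
      omega
    · by_contra h1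
      have h2 := ev_le θ (j + 1)
      obtain ⟨b, hb, h3⟩ := h (ev θ j + 1) (by omega)
      rcases Nat.lt_or_ge j b with h4 | h4
      · have := ev_mono θ (Nat.succ_le_of_lt h4)
        simp only [Nat.succ_eq_add_one] at this
        omega
      · have := ev_mono θ h4
        omega
  · rintro ⟨h0, hn, h1⟩
    have key : ∀ m ≤ n, ∀ a ≤ ev θ m, ∃ j ≤ m, ev θ j = a := by
      intro m
      induction m with
      | zero => exact fun _ a ha => ⟨0, le_rfl, by omega⟩
      | succ m ih =>
        intro hm a ha
        by_cases h2 : a ≤ ev θ m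
        · obtain ⟨j, hj, h3⟩ := ih (by omega) a h2
          exact ⟨j, by omega, h3⟩
        · exact ⟨m + 1, le_rfl, by have := h1 m (by omega); omega⟩
    exact fun a ha => key n le_rfl a (by omega)

lemma isReg_iff {n k : ℕ} {v : Fin (n + 1) → V} {u : Fin (k + 1) → V} :
    IsReg v u ↔ (∀ i < k, coskVertex (V := V) (n := k) u i ≠ coskVertex (V := V) (n := k) u (i + 1)) ∧
      ∃ θ : ⦋n⦌ ⟶ ⦋k⦌, (ev θ 0 = 0 ∧ ev θ n = k ∧ ∀ j < n, ev θ (j + 1) ≤ ev θ j + 1) ∧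
        v = (coskZero V).map θ.op u := by
  refine and_congr ?_ ?_
  · constructor
    · intro h i hi hc
      exact h ⟨i, hi⟩ ((coskVertex_eq (V := V) u (Fin.castSucc ⟨i, hi⟩)).symm.trans
        (hc.trans (coskVertex_eq (V := V) u (Fin.succ ⟨i, hi⟩))))
    · intro h i hc
      exact h i.val i.2 ((coskVertex_eq (V := V) u i.castSucc).trans
        (hc.trans (coskVertex_eq (V := V) u i.succ).symm))
  · constructor
    · rintro ⟨s, hs, h⟩
      exact ⟨mkHom s, (surjective_iff_ev (mkHom s)).1 hs, h⟩
    · rintro ⟨θ, hθ, h⟩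
      exact ⟨θ.toOrderHom, (surjective_iff_ev θ).2 hθ, h⟩

/-- The path pair of sets of a regular path complex. -/
def RegularPathComplex.toSetPathPair (P : RegularPathComplex V) : SetPathPair.{u} where
  X := coskZero V
  Y n := {v | ∃ k, ∃ u ∈ P.P k, IsReg (n := n) v u}
  σ_mem n i := by
    rintro v ⟨k, u, hu, hreg, s, hs, rfl⟩
    refine ⟨k, u, hu, hreg, s.comp (σ i).toOrderHom, hs.comp ?_, rfl⟩
    exact Fin.predAbove_surjective i
  δ_zero_mem n := by
    rintro v ⟨k, u, hu, h⟩
    exact P.isReg_tail hu h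
  δ_last_mem n := by
    rintro v ⟨k, u, hu, h⟩
    have := P.isReg_init hu h
    have e : (fun i : Fin (n + 1) => (show Fin (n + 2) → V from v) i.castSucc) =
        (coskZero V).δ (Fin.last (n + 1)) v :=
      funext fun i => congrArg v (Fin.succAbove_last_apply i).symm
    exact e ▸ this

/-- For a sequence without repetition the surjection onto its reduced form is strictly increasing,
hence the identity. -/
lemma RegularPathComplex.mem_toSetPathPair_iff (P : RegularPathComplex V) {n : ℕ}
    {v : (coskZero V) _⦋n⦌} (hv : NonFlat v) : v ∈ P.P n ↔ v ∈ P.toSetPathPair.Y n := by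
  constructor
  · intro h
    exact ⟨n, v, h, P.regular n v h, OrderHom.id, Function.surjective_id, rfl⟩
  · rintro ⟨k, u, hu, h⟩
    obtain ⟨h1, θ, ⟨h2, h3, h4⟩, rfl⟩ := isReg_iff.1 h
    have h5 : ∀ i ≤ n, ev θ i = i := by
      intro i
      induction i with
      | zero => exact fun _ => h2
      | succ i ih =>
        intro hi
        have := h4 i hi
        have := hv.ev_lt (i := i) hi
        have := ih (by omega)
        omega
    obtain rfl : n = k := by rw [← h3, h5 n le_rfl]
    have e : (coskZero V).map θ.op (show (coskZero V) _⦋n⦌ from u) = u := by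
      rw [show θ = 𝟙 _ from hom_ext_ev fun i hi => by rw [h5 i hi, ev_id hi], SSet_map_id]
    exact (congrArg (fun x : Fin (n + 1) → V => x ∈ P.P n) e).symm.mp hu

/-- A coskeleton of a product of sets is a product of coskeleta. -/
def coskProdIso (V V' : Type u) : coskZero (V × V') ≅ (coskZero V ⊗ coskZero V' : SSet.{u}) where
  hom := { app := fun a => ↾fun w => ((fun i => (w i).1, fun i => (w i).2) :
    (Fin (a.unop.len + 1) → V) × (Fin (a.unop.len + 1) → V')) }
  inv := { app := fun a => ↾fun p : (Fin (a.unop.len + 1) → V) × (Fin (a.unop.len + 1) → V') =>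
    fun i => (p.1 i, p.2 i) }

/-- The surjections onto the two reduced sequences are the coordinates of a grid path: at each step
one of them moves because `w` is regular, and not both because `w` is step-like and the reduced
sequences are regular. Conversely the coordinates of a path are surjective, so composing with them
does not change the reduced sequences. -/
lemma RegularPathComplex.mem_box_iff (P : RegularPathComplex V) (P' : RegularPathComplex V') {n : ℕ}
    {w : (coskZero (V × V')) _⦋n⦌} (hw : NonFlat w) : w ∈ (P.box P').P n ↔
      (coskProdIso V V').hom.app (op ⦋n⦌) w ∈ diamond P.toSetPathPair P'.toSetPathPair n := by
  have hv1 : ∀ i, coskVertex (V := V) (n := n) (fun i => ((show Fin (n + 1) → V × V' from w) i).1) i =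
    (coskVertex w i).1 := fun i => rfl
  have hv2 : ∀ i, coskVertex (V := V') (n := n) (fun i => ((show Fin (n + 1) → V × V' from w) i).2) i =
    (coskVertex w i).2 := fun i => rfl
  have hw' : ∀ i < n, coskVertex w i ≠ coskVertex w (i + 1) := fun i hi h =>
    hw i (flatAt_cosk_iff.2 ⟨hi, h⟩)
  have hcast : ∀ i : Fin n, coskVertex w i.val = w i.castSucc ∧
      coskVertex w (i.val + 1) = w i.succ := fun i =>
    ⟨coskVertex_eq (V := V × V') w i.castSucc, coskVertex_eq (V := V × V') w i.succ⟩
  refine Iff.trans ?_ mem_diamond_iff.symm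
  constructor
  · rintro ⟨-, h2, ⟨k, u, hu, h3⟩, l, u', hu', h4⟩
    obtain ⟨h5, θ, ⟨a0, an, a1⟩, e⟩ := isReg_iff.1 h3
    obtain ⟨h5', θ', ⟨b0, bn, b1⟩, e'⟩ := isReg_iff.1 h4
    have c1 : ∀ i, (coskVertex w i).1 = coskVertex (V := V) (n := k) u (ev θ i) := fun i => by
      rw [← hv1, e]
      exact coskVertex_map θ _ i
    have c2 : ∀ i, (coskVertex w i).2 = coskVertex (V := V') (n := l) u' (ev θ' i) := fun i => by
      rw [← hv2, e']
      exact coskVertex_map θ' _ i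
    have hz : ∀ j ≤ n, ev θ j + ev θ' j = j := by
      intro j
      induction j with
      | zero => intro _; omega
      | succ j ih =>
        intro hj
        have i0 := ih (by omega)
        have i1 := a1 j hj
        have i2 := b1 j hj
        have i3 := ev_mono θ (Nat.le_succ j)
        have i4 := ev_mono θ' (Nat.le_succ j)
        have i5 := ev_le θ (j + 1)
        have i6 := ev_le θ' (j + 1)
        simp only [Nat.succ_eq_add_one] at i3 i4
        -- Both coordinates at rest would repeat a vertex of `w`.
        have i7 : ¬ (ev θ (j + 1) = ev θ j ∧ ev θ' (j + 1) = ev θ' j) := fun ⟨q1, q2⟩ =>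
          hw' j hj (Prod.ext (by rw [c1, c1, q1]) (by rw [c2, c2, q2]))
        -- If both coordinates moved, the step-like condition would produce a repetition in `u` or
        -- in `u'`.
        have i8 : ¬ (ev θ (j + 1) = ev θ j + 1 ∧ ev θ' (j + 1) = ev θ' j + 1) := by
          rintro ⟨q1, q2⟩
          have hh := h2 ⟨j, hj⟩
          rw [← (hcast ⟨j, hj⟩).1, ← (hcast ⟨j, hj⟩).2] at hh
          dsimp only at hh
          rw [c1, c1, c2, c2, q1, q2] at hh
          rcases hh with hh | hh
          · exact h5 _ (by omega) hh
          · exact h5' _ (by omega) hh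
        omega
    refine ⟨k, l, (θ, θ'), ⟨by have := hz n le_rfl; omega, hz⟩, u, ?_, u', ?_, ?_⟩
    · exact ⟨k, u, hu, P.regular k u hu, OrderHom.id, Function.surjective_id, rfl⟩
    · exact ⟨l, u', hu', P'.regular l u' hu', OrderHom.id, Function.surjective_id, rfl⟩
    · exact (simplexPair_inj (X := coskZero V) (X' := coskZero V') (n := n)).2 ⟨e, e'⟩
  · rintro ⟨k, l, z, hz, y, ⟨k', u, hu, h3⟩, y', ⟨l', u', hu', h4⟩, hh⟩
    have hh : simplexPair (X := coskZero V) (X' := coskZero V') (n := n)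
        (fun i => ((show Fin (n + 1) → V × V' from w) i).1)
      (fun i => ((show Fin (n + 1) → V × V' from w) i).2) = cross z y y' := hh
    have hstep := cross_mem_stepLike hz y y'
    rw [← hh] at hstep
    obtain ⟨e, e'⟩ := simplexPair_inj.1 hh
    have hs : (ev z.1 0 = 0 ∧ ev z.1 n = k ∧ ∀ j < n, ev z.1 (j + 1) ≤ ev z.1 j + 1) ∧
        (ev z.2 0 = 0 ∧ ev z.2 n = l ∧ ∀ j < n, ev z.2 (j + 1) ≤ ev z.2 j + 1) := by
      have h0 := hz.2 0 (Nat.zero_le _)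
      have hn := hz.2 n le_rfl
      have h1 := ev_le z.1 n
      have h2 := ev_le z.2 n
      have h5 := hz.1
      refine ⟨⟨by omega, by omega, fun j hj => ?_⟩, ⟨by omega, by omega, fun j hj => ?_⟩⟩ <;>
      · have h6 := hz.2 j hj.le
        have h7 := hz.2 (j + 1) hj
        have h8 := ev_mono z.1 (Nat.le_succ j)
        have h9 := ev_mono z.2 (Nat.le_succ j)
        simp only [Nat.succ_eq_add_one] at h8 h9
        omega
    refine ⟨fun i => ?_, fun i => ?_, ⟨k', u, hu, h3.1, ?_⟩, ⟨l', u', hu', h4.1, ?_⟩⟩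
    · rw [← (hcast i).1, ← (hcast i).2]
      exact hw' i i.2
    · rw [← (hcast i).1, ← (hcast i).2]
      rcases mem_stepLike.1 hstep i.val i.2 with h | h
      · exact Or.inl (flatAt_cosk_iff.1 h).2
      · exact Or.inr (flatAt_cosk_iff.1 h).2
    · obtain ⟨s, hs', rfl⟩ := h3.2
      exact ⟨s.comp z.1.toOrderHom, hs'.comp ((surjective_iff_ev z.1).2 hs.1), e⟩
    · obtain ⟨s, hs', rfl⟩ := h4.2
      exact ⟨s.comp z.2.toOrderHom, hs'.comp ((surjective_iff_ev z.2).2 hs.2), e'⟩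

variable (K : Type u) [CommRing K]

lemma RegularPathComplex.Omega_eq (P : RegularPathComplex V) :
    P.Omega K = omegaChains K P.toSetPathPair.Y := by
  have : (fun n => clsSpan K (X := coskZero V) (n := n) (P.P n)) =
      fun n => clsSpan K (P.toSetPathPair.Y n) :=
    funext fun n => clsSpan_congr K fun v hv => P.mem_toSetPathPair_iff hv
  exact congrArg (omegaComplex (normalizedChains K (coskZero V))) this

/-- The complex of a regular box product. -/
def RegularPathComplex.boxIso (P : RegularPathComplex V) (P' : RegularPathComplex V') :
    (P.box P').Omega K ≅ omegaChains K (X := coskZero V ⊗ coskZero V')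
      (diamond P.toSetPathPair P'.toSetPathPair) :=
  omegaChainsIso K (coskProdIso V V') (Y := fun n => (P.box P').P n) fun _ _ hw =>
    P.mem_box_iff P' hw

end Cosk

/-! ### Submodules of projective modules over a principal ideal domain. -/

section Projective

variable {K : Type u} [CommRing K] [IsDomain K] [IsPrincipalIdealRing K]

/-- Over a principal ideal domain, a quotient of an injective module is injective. -/
lemma Module.Injective.of_surjective_of_isPrincipalIdealRing {E E' : Type u} [AddCommGroup E]
    [Module K E] [AddCommGroup E'] [Module K E'] (hE : Module.Injective K E) (p : E →ₗ[K] E')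
    (hp : Function.Surjective p) : Module.Injective K E' := by
  refine Module.Baer.injective fun I g => ?_
  rcases IsPrincipalIdealRing.principal I with ⟨m, rfl⟩
  obtain rfl | h0 := eq_or_ne m 0
  · refine ⟨0, fun n hn => ?_⟩
    rw [Submodule.span_zero_singleton] at hn
    subst hn
    exact (map_zero g).symm
  -- Baer's criterion for the ideal generated by `m ≠ 0`: the value at `m` is lifted to `E`, divided
  -- by `m` there by injectivity, and the quotient `h 1` is projected back.
  obtain ⟨e, he⟩ := hp (g ⟨m, Submodule.subset_span (Set.mem_singleton _)⟩)
  obtain ⟨h, hh⟩ := hE.out (LinearMap.toSpanSingleton K K m)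
    (fun a b hab => mul_right_cancel₀ h0 hab) (LinearMap.toSpanSingleton K E e)
  refine ⟨LinearMap.toSpanSingleton K E' (p (h 1)), fun n hn => ?_⟩
  rcases Submodule.mem_span_singleton.mp hn with ⟨n, rfl⟩
  have h1 : h m = e := by simpa using hh 1
  have h2 : m • h 1 = h m := by rw [← map_smul, smul_eq_mul, mul_one]
  refine (mul_smul n m (p (h 1))).trans ?_
  rw [← map_smul, h2, h1, he, ← map_smul]
  rfl

/-- Over a principal ideal domain, a submodule of a projective module is projective. -/
lemma Module.Projective.submodule_of_isPrincipalIdealRing {P : Type u} [AddCommGroup P]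
    [Module K P] [Module.Projective K P] (A : Submodule K P) : Module.Projective K A := by
  refine Module.Projective.of_lifting_property'' fun f hf => ?_
  -- To split a free cover `f` of `A`, the free module is embedded by `i` into an injective module
  -- `E`. The induced map A ≅ M / ker f → E / i(ker f) extends to `P` because the target is
  -- injective, and the extension lifts to `ψ : P → E` because `P` is projective.
  let M := ModuleCat.of K (A →₀ K)
  let E := CategoryTheory.Injective.under M
  let i : (A →₀ K) →ₗ[K] E := (CategoryTheory.Injective.ι M).hom
  have hi : Function.Injective i :=
    (ModuleCat.mono_iff_injective (CategoryTheory.Injective.ι M)).1 inferInstance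
  have : CategoryTheory.Injective (ModuleCat.of K E) :=
    inferInstanceAs (CategoryTheory.Injective (CategoryTheory.Injective.under M))
  have hE : Module.Injective K E := Module.injective_module_of_injective_object K E
  let N := (LinearMap.ker f).map i
  have hE' : Module.Injective K (E ⧸ N) :=
    hE.of_surjective_of_isPrincipalIdealRing N.mkQ N.mkQ_surjective
  let e := f.quotKerEquivOfSurjective hf
  let j : ((A →₀ K) ⧸ LinearMap.ker f) →ₗ[K] E ⧸ N :=
    Submodule.mapQ _ _ i (Submodule.le_comap_map _ _)
  obtain ⟨φ, hφ⟩ := hE'.out A.subtype A.injective_subtype (j ∘ₗ e.symm.toLinearMap)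
  obtain ⟨ψ, hψ⟩ := Module.projective_lifting_property N.mkQ φ N.mkQ_surjective
  -- On `A` the map `ψ` takes values in the image of `i`: with `a = f m`, the elements `ψ a` and `i
  -- m` differ by an element of `i (ker f)`. As `i` is injective, pulling back along it gives a
  -- linear section.
  have key : ∀ a : A, ∃ m, i m = ψ a ∧ f m = a := by
    intro a
    obtain ⟨m, rfl⟩ := hf a
    have h1 : N.mkQ (ψ (f m)) = N.mkQ (i m) := by
      rw [← LinearMap.comp_apply, hψ]
      refine (hφ (f m)).trans ?_
      have : e.symm (f m) = Submodule.Quotient.mk m := by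
        rw [LinearEquiv.symm_apply_eq]
        rfl
      change j (e.symm (f m)) = _
      rw [this]
      rfl
    rw [← sub_eq_zero, ← map_sub, Submodule.mkQ_apply, Submodule.Quotient.mk_eq_zero] at h1
    obtain ⟨k, hk, hk'⟩ := h1
    refine ⟨m + k, ?_, ?_⟩
    · rw [map_add, hk', add_sub_cancel]
    · rw [map_add, LinearMap.mem_ker.1 hk, add_zero]
  choose s hs hs' using key
  refine ⟨{ toFun := s, map_add' := fun a b => hi ?_, map_smul' := fun c a => hi ?_ }, ?_⟩
  · rw [map_add, hs, hs, hs, Submodule.coe_add, map_add]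
  · rw [map_smul, hs, hs, Submodule.coe_smul, map_smul, RingHom.id_apply]
  · ext a
    exact congrArg Subtype.val (hs' a)

end Projective

/-! ### Homology as cycles modulo boundaries. -/

section HomologyPresentation

variable {K : Type u} [CommRing K]

/-- The `n`-cycles of a chain complex of modules. -/
abbrev cycleSub (C : ChainComplex (ModuleCat.{u} K) ℕ) (n : ℕ) : Submodule K (C.X n) :=
  LinearMap.ker (C.d n (n - 1)).hom

/-- The `n`-boundaries of a chain complex of modules. -/
abbrev boundarySub (C : ChainComplex (ModuleCat.{u} K) ℕ) (n : ℕ) : Submodule K (C.X n) :=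
  LinearMap.range (C.d (n + 1) n).hom

/-- The short complex computing the `n`-th homology. -/
abbrev scAt (C : ChainComplex (ModuleCat.{u} K) ℕ) (n : ℕ) : ShortComplex (ModuleCat.{u} K) :=
  C.sc' (n + 1) n (n - 1)

/-- The isomorphism from the homology to the quotient of the cycles by the boundaries. -/
def homologyIsoAt (C : ChainComplex (ModuleCat.{u} K) ℕ) (n : ℕ) :
    C.homology n ≅ (scAt C n).moduleCatLeftHomologyData.H :=
  ShortComplex.homologyMapIso (C.isoSc' (n + 1) n (n - 1) (by simp) (by cases n <;> simp)) ≪≫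
    (scAt C n).moduleCatHomologyIso

/-- The class of a cycle in the homology. -/
def homologyMk (C : ChainComplex (ModuleCat.{u} K) ℕ) (n : ℕ) :
    cycleSub C n →ₗ[K] C.homology n :=
  (homologyIsoAt C n).inv.hom ∘ₗ (scAt C n).moduleCatLeftHomologyData.π.hom

lemma homologyMk_surjective (C : ChainComplex (ModuleCat.{u} K) ℕ) (n : ℕ) :
    Function.Surjective (homologyMk C n) := by
  have h1 : Function.Surjective (homologyIsoAt C n).inv.hom :=
    (ModuleCat.epi_iff_surjective _).1 inferInstance
  have h2 : Function.Surjective (scAt C n).moduleCatLeftHomologyData.π.hom :=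
    (ModuleCat.epi_iff_surjective _).1 inferInstance
  exact h1.comp h2

lemma homologyMk_eq_zero_iff (C : ChainComplex (ModuleCat.{u} K) ℕ) (n : ℕ)
    (z : cycleSub C n) : homologyMk C n z = 0 ↔ (z : C.X n) ∈ boundarySub C n := by
  have h1 : Function.Injective (homologyIsoAt C n).inv.hom :=
    (ModuleCat.mono_iff_injective _).1 inferInstance
  have h3 : homologyMk C n z = 0 ↔ (scAt C n).moduleCatLeftHomologyData.π.hom z = 0 := by
    refine ⟨fun h => h1 (h.trans (map_zero _).symm), fun h => ?_⟩
    exact (congrArg (homologyIsoAt C n).inv.hom h).trans (map_zero _)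
  rw [h3]
  refine (Submodule.Quotient.mk_eq_zero _).trans ?_
  constructor
  · rintro ⟨x, hx⟩
    exact ⟨x, congrArg Subtype.val hx⟩
  · rintro ⟨x, hx⟩
    exact ⟨x, Subtype.ext hx⟩

end HomologyPresentation

/-! ### Tor from a projective resolution of length one. -/

section TorPresentation

variable {K : Type u} [CommRing K] {B Z : Type u} [AddCommGroup B] [Module K B]
  [AddCommGroup Z] [Module K Z]

/-- The terms of the complex `⋯ → 0 → B → Z`. -/
def twoTermX (K B Z : Type u) [CommRing K] [AddCommGroup B] [Module K B]
    [AddCommGroup Z] [Module K Z] : ℕ → ModuleCat.{u} K := fun n => match n with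
  | 0 => ModuleCat.of K Z
  | 1 => ModuleCat.of K B
  | _ + 2 => ModuleCat.of K PUnit

/-- The differentials of the complex `⋯ → 0 → B → Z`. -/
def twoTermD (ι : B →ₗ[K] Z) :
    ∀ n, twoTermX K B Z (n + 1) ⟶ twoTermX K B Z n := fun n => match n with
  | 0 => ModuleCat.ofHom ι
  | _ + 1 => 0

/-- The complex `⋯ → 0 → B → Z`. -/
def twoTerm (ι : B →ₗ[K] Z) : ChainComplex (ModuleCat.{u} K) ℕ :=
  ChainComplex.of (twoTermX K B Z) (twoTermD ι)
    (fun _ => Limits.zero_comp)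

lemma twoTerm_d_one (ι : B →ₗ[K] Z) : (twoTerm ι).d 1 0 = ModuleCat.ofHom ι :=
  ChainComplex.of_d (twoTermX K B Z) (twoTermD ι) 0

lemma twoTerm_d_succ (ι : B →ₗ[K] Z) (n : ℕ) : (twoTerm ι).d (n + 2) (n + 1) = 0 :=
  ChainComplex.of_d (twoTermX K B Z) (twoTermD ι) (n + 1)

lemma twoTerm_projective [Module.Projective K B] [Module.Projective K Z] (ι : B →ₗ[K] Z)
    (n : ℕ) : Projective ((twoTerm ι).X n) := by
  match n with
  | 0 => exact (IsProjective.iff_projective (R := K) Z).1 inferInstance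
  | 1 => exact (IsProjective.iff_projective (R := K) B).1 inferInstance
  | _ + 2 => exact (IsProjective.iff_projective (R := K) PUnit.{u + 1}).1 inferInstance

variable {H : ModuleCat.{u} K}

/-- The augmentation of the complex `⋯ → 0 → B → Z` by a map killing the image of `B`. -/
def twoTermAug (ι : B →ₗ[K] Z) (π : Z →ₗ[K] H) (hπι : Function.Exact ι π) :
    twoTerm ι ⟶ (ChainComplex.single₀ (ModuleCat.{u} K)).obj H :=
  (ChainComplex.toSingle₀Equiv (twoTerm ι) H).symm ⟨ModuleCat.ofHom π, by
    rw [twoTerm_d_one]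
    exact ModuleCat.hom_ext (LinearMap.ext fun b => hπι.apply_apply_eq_zero b)⟩

lemma twoTerm_exactAt_succ (ι : B →ₗ[K] Z) (hι : Function.Injective ι) (n : ℕ) :
    (twoTerm ι).ExactAt (n + 1) := by
  rw [HomologicalComplex.exactAt_iff' _ (n + 1 + 1) (n + 1) n (by simp) (by simp),
    ShortComplex.moduleCat_exact_iff]
  intro x hx
  refine ⟨0, ?_⟩
  rw [map_zero]
  match n with
  | 0 =>
    have := congrArg (fun f => f.hom x) (twoTerm_d_one ι)
    exact (hι ((this.symm.trans hx).trans (map_zero ι).symm)).symm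
  | n + 1 => exact (Subsingleton.elim (α := PUnit.{u + 1}) _ _)

lemma twoTermAug_quasiIso (ι : B →ₗ[K] Z) (hι : Function.Injective ι) (π : Z →ₗ[K] H)
    (hπι : Function.Exact ι π) (hπ : Function.Surjective π) :
    QuasiIso (twoTermAug ι π hπι) := ⟨fun n => by
  cases n with
  | zero =>
    rw [ChainComplex.quasiIsoAt₀_iff, ShortComplex.quasiIso_iff_of_zeros']
    · let T : ShortComplex (ModuleCat.{u} K) := ShortComplex.mk (ModuleCat.ofHom ι)
        (ModuleCat.ofHom π)
        (ModuleCat.hom_ext (LinearMap.ext fun b => hπι.apply_apply_eq_zero b))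
      refine (ShortComplex.exact_and_epi_g_iff_of_iso (S₂ := T) ?_).2 ⟨?_, ?_⟩
      · refine ShortComplex.isoMk (Iso.refl _) (Iso.refl _) (Iso.refl _) ?_ ?_
        · refine (Category.id_comp _).trans (Eq.trans ?_ (Category.comp_id _).symm)
          exact (twoTerm_d_one ι).symm
        · refine (Category.id_comp _).trans (Eq.trans ?_ (Category.comp_id _).symm)
          rfl
      · rw [ShortComplex.moduleCat_exact_iff]
        exact fun x hx => (hπι x).1 hx
      · exact (ModuleCat.epi_iff_surjective _).2 hπ
    all_goals rfl
  | succ n =>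
    rw [quasiIsoAt_iff_exactAt']
    · exact twoTerm_exactAt_succ ι hι n
    · exact ChainComplex.exactAt_succ_single_obj _ _⟩

/-- The projective resolution `0 → B → Z → H → 0`. -/
def twoTermResolution [Module.Projective K B] [Module.Projective K Z] (ι : B →ₗ[K] Z)
    (hι : Function.Injective ι) (π : Z →ₗ[K] H) (hπι : Function.Exact ι π)
    (hπ : Function.Surjective π) : ProjectiveResolution H where
  complex := twoTerm ι
  projective := twoTerm_projective ι
  π := twoTermAug ι π hπι
  quasiIso := twoTermAug_quasiIso ι hι π hπι hπ

/-- The first torsion module computed by a projective resolution of length one. -/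
theorem nonempty_torEquiv [Module.Projective K B] [Module.Projective K Z] (ι : B →ₗ[K] Z)
    (hι : Function.Injective ι) (π : Z →ₗ[K] H) (hπι : Function.Exact ι π)
    (hπ : Function.Surjective π) (X : ModuleCat.{u} K) :
    Nonempty ((((CategoryTheory.Tor (ModuleCat.{u} K) 1).obj X).obj H : ModuleCat.{u} K) ≃ₗ[K]
      LinearMap.ker (ι.lTensor X)) := by
  let F : ModuleCat.{u} K ⥤ ModuleCat.{u} K := (tensoringLeft (ModuleCat.{u} K)).obj X
  let E := (F.mapHomologicalComplex (ComplexShape.down ℕ)).obj (twoTerm ι)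
  -- Tor is derived in its second variable, so it is the homology of `X` tensored with the two-term
  -- resolution of `H`. In degree one there are no boundaries, and the homology is the kernel.
  let e1 := (twoTermResolution ι hι π hπι hπ).isoLeftDerivedObj F 1
  have hE1 : E.d 1 0 = ModuleCat.ofHom (ι.lTensor X) := by
    change F.map ((twoTerm ι).d 1 0) = _
    rw [twoTerm_d_one]
    rfl
  have hE2 : E.d 2 1 = 0 := by
    change F.map ((twoTerm ι).d 2 1) = _
    rw [twoTerm_d_succ, F.map_zero]
    rfl
  let e2 : cycleSub E 1 ≃ₗ[K] E.homology 1 := LinearEquiv.ofBijective (homologyMk E 1)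
    ⟨by
      rw [← LinearMap.ker_eq_bot, LinearMap.ker_eq_bot']
      intro z hz
      rw [homologyMk_eq_zero_iff] at hz
      obtain ⟨y, hy⟩ := hz
      rw [show (E.d (1 + 1) 1) = 0 from hE2] at hy
      exact Subtype.ext hy.symm, homologyMk_surjective E 1⟩
  have h3 : cycleSub E 1 = LinearMap.ker (ι.lTensor X) :=
    congrArg (fun f => LinearMap.ker (ModuleCat.Hom.hom f)) hE1
  exact ⟨e1.toLinearEquiv ≪≫ₗ e2.symm ≪≫ₗ LinearEquiv.ofEq _ _ h3⟩

end TorPresentation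

/-- A linear map factors through a surjective one with smaller kernel. -/
lemma LinearMap.exists_comp_eq_of_ker_le {R A B E : Type*} [CommRing R] [AddCommGroup A]
    [AddCommGroup B] [AddCommGroup E] [Module R A] [Module R B] [Module R E] (p : A →ₗ[R] B)
    (hp : Function.Surjective p) (q : A →ₗ[R] E) (hpq : LinearMap.ker p ≤ LinearMap.ker q) :
    ∃ l : B →ₗ[R] E, l ∘ₗ p = q := by
  refine ⟨(LinearMap.ker p).liftQ q hpq ∘ₗ (p.quotKerEquivOfSurjective hp).symm.toLinearMap,
    LinearMap.ext fun u => ?_⟩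
  have : (p.quotKerEquivOfSurjective hp).symm (p u) = Submodule.Quotient.mk u := by
    rw [LinearEquiv.symm_apply_eq]
    rfl
  change (LinearMap.ker p).liftQ q hpq ((p.quotKerEquivOfSurjective hp).symm (p u)) = _
  rw [this]
  rfl

/-! ### Cycles, boundaries and the homology cross product. -/

section KunnethSetup

variable {K : Type u} [CommRing K] (C D : ChainComplex (ModuleCat.{u} K) ℕ)

/-- The differential as a map to the cycles. -/
def toCycleSub (n : ℕ) : C.X (n + 1) →ₗ[K] cycleSub C n :=
  (C.d (n + 1) n).hom.codRestrict _ fun x =>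
    LinearMap.congr_fun (congrArg ModuleCat.Hom.hom (C.d_comp_d (n + 1) n (n - 1))) x

lemma exact_toCycleSub_homologyMk (n : ℕ) :
    Function.Exact (toCycleSub C n) (homologyMk C n) := fun z => by
  rw [homologyMk_eq_zero_iff]
  exact ⟨fun ⟨x, hx⟩ => ⟨x, Subtype.ext hx⟩, fun ⟨x, hx⟩ => ⟨x, congrArg Subtype.val hx⟩⟩

/-- The boundaries as a submodule of the cycles. -/
abbrev bdSub (n : ℕ) : Submodule K (cycleSub C n) := LinearMap.range (toCycleSub C n)

/-- The differential as a map onto the boundaries. -/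
def toBdSub (n : ℕ) : C.X (n + 1) →ₗ[K] bdSub C n := (toCycleSub C n).rangeRestrict

lemma toBdSub_surjective (n : ℕ) : Function.Surjective (toBdSub C n) :=
  (toCycleSub C n).surjective_rangeRestrict

lemma exact_bdSub_homologyMk (n : ℕ) :
    Function.Exact (bdSub C n).subtype (homologyMk C n) := fun z => by
  rw [exact_toCycleSub_homologyMk C n z]
  exact ⟨fun h => ⟨⟨z, h⟩, rfl⟩, fun ⟨b, hb⟩ => hb ▸ b.2⟩

lemma toBdSub_eq_zero_iff (n : ℕ) (x : C.X (n + 1)) : toBdSub C n x = 0 ↔ C.d (n + 1) n x = 0 :=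
  ⟨fun h => congrArg (fun z => ((z : bdSub C n) : cycleSub C n).1) h,
    fun h => Subtype.ext (Subtype.ext h)⟩

lemma exact_cycleSub_toBdSub (n : ℕ) :
    Function.Exact (cycleSub C (n + 1)).subtype (toBdSub C n) := fun x => by
  rw [toBdSub_eq_zero_iff]
  exact ⟨fun h => ⟨⟨x, h⟩, rfl⟩, fun ⟨z, hz⟩ => hz ▸ z.2⟩

lemma exact_cycleSub_d (n : ℕ) :
    Function.Exact (cycleSub C n).subtype (C.d n (n - 1)).hom :=
  LinearMap.exact_subtype_ker_map _

lemma toBdSub_comp_d (n : ℕ) : toBdSub C n ∘ₗ (C.d (n + 2) (n + 1)).hom = 0 :=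
  LinearMap.ext fun x => (toBdSub_eq_zero_iff C n _).2
    (LinearMap.congr_fun (congrArg ModuleCat.Hom.hom (C.d_comp_d (n + 2) (n + 1) n)) x)

section

variable [IsDomain K] [IsPrincipalIdealRing K] [∀ n, Module.Projective K (C.X n)]

instance (n : ℕ) : Module.Projective K (cycleSub C n) :=
  Module.Projective.submodule_of_isPrincipalIdealRing _

instance (n : ℕ) : Module.Projective K (bdSub C n) :=
  Module.Projective.submodule_of_isPrincipalIdealRing _

/-- The image of the differential is projective, being a submodule of a projective module, so the
differential has a section `s` on it, and `id - s ∘ d` projects onto the cycles. -/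
lemma exists_cycleSub_retraction (n : ℕ) :
    ∃ r : C.X n →ₗ[K] cycleSub C n, r ∘ₗ (cycleSub C n).subtype = LinearMap.id := by
  let d := (C.d n (n - 1)).hom
  have : Module.Projective K (LinearMap.range d) :=
    Module.Projective.submodule_of_isPrincipalIdealRing _
  obtain ⟨s, hs⟩ := Module.projective_lifting_property d.rangeRestrict LinearMap.id
    d.surjective_rangeRestrict
  let r : C.X n →ₗ[K] C.X n := LinearMap.id - s ∘ₗ d.rangeRestrict
  have hmem : ∀ x, r x ∈ cycleSub C n := fun x => by
    change d (x - s (d.rangeRestrict x)) = 0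
    rw [map_sub, sub_eq_zero]
    exact (congrArg Subtype.val (LinearMap.congr_fun hs (d.rangeRestrict x))).symm
  refine ⟨r.codRestrict _ hmem, LinearMap.ext fun z => Subtype.ext ?_⟩
  change (z : C.X n) - s (d.rangeRestrict z) = z
  have : d.rangeRestrict z = 0 := Subtype.ext z.2
  rw [this, map_zero, sub_zero]

/-- A retraction onto the cycles. -/
def cycleRetr (n : ℕ) : C.X n →ₗ[K] cycleSub C n := (exists_cycleSub_retraction C n).choose

lemma cycleRetr_comp_subtype (n : ℕ) : cycleRetr C n ∘ₗ (cycleSub C n).subtype = LinearMap.id :=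
  (exists_cycleSub_retraction C n).choose_spec

lemma cycleRetr_coe (n : ℕ) (z : cycleSub C n) : cycleRetr C n z = z :=
  LinearMap.congr_fun (cycleRetr_comp_subtype C n) z

lemma cycleRetr_d (n : ℕ) (x : C.X (n + 1)) :
    cycleRetr C n ((C.d (n + 1) n).hom x) = toCycleSub C n x :=
  cycleRetr_coe C n (toCycleSub C n x)

end

/-- The projection of the tensor product to a summand. -/
def tensorπ {n i j : ℕ} (h : i + j = n) :
    (HomologicalComplex.tensorObj C D).X n →ₗ[K] (C.X i : ModuleCat.{u} K) ⊗[K] D.X j :=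
  LinearMap.proj (R := K)
    (φ := fun p : {p : ℕ × ℕ // p.1 + p.2 = n} => (C.X p.1.1 : ModuleCat.{u} K) ⊗[K] D.X p.1.2)
    ⟨(i, j), h⟩ ∘ₗ (tensorEquiv C D n).toLinearMap

variable {C D}

lemma tensorπ_ι_self {n i j : ℕ} (h : i + j = n) (t : (C.X i : ModuleCat.{u} K) ⊗[K] D.X j) :
    tensorπ C D h (tensorι C D i j n t) = t := tensorEquiv_ι_self h t

lemma tensorπ_ι_ne {n i j k l : ℕ} (h : k + l = n) (hne : k ≠ i)
    (t : (C.X i : ModuleCat.{u} K) ⊗[K] D.X j) :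
    tensorπ C D h (tensorι C D i j n t) = 0 := tensorEquiv_ι_ne h hne t

lemma tensorπ_d {n : ℕ} (x : (HomologicalComplex.tensorObj C D).X (n + 1)) {k l : ℕ}
    (h : k + l = n) (h₁ : (k + 1) + l = n + 1) (h₂ : k + (l + 1) = n + 1) :
    tensorπ C D h (((HomologicalComplex.tensorObj C D).d (n + 1) n).hom x) =
      (C.d (k + 1) k).hom.rTensor _ (tensorπ C D h₁ x) +
      (-1 : K) ^ k • (D.d (l + 1) l).hom.lTensor _ (tensorπ C D h₂ x) :=
  tensorEquiv_d x h

lemma sum_tensorι_tensorπ {n : ℕ} (x : (HomologicalComplex.tensorObj C D).X n) :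
    ∑ p : {p : ℕ × ℕ // p.1 + p.2 = n}, tensorι C D p.1.1 p.1.2 n (tensorπ C D p.2 x) = x := by
  have h := tensorEquiv_symm_apply (C := C) (D := D) (tensorEquiv C D n x)
  rw [LinearEquiv.symm_apply_apply] at h
  exact h.symm

lemma rTensor_d_tensorπ {n : ℕ} (x : cycleSub (HomologicalComplex.tensorObj C D) (n + 1))
    {k l : ℕ} (h : k + l = n) (h₁ : (k + 1) + l = n + 1) (h₂ : k + (l + 1) = n + 1) :
    (C.d (k + 1) k).hom.rTensor _ (tensorπ C D h₁ x) =
      -((-1 : K) ^ k • (D.d (l + 1) l).hom.lTensor _ (tensorπ C D h₂ x)) := by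
  have hx : ((HomologicalComplex.tensorObj C D).d (n + 1) n).hom x = 0 := x.2
  rw [eq_neg_iff_add_eq_zero, ← tensorπ_d _ h, hx, map_zero]

lemma d_tensorι_subtype_right {n i j : ℕ} (h : i + j = n)
    (v : (C.X (i + 1) : ModuleCat.{u} K) ⊗[K] cycleSub D j) :
    ((HomologicalComplex.tensorObj C D).d (n + 1) n).hom
      (tensorι C D (i + 1) j (n + 1) ((cycleSub D j).subtype.lTensor _ v)) =
    tensorι C D i j n (TensorProduct.map (cycleSub C i).subtype (cycleSub D j).subtype
      ((toCycleSub C i).rTensor _ v)) := by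
  rw [d_tensorι (by omega), ← LinearMap.lTensor_comp_apply,
    (exact_cycleSub_d D j).linearMap_comp_eq_zero, LinearMap.lTensor_zero, LinearMap.zero_apply,
    map_zero, smul_zero, add_zero]
  have key : (C.d (i + 1) i).hom.rTensor (D.X j) ∘ₗ (cycleSub D j).subtype.lTensor (C.X (i + 1)) =
      TensorProduct.map (cycleSub C i).subtype (cycleSub D j).subtype ∘ₗ
        (toCycleSub C i).rTensor (cycleSub D j) := TensorProduct.ext' fun a b => rfl
  exact congrArg (tensorι C D i j n) (LinearMap.congr_fun key v)

lemma d_tensorι_subtype_left {n i j : ℕ} (h : i + j = n)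
    (s : (cycleSub C i) ⊗[K] (D.X (j + 1) : ModuleCat.{u} K)) :
    ((HomologicalComplex.tensorObj C D).d (n + 1) n).hom
      (tensorι C D i (j + 1) (n + 1) ((cycleSub C i).subtype.rTensor _ s)) =
    (-1 : K) ^ i • tensorι C D i j n
      (TensorProduct.map (cycleSub C i).subtype (cycleSub D j).subtype
      ((toCycleSub D j).lTensor _ s)) := by
  rw [d_tensorι (by omega), ← LinearMap.rTensor_comp_apply,
    (exact_cycleSub_d C i).linearMap_comp_eq_zero, LinearMap.rTensor_zero, LinearMap.zero_apply,
    map_zero, zero_add]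
  have key : (D.d (j + 1) j).hom.lTensor (C.X i) ∘ₗ (cycleSub C i).subtype.rTensor (D.X (j + 1)) =
      TensorProduct.map (cycleSub C i).subtype (cycleSub D j).subtype ∘ₗ
        (toCycleSub D j).lTensor (cycleSub C i) := TensorProduct.ext' fun a b => rfl
  exact congrArg (fun y => (-1 : K) ^ i • tensorι C D i j n y) (LinearMap.congr_fun key s)

lemma tensorι_mem_cycleSub (i j n : ℕ) (u : cycleSub C i ⊗[K] cycleSub D j) :
    tensorι C D i j n (TensorProduct.map (cycleSub C i).subtype (cycleSub D j).subtype u) ∈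
      cycleSub (HomologicalComplex.tensorObj C D) n := by
  cases n with
  | zero =>
    have : (HomologicalComplex.tensorObj C D).d 0 (0 - 1) = 0 :=
      (HomologicalComplex.tensorObj C D).shape _ _ (by simp)
    rw [LinearMap.mem_ker, this]
    rfl
  | succ n =>
    by_cases h : i + j = n + 1
    · rw [LinearMap.mem_ker]
      refine (d_tensorι h _).trans ?_
      have h1 : (C.d i (i - 1)).hom.rTensor (D.X j) ∘ₗ
          TensorProduct.map (cycleSub C i).subtype (cycleSub D j).subtype = 0 :=
        TensorProduct.ext' fun a b => by
          change (C.d i (i - 1)).hom a.1 ⊗ₜ[K] b.1 = 0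
          rw [show (C.d i (i - 1)).hom a.1 = 0 from a.2, TensorProduct.zero_tmul]
      have h2 : (D.d j (j - 1)).hom.lTensor (C.X i) ∘ₗ
          TensorProduct.map (cycleSub C i).subtype (cycleSub D j).subtype = 0 :=
        TensorProduct.ext' fun a b => by
          change a.1 ⊗ₜ[K] (D.d j (j - 1)).hom b.1 = 0
          rw [show (D.d j (j - 1)).hom b.1 = 0 from b.2, TensorProduct.tmul_zero]
      rw [show (C.d i (i - 1)).hom.rTensor (D.X j) _ = 0 from LinearMap.congr_fun h1 u,
        show (D.d j (j - 1)).hom.lTensor (C.X i) _ = 0 from LinearMap.congr_fun h2 u,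
        map_zero, map_zero, smul_zero, add_zero]
    · rw [tensorι_eq_zero C D h]
      exact zero_mem _

variable (C D) in
/-- The product of two cycles. -/
def cycleProd (i j n : ℕ) : cycleSub C i ⊗[K] cycleSub D j →ₗ[K]
    cycleSub (HomologicalComplex.tensorObj C D) n :=
  (tensorι C D i j n ∘ₗ
    TensorProduct.map (cycleSub C i).subtype (cycleSub D j).subtype).codRestrict _
    (tensorι_mem_cycleSub i j n)

-- By right exactness the kernel of Zᵢ ⊗ Zⱼ → Hᵢ ⊗ Hⱼ is generated by the images of Cᵢ₊₁ ⊗ Zⱼ and Zᵢ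
-- ⊗ Dⱼ₊₁. Products of a boundary with a cycle are boundaries by the Leibniz rule, so the product of
-- cycles descends to homology.
variable (C D) in
lemma exists_homologyCross (i j n : ℕ) : ∃ f : (C.homology i : ModuleCat.{u} K) ⊗[K]
    (D.homology j : ModuleCat.{u} K) →ₗ[K] ((HomologicalComplex.tensorObj C D).homology n :
      ModuleCat.{u} K),
    f ∘ₗ TensorProduct.map (homologyMk C i) (homologyMk D j) =
      homologyMk (HomologicalComplex.tensorObj C D) n ∘ₗ cycleProd C D i j n := by
  let p := TensorProduct.map (homologyMk C i) (homologyMk D j)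
  let q := homologyMk (HomologicalComplex.tensorObj C D) n ∘ₗ cycleProd C D i j n
  have hp : Function.Surjective p :=
    TensorProduct.map_surjective (homologyMk_surjective C i) (homologyMk_surjective D j)
  have hpq : LinearMap.ker p ≤ LinearMap.ker q := by
    have hk : LinearMap.ker p = _ := TensorProduct.map_ker (exact_toCycleSub_homologyMk C i)
      (homologyMk_surjective C i) (exact_toCycleSub_homologyMk D j) (homologyMk_surjective D j)
    rw [hk, sup_le_iff]
    by_cases h : i + j = n
    · constructor
      · rintro _ ⟨s, rfl⟩
        refine (homologyMk_eq_zero_iff _ _ _).2 ⟨(-1 : K) ^ i •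
          tensorι C D i (j + 1) (n + 1) ((cycleSub C i).subtype.rTensor _ s), ?_⟩
        rw [map_smul, d_tensorι_subtype_left h, smul_smul, ← mul_pow, neg_mul_neg, one_mul,
          one_pow, one_smul]
        rfl
      · rintro _ ⟨v, rfl⟩
        exact (homologyMk_eq_zero_iff _ _ _).2 ⟨tensorι C D (i + 1) j (n + 1)
          ((cycleSub D j).subtype.lTensor _ v), d_tensorι_subtype_right h v⟩
    · have : q = 0 := by
        refine LinearMap.ext fun u => ?_
        have : cycleProd C D i j n u = 0 :=
          Subtype.ext (LinearMap.congr_fun (tensorι_eq_zero C D h) _)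
        exact (congrArg (homologyMk (HomologicalComplex.tensorObj C D) n) this).trans (map_zero _)
      rw [this, LinearMap.ker_zero]
      exact ⟨le_top, le_top⟩
  exact LinearMap.exists_comp_eq_of_ker_le p hp q hpq

variable (C D) in
/-- The homology cross product. -/
def homologyCross (i j n : ℕ) : (C.homology i : ModuleCat.{u} K) ⊗[K]
    (D.homology j : ModuleCat.{u} K) →ₗ[K] ((HomologicalComplex.tensorObj C D).homology n :
      ModuleCat.{u} K) :=
  (exists_homologyCross C D i j n).choose

lemma homologyCross_map (i j n : ℕ) (u : cycleSub C i ⊗[K] cycleSub D j) :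
    homologyCross C D i j n (TensorProduct.map (homologyMk C i) (homologyMk D j) u) =
      homologyMk (HomologicalComplex.tensorObj C D) n (cycleProd C D i j n u) :=
  LinearMap.congr_fun (exists_homologyCross C D i j n).choose_spec u

end KunnethSetup

set_option linter.unusedSectionVars false

/-! ### The left inverse of the cross product and the torsion map. -/

section Kunneth

variable {K : Type u} [CommRing K] [IsDomain K] [IsPrincipalIdealRing K]
  (C D : ChainComplex (ModuleCat.{u} K) ℕ)
  [∀ n, Module.Projective K (C.X n)] [∀ n, Module.Projective K (D.X n)]

/-- A left inverse of the cross product at the level of chains. -/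
def crossRetr {n i j : ℕ} (h : i + j = n) : (HomologicalComplex.tensorObj C D).X n →ₗ[K]
    (C.homology i : ModuleCat.{u} K) ⊗[K] (D.homology j : ModuleCat.{u} K) :=
  TensorProduct.map (homologyMk C i ∘ₗ cycleRetr C i) (homologyMk D j ∘ₗ cycleRetr D j) ∘ₗ
    tensorπ C D h

variable {C D}

lemma homologyMk_cycleRetr_d (n : ℕ) (x : C.X (n + 1)) :
    homologyMk C n (cycleRetr C n ((C.d (n + 1) n).hom x)) = 0 := by
  rw [cycleRetr_d]
  exact (exact_toCycleSub_homologyMk C n).apply_apply_eq_zero x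

/-- The retraction sends a boundary in either factor to the zero class. This makes `crossRetr` a
test for injectivity on homology. -/
lemma crossRetr_d {n i j : ℕ} (h : i + j = n)
    (s : (HomologicalComplex.tensorObj C D).X (n + 1)) :
    crossRetr C D h (((HomologicalComplex.tensorObj C D).d (n + 1) n).hom s) = 0 := by
  let m := TensorProduct.map (homologyMk C i ∘ₗ cycleRetr C i) (homologyMk D j ∘ₗ cycleRetr D j)
  have h1 : m ∘ₗ (C.d (i + 1) i).hom.rTensor (D.X j) = 0 := TensorProduct.ext' fun a b =>
    (congrArg (fun z => z ⊗ₜ[K] homologyMk D j (cycleRetr D j b))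
      (homologyMk_cycleRetr_d i a)).trans (TensorProduct.zero_tmul _ _)
  have h2 : m ∘ₗ (D.d (j + 1) j).hom.lTensor (C.X i) = 0 := TensorProduct.ext' fun a b =>
    (congrArg (fun z => homologyMk C i (cycleRetr C i a) ⊗ₜ[K] z)
      (homologyMk_cycleRetr_d j b)).trans (TensorProduct.tmul_zero _ _)
  change m (tensorπ C D h _) = 0
  rw [tensorπ_d s h (by omega) (by omega), map_add, map_smul]
  rw [show m ((C.d (i + 1) i).hom.rTensor (D.X j) _) = 0 from LinearMap.congr_fun h1 _,
    show m ((D.d (j + 1) j).hom.lTensor (C.X i) _) = 0 from LinearMap.congr_fun h2 _,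
    smul_zero, add_zero]

lemma crossRetr_cycleProd_self {n i j : ℕ} (h : i + j = n)
    (u : cycleSub C i ⊗[K] cycleSub D j) :
    crossRetr C D h (cycleProd C D i j n u) =
      TensorProduct.map (homologyMk C i) (homologyMk D j) u := by
  refine (congrArg (TensorProduct.map (homologyMk C i ∘ₗ cycleRetr C i)
    (homologyMk D j ∘ₗ cycleRetr D j)) (tensorπ_ι_self h _)).trans ?_
  rw [← LinearMap.comp_apply, ← TensorProduct.map_comp, LinearMap.comp_assoc,
    cycleRetr_comp_subtype, LinearMap.comp_assoc, cycleRetr_comp_subtype, LinearMap.comp_id,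
    LinearMap.comp_id]

lemma tensorπ_cycleProd_ne {n i j k l : ℕ} (h : k + l = n) (hne : k ≠ i)
    (u : cycleSub C i ⊗[K] cycleSub D j) : tensorπ C D h (cycleProd C D i j n u) = 0 :=
  tensorπ_ι_ne h hne _

lemma crossRetr_cycleProd_ne {n i j k l : ℕ} (h : k + l = n) (hne : k ≠ i)
    (u : cycleSub C i ⊗[K] cycleSub D j) : crossRetr C D h (cycleProd C D i j n u) = 0 :=
  (congrArg _ (tensorπ_cycleProd_ne h hne u)).trans (map_zero _)

variable (C D) in
/-- The kernel of `Hᵢ ⊗ Bⱼ → Hᵢ ⊗ Zⱼ`. -/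
abbrev torKer (i j : ℕ) : Submodule K ((C.homology i : ModuleCat.{u} K) ⊗[K] bdSub D j) :=
  LinearMap.ker ((bdSub D j).subtype.lTensor (C.homology i : ModuleCat.{u} K))

variable (C D) in
lemma nonempty_torEquivKer (i j : ℕ) :
    Nonempty ((((CategoryTheory.Tor (ModuleCat.{u} K) 1).obj (C.homology i)).obj
      (D.homology j) : ModuleCat.{u} K) ≃ₗ[K] torKer C D i j) :=
  nonempty_torEquiv (bdSub D j).subtype Subtype.val_injective (homologyMk D j)
    (exact_bdSub_homologyMk D j) (homologyMk_surjective D j) (C.homology i)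

lemma rTensor_cycleSub_injective (i : ℕ) (M : Type u) [AddCommGroup M] [Module K M]
    [Module.Flat K M] : Function.Injective ((cycleSub C i).subtype.rTensor M) :=
  Module.Flat.rTensor_preserves_injective_linearMap _ Subtype.val_injective

/-- Applying ∂ ⊗ 1 to the element (1 ⊗ ∂)t gives zero: the cycle equation rewrites (∂ ⊗ 1)t as ∓(1 ⊗
∂) of the component of bidegree (i - 1, j + 2), and ∂∂ = 0. Flatness of Bⱼ then moves the element
into Zᵢ ⊗ Bⱼ. -/
lemma lTensor_toBdSub_mem {n i j : ℕ} (h : i + j + 1 = n)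
    (t : cycleSub (HomologicalComplex.tensorObj C D) n) :
    (toBdSub D j).lTensor (C.X i) (tensorπ C D (i := i) (j := j + 1) h t) ∈
      LinearMap.range ((cycleSub C i).subtype.rTensor (bdSub D j)) := by
  subst h
  refine (Module.Flat.rTensor_exact (bdSub D j) (exact_cycleSub_d C i) _).1 ?_
  cases i with
  | zero =>
    rw [C.shape 0 (0 - 1) (by simp), ModuleCat.hom_zero, LinearMap.rTensor_zero,
      LinearMap.zero_apply]
  | succ k =>
    have h1 := rTensor_d_tensorπ (n := k + 1 + j) (k := k) (l := j + 1) t (by omega) (by omega)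
      (by omega)
    have h2 : (C.d (k + 1) k).hom.rTensor (bdSub D j) ∘ₗ (toBdSub D j).lTensor (C.X (k + 1)) =
      (toBdSub D j).lTensor (C.X k) ∘ₗ (C.d (k + 1) k).hom.rTensor (D.X (j + 1)) :=
      TensorProduct.ext' fun a b => rfl
    have h3 : (toBdSub D j).lTensor (C.X k) ∘ₗ (D.d (j + 2) (j + 1)).hom.lTensor (C.X k) = 0 := by
      rw [← LinearMap.lTensor_comp, toBdSub_comp_d, LinearMap.lTensor_zero]
    refine (LinearMap.congr_fun h2 _).trans ?_
    refine (congrArg ((toBdSub D j).lTensor (C.X k)) h1).trans ?_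
    rw [map_neg, map_smul, neg_eq_zero]
    exact (congrArg (fun y => (-1 : K) ^ k • y) (LinearMap.congr_fun h3 _)).trans (smul_zero _)

/-- By the cycle equation in bidegree (i, j), the image of `y` in Zᵢ ⊗ Zⱼ also comes from Cᵢ₊₁ ⊗ Zⱼ
through the differential of the first factor. It therefore vanishes in Hᵢ ⊗ Zⱼ. -/
lemma lTensor_bdSub_eq {n i j : ℕ} (h : i + j + 1 = n)
    (t : cycleSub (HomologicalComplex.tensorObj C D) n) (y : cycleSub C i ⊗[K] bdSub D j)
    (hy : (cycleSub C i).subtype.rTensor (bdSub D j) y =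
      (toBdSub D j).lTensor (C.X i) (tensorπ C D (i := i) (j := j + 1) h t)) :
    (homologyMk C i).rTensor (bdSub D j) y ∈ torKer C D i j := by
  subst h
  have h1 := rTensor_d_tensorπ (n := i + j) (k := i) (l := j) t (by omega) (by omega)
      (by omega)
  have e1 : (cycleSub C i).subtype.rTensor (cycleSub D j) ∘ₗ
      (bdSub D j).subtype.lTensor (cycleSub C i) =
      (bdSub D j).subtype.lTensor (C.X i) ∘ₗ (cycleSub C i).subtype.rTensor (bdSub D j) :=
    TensorProduct.ext' fun a b => rfl
  have e2 : (bdSub D j).subtype.lTensor (C.X i) ∘ₗ (toBdSub D j).lTensor (C.X i) =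
      (cycleRetr D j).lTensor (C.X i) ∘ₗ (D.d (j + 1) j).hom.lTensor (C.X i) :=
    TensorProduct.ext' fun a b => congrArg (fun z => a ⊗ₜ[K] z) (cycleRetr_d D j b).symm
  have e3 : (cycleRetr D j).lTensor (C.X i) ∘ₗ (C.d (i + 1) i).hom.rTensor (D.X j) =
      (cycleSub C i).subtype.rTensor (cycleSub D j) ∘ₗ
      (toCycleSub C i).rTensor (cycleSub D j) ∘ₗ (cycleRetr D j).lTensor (C.X (i + 1)) :=
    TensorProduct.ext' fun a b => rfl
  -- The witness is, up to sign, the component of bidegree (i + 1, j), with its second factor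
  -- retracted to cycles.
  have key : ∃ v : (C.X (i + 1) : ModuleCat.{u} K) ⊗[K] cycleSub D j,
      (bdSub D j).subtype.lTensor (cycleSub C i) y =
        (toCycleSub C i).rTensor (cycleSub D j) v := by
    refine ⟨-((-1 : K) ^ i • (cycleRetr D j).lTensor (C.X (i + 1))
      (tensorπ C D (n := i + j + 1) (i := i + 1) (j := j) (by omega) t)),
      rTensor_cycleSub_injective i (cycleSub D j) ?_⟩
    refine (LinearMap.congr_fun e1 y).trans ?_
    refine (congrArg ((bdSub D j).subtype.lTensor (C.X i)) hy).trans ?_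
    refine (LinearMap.congr_fun e2 _).trans ?_
    rw [map_neg, map_neg, map_smul, map_smul]
    refine Eq.trans ?_ (congrArg (fun z => -((-1 : K) ^ i • z)) (LinearMap.congr_fun e3 _))
    have h2 := congrArg (fun z => -((-1 : K) ^ i • (cycleRetr D j).lTensor (C.X i) z)) h1
    refine Eq.trans ?_ h2.symm
    rw [map_neg, map_smul, smul_neg, neg_neg, smul_smul, ← mul_pow, neg_mul_neg, one_mul,
      one_pow, one_smul]
    rfl
  obtain ⟨v, hv⟩ := key
  have e4 : (bdSub D j).subtype.lTensor (C.homology i : ModuleCat.{u} K) ∘ₗ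
      (homologyMk C i).rTensor (bdSub D j) =
      (homologyMk C i).rTensor (cycleSub D j) ∘ₗ (bdSub D j).subtype.lTensor (cycleSub C i) :=
    TensorProduct.ext' fun a b => rfl
  refine (LinearMap.congr_fun e4 y).trans ?_
  refine (congrArg ((homologyMk C i).rTensor (cycleSub D j)) hv).trans ?_
  rw [← LinearMap.comp_apply, ← LinearMap.rTensor_comp,
    (exact_toCycleSub_homologyMk C i).linearMap_comp_eq_zero, LinearMap.rTensor_zero,
    LinearMap.zero_apply]

-- The element `y` is unique, because Zᵢ ⊗ Bⱼ embeds into Cᵢ ⊗ Bⱼ, so its class depends linearly on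
-- the cycle.
variable (C D) in
lemma exists_torMap {n i j : ℕ} (h : i + j + 1 = n) :
    ∃ g : cycleSub (HomologicalComplex.tensorObj C D) n →ₗ[K] torKer C D i j,
      ∀ (t : cycleSub (HomologicalComplex.tensorObj C D) n) (y : cycleSub C i ⊗[K] bdSub D j),
        (cycleSub C i).subtype.rTensor (bdSub D j) y =
          (toBdSub D j).lTensor (C.X i) (tensorπ C D (i := i) (j := j + 1) h t) →
        (g t : (C.homology i : ModuleCat.{u} K) ⊗[K] bdSub D j) =
          (homologyMk C i).rTensor (bdSub D j) y := by
  let m := (cycleSub C i).subtype.rTensor (bdSub D j)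
  let e := LinearEquiv.ofInjective m (rTensor_cycleSub_injective i (bdSub D j))
  let q : cycleSub (HomologicalComplex.tensorObj C D) n →ₗ[K]
      (C.X i : ModuleCat.{u} K) ⊗[K] bdSub D j :=
    (toBdSub D j).lTensor (C.X i) ∘ₗ tensorπ C D (i := i) (j := j + 1) h ∘ₗ
      (cycleSub (HomologicalComplex.tensorObj C D) n).subtype
  let y := e.symm.toLinearMap ∘ₗ q.codRestrict _ (lTensor_toBdSub_mem h)
  have hy : ∀ t, m (y t) = q t := fun t =>
    congrArg Subtype.val (e.apply_symm_apply (q.codRestrict _ (lTensor_toBdSub_mem h) t))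
  refine ⟨((homologyMk C i).rTensor (bdSub D j) ∘ₗ y).codRestrict _
    fun t => lTensor_bdSub_eq h t (y t) (hy t), fun t z hz => ?_⟩
  have : y t = z := rTensor_cycleSub_injective i (bdSub D j) ((hy t).trans hz.symm)
  rw [← this]
  rfl

variable (C D) in
/-- The map from the cycles of the tensor product to the torsion modules. -/
def torMap {n i j : ℕ} (h : i + j + 1 = n) :
    cycleSub (HomologicalComplex.tensorObj C D) n →ₗ[K] torKer C D i j :=
  (exists_torMap C D h).choose

lemma torMap_eq {n i j : ℕ} (h : i + j + 1 = n)
    (t : cycleSub (HomologicalComplex.tensorObj C D) n) (y : cycleSub C i ⊗[K] bdSub D j)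
    (hy : (cycleSub C i).subtype.rTensor (bdSub D j) y =
      (toBdSub D j).lTensor (C.X i) (tensorπ C D (i := i) (j := j + 1) h t)) :
    (torMap C D h t : (C.homology i : ModuleCat.{u} K) ⊗[K] bdSub D j) =
      (homologyMk C i).rTensor (bdSub D j) y :=
  (exists_torMap C D h).choose_spec t y hy

end Kunneth

/-! ### Kernel and image of the torsion map. -/

section Kunneth

variable {K : Type u} [CommRing K] [IsDomain K] [IsPrincipalIdealRing K]
  {C D : ChainComplex (ModuleCat.{u} K) ℕ}
  [∀ n, Module.Projective K (C.X n)] [∀ n, Module.Projective K (D.X n)]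

lemma rTensor_toBdSub_lTensor (i j : ℕ)
    (z : (C.X (i + 1) : ModuleCat.{u} K) ⊗[K] (D.X (j + 1) : ModuleCat.{u} K)) :
    (toBdSub D j).lTensor (C.X i) ((C.d (i + 1) i).hom.rTensor (D.X (j + 1)) z) =
      (cycleSub C i).subtype.rTensor (bdSub D j) ((toCycleSub C i).rTensor (bdSub D j)
        ((toBdSub D j).lTensor (C.X (i + 1)) z)) := by
  have e : (toBdSub D j).lTensor (C.X i) ∘ₗ (C.d (i + 1) i).hom.rTensor (D.X (j + 1)) =
      (cycleSub C i).subtype.rTensor (bdSub D j) ∘ₗ (toCycleSub C i).rTensor (bdSub D j) ∘ₗ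
        (toBdSub D j).lTensor (C.X (i + 1)) := TensorProduct.ext' fun a b => rfl
  exact LinearMap.congr_fun e z

lemma rTensor_homologyMk_toCycleSub (i : ℕ) (M : Type u) [AddCommGroup M] [Module K M]
    (w : (C.X (i + 1) : ModuleCat.{u} K) ⊗[K] M) :
    (homologyMk C i).rTensor M ((toCycleSub C i).rTensor M w) = 0 := by
  rw [← LinearMap.comp_apply, ← LinearMap.rTensor_comp,
    (exact_toCycleSub_homologyMk C i).linearMap_comp_eq_zero, LinearMap.rTensor_zero,
    LinearMap.zero_apply]

lemma lTensor_toBdSub_d (i j : ℕ)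
    (z : (C.X i : ModuleCat.{u} K) ⊗[K] (D.X (j + 2) : ModuleCat.{u} K)) :
    (toBdSub D j).lTensor (C.X i) ((D.d (j + 2) (j + 1)).hom.lTensor (C.X i) z) = 0 := by
  rw [← LinearMap.comp_apply, ← LinearMap.lTensor_comp, toBdSub_comp_d, LinearMap.lTensor_zero,
    LinearMap.zero_apply]

lemma lTensor_toBdSub_cycleSub (i j : ℕ)
    (z : (C.X i : ModuleCat.{u} K) ⊗[K] cycleSub D (j + 1)) :
    (toBdSub D j).lTensor (C.X i) ((cycleSub D (j + 1)).subtype.lTensor (C.X i) z) = 0 := by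
  rw [← LinearMap.comp_apply, ← LinearMap.lTensor_comp,
    (exact_cycleSub_toBdSub D j).linearMap_comp_eq_zero, LinearMap.lTensor_zero,
    LinearMap.zero_apply]

/-- Of the two terms of the boundary, 1 ⊗ ∂ is killed by a second 1 ⊗ ∂, and the other becomes ∂ ⊗ ∂
of the component of bidegree (i + 1, j + 1). Such elements vanish in Hᵢ ⊗ Bⱼ, so the torsion map
kills boundaries. -/
lemma lTensor_toBdSub_tensorπ_d {n i j : ℕ} (h : i + j + 1 = n)
    (h' : (i + 1) + (j + 1) = n + 1) (s : (HomologicalComplex.tensorObj C D).X (n + 1)) :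
    (toBdSub D j).lTensor (C.X i) (tensorπ C D (i := i) (j := j + 1) h
      (((HomologicalComplex.tensorObj C D).d (n + 1) n).hom s)) =
      (cycleSub C i).subtype.rTensor (bdSub D j) ((toCycleSub C i).rTensor (bdSub D j)
        ((toBdSub D j).lTensor (C.X (i + 1)) (tensorπ C D h' s))) := by
  rw [tensorπ_d s (k := i) (l := j + 1) h h' (by omega), map_add, map_smul,
    rTensor_toBdSub_lTensor]
  refine (congrArg (fun z => _ + (-1 : K) ^ i • z) (lTensor_toBdSub_d i j _)).trans ?_
  rw [smul_zero, add_zero]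

lemma torMap_of_mem_bdSub {n i j : ℕ} (h : i + j + 1 = n)
    (t : cycleSub (HomologicalComplex.tensorObj C D) n)
    (ht : t.1 ∈ boundarySub (HomologicalComplex.tensorObj C D) n) : torMap C D h t = 0 := by
  obtain ⟨s, hs⟩ := ht
  refine Subtype.ext ?_
  rw [torMap_eq h t _ ((lTensor_toBdSub_tensorπ_d h (by omega) s).symm.trans
    (congrArg (fun x => (toBdSub D j).lTensor (C.X i)
      (tensorπ C D (i := i) (j := j + 1) h x)) hs))]
  exact rTensor_homologyMk_toCycleSub _ _ _

lemma torMap_eq_zero {n i j : ℕ} (h : i + j + 1 = n)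
    (t : cycleSub (HomologicalComplex.tensorObj C D) n)
    (ht : (toBdSub D j).lTensor (C.X i) (tensorπ C D (i := i) (j := j + 1) h t) = 0) :
    torMap C D h t = 0 :=
  Subtype.ext ((torMap_eq h t 0 ((map_zero _).trans ht.symm)).trans (map_zero _))

lemma torMap_cycleProd {n i j k l : ℕ} (h : i + j + 1 = n) (h' : k + l = n)
    (u : cycleSub C k ⊗[K] cycleSub D l) : torMap C D h (cycleProd C D k l n u) = 0 := by
  refine torMap_eq_zero h _ ?_
  by_cases hk : i = k
  · subst hk
    obtain rfl : l = j + 1 := by omega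
    have e : TensorProduct.map (cycleSub C i).subtype (cycleSub D (j + 1)).subtype =
        (cycleSub D (j + 1)).subtype.lTensor (C.X i) ∘ₗ
          (cycleSub C i).subtype.rTensor (cycleSub D (j + 1)) :=
      TensorProduct.ext' fun a b => rfl
    refine (congrArg ((toBdSub D j).lTensor (C.X i)) ((tensorπ_ι_self (i := i) (j := j + 1) h _).trans
      (LinearMap.congr_fun e u))).trans ?_
    exact lTensor_toBdSub_cycleSub i j _
  · rw [tensorπ_cycleProd_ne (k := i) (l := j + 1) h hk, map_zero]

lemma mem_range_map_cycleSub {i j : ℕ} (t : (C.X i : ModuleCat.{u} K) ⊗[K] D.X j)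
    (h₁ : (C.d i (i - 1)).hom.rTensor (D.X j) t = 0)
    (h₂ : (D.d j (j - 1)).hom.lTensor (C.X i) t = 0) :
    ∃ u, TensorProduct.map (cycleSub C i).subtype (cycleSub D j).subtype u = t := by
  obtain ⟨v, rfl⟩ := (Module.Flat.lTensor_exact (C.X i) (exact_cycleSub_d D j) t).1 h₂
  have h₃ : (C.d i (i - 1)).hom.rTensor (cycleSub D j) v = 0 := by
    refine Module.Flat.lTensor_preserves_injective_linearMap (M := C.X (i - 1))
      (cycleSub D j).subtype Subtype.val_injective ?_
    rw [map_zero, ← h₁]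
    have e : (cycleSub D j).subtype.lTensor (C.X (i - 1)) ∘ₗ
        (C.d i (i - 1)).hom.rTensor (cycleSub D j) =
        (C.d i (i - 1)).hom.rTensor (D.X j) ∘ₗ (cycleSub D j).subtype.lTensor (C.X i) :=
      TensorProduct.ext' fun a b => rfl
    exact LinearMap.congr_fun e v
  obtain ⟨u, rfl⟩ := (Module.Flat.rTensor_exact (cycleSub D j) (exact_cycleSub_d C i) v).1 h₃
  refine ⟨u, ?_⟩
  have e : TensorProduct.map (cycleSub C i).subtype (cycleSub D j).subtype =
      (cycleSub D j).subtype.lTensor (C.X i) ∘ₗ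
        (cycleSub C i).subtype.rTensor (cycleSub D j) := TensorProduct.ext' fun a b => rfl
  exact LinearMap.congr_fun e u

/-- If 1 ⊗ ∂ kills all components, the cycle equation shows that ∂ ⊗ 1 does as well, so every
component lies in the tensor product of the cycles. -/
lemma exists_cycleProd_of_toBdSub_eq_zero {n : ℕ}
    (t : cycleSub (HomologicalComplex.tensorObj C D) n)
    (ht : ∀ i j (h : i + j + 1 = n),
      (toBdSub D j).lTensor (C.X i) (tensorπ C D (i := i) (j := j + 1) h t) = 0)
    {a b : ℕ} (h : a + b = n) :
    ∃ u, TensorProduct.map (cycleSub C a).subtype (cycleSub D b).subtype u =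
      tensorπ C D h t := by
  have h0 : ∀ i j (h : i + j = n), (D.d j (j - 1)).hom.lTensor (C.X i)
      (tensorπ C D h t) = 0 := by
    intro i j h
    cases j with
    | zero =>
      rw [D.shape 0 (0 - 1) (by simp), ModuleCat.hom_zero, LinearMap.lTensor_zero,
        LinearMap.zero_apply]
    | succ j =>
      have e : (D.d (j + 1) j).hom.lTensor (C.X i) =
        ((cycleSub D j).subtype ∘ₗ (bdSub D j).subtype).lTensor (C.X i) ∘ₗ
          (toBdSub D j).lTensor (C.X i) := TensorProduct.ext' fun a b => rfl
      refine (LinearMap.congr_fun e _).trans ?_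
      exact (congrArg (((cycleSub D j).subtype ∘ₗ (bdSub D j).subtype).lTensor (C.X i))
        (ht i j h)).trans (map_zero _)
  refine mem_range_map_cycleSub _ ?_ (h0 a b h)
  cases a with
  | zero =>
    rw [C.shape 0 (0 - 1) (by simp), ModuleCat.hom_zero, LinearMap.rTensor_zero,
      LinearMap.zero_apply]
  | succ k =>
    obtain rfl : n = k + b + 1 := by omega
    refine (rTensor_d_tensorπ (n := k + b) t rfl h (by omega)).trans ?_
    have := h0 k (b + 1) (by omega)
    rw [neg_eq_zero]
    exact (congrArg (fun z => (-1 : K) ^ k • z) this).trans (smul_zero _)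

-- The summands are independent, so one chain can correct all bidegrees at once; components with an
-- index zero are set to zero.
variable (C D) in
lemma exists_tensorπ_succ_eq {n : ℕ} (z : ∀ i j, i + j + 1 = n →
    (C.X (i + 1) : ModuleCat.{u} K) ⊗[K] (D.X (j + 1) : ModuleCat.{u} K)) :
    ∃ s : (HomologicalComplex.tensorObj C D).X (n + 1), ∀ i j (h : i + j + 1 = n)
      (h' : (i + 1) + (j + 1) = n + 1), tensorπ C D h' s = z i j h := by
  let f : ∀ p : {p : ℕ × ℕ // p.1 + p.2 = n + 1},
    (C.X p.1.1 : ModuleCat.{u} K) ⊗[K] D.X p.1.2 := fun p => match p with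
    | ⟨(i + 1, j + 1), h⟩ => z i j (by simp only at h; omega)
    | ⟨(0, _), _⟩ => 0
    | ⟨(_ + 1, 0), _⟩ => 0
  refine ⟨(tensorEquiv C D (n + 1)).symm f, fun i j h h' => ?_⟩
  exact congrFun ((tensorEquiv C D (n + 1)).apply_symm_apply f) ⟨(i + 1, j + 1), h'⟩

/-- A vanishing torsion class means that (1 ⊗ ∂)t comes from Cᵢ₊₁ ⊗ Dⱼ₊₁ through ∂ ⊗ ∂. Subtracting
the boundary of the chain assembled from these elements leaves a cycle killed by 1 ⊗ ∂, which is a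
sum of products of cycles. -/
lemma exists_eq_of_torMap_eq_zero {n : ℕ} (t : cycleSub (HomologicalComplex.tensorObj C D) n)
    (ht : ∀ i j (h : i + j + 1 = n), torMap C D h t = 0) :
    ∃ u : ∀ p : {p : ℕ × ℕ // p.1 + p.2 = n}, cycleSub C p.1.1 ⊗[K] cycleSub D p.1.2,
      homologyMk _ n t = ∑ p, homologyMk _ n (cycleProd C D p.1.1 p.1.2 n (u p)) := by
  have h1 : ∀ i j (h : i + j + 1 = n),
      ∃ z : (C.X (i + 1) : ModuleCat.{u} K) ⊗[K] (D.X (j + 1) : ModuleCat.{u} K),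
      (toBdSub D j).lTensor (C.X i) (tensorπ C D (i := i) (j := j + 1) h t) =
      (cycleSub C i).subtype.rTensor (bdSub D j) ((toCycleSub C i).rTensor (bdSub D j)
        ((toBdSub D j).lTensor (C.X (i + 1)) z)) := by
    intro i j h
    obtain ⟨y, hy⟩ := lTensor_toBdSub_mem h t
    have h2 : (homologyMk C i).rTensor (bdSub D j) y = 0 := by
      rw [← torMap_eq h t y hy, ht]
      rfl
    obtain ⟨w, rfl⟩ := (rTensor_exact (bdSub D j) (exact_toCycleSub_homologyMk C i)
      (homologyMk_surjective C i) y).1 h2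
    obtain ⟨z, rfl⟩ := LinearMap.lTensor_surjective (C.X (i + 1)) (toBdSub_surjective D j) w
    exact ⟨z, hy.symm⟩
  choose z hz using h1
  obtain ⟨s, hs⟩ := exists_tensorπ_succ_eq C D z
  let b : cycleSub (HomologicalComplex.tensorObj C D) n :=
    toCycleSub (HomologicalComplex.tensorObj C D) n s
  have h3 : ∀ i j (h : i + j + 1 = n), (toBdSub D j).lTensor (C.X i)
      (tensorπ C D (i := i) (j := j + 1) h (t - b : cycleSub _ n)) = 0 := by
    intro i j h
    rw [Submodule.coe_sub, map_sub, map_sub, hz i j h, sub_eq_zero]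
    refine Eq.trans ?_ (lTensor_toBdSub_tensorπ_d h (by omega) s).symm
    rw [hs i j h]
  have h4 := fun p : {p : ℕ × ℕ // p.1 + p.2 = n} =>
    exists_cycleProd_of_toBdSub_eq_zero (t - b) h3 p.2
  choose u hu using h4
  refine ⟨u, ?_⟩
  have h5 : t - b = ∑ p, cycleProd C D p.1.1 p.1.2 n (u p) := by
    refine Subtype.ext ?_
    rw [← sum_tensorι_tensorπ (t - b).1, Submodule.coe_sum]
    exact Finset.sum_congr rfl fun p _ => congrArg (tensorι C D p.1.1 p.1.2 n) (hu p).symm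
  have h6 : homologyMk (HomologicalComplex.tensorObj C D) n b = 0 :=
    (exact_toCycleSub_homologyMk (HomologicalComplex.tensorObj C D) n).apply_apply_eq_zero s
  rw [← map_sum, ← h5, map_sub, h6, sub_zero]

/-- The class `x` is lifted to `y` in Zᵢ ⊗ Bⱼ and then to `s` in Zᵢ ⊗ Dⱼ₊₁. Since `x` dies in Hᵢ ⊗
Zⱼ, the image of `y` in Zᵢ ⊗ Zⱼ also comes from some `v` in Cᵢ₊₁ ⊗ Zⱼ, and `s` and `v` combine to a
cycle. -/
lemma exists_torMap_eq {i j : ℕ} (x : torKer C D i j) :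
    ∃ t : cycleSub (HomologicalComplex.tensorObj C D) (i + j + 1),
      torMap C D rfl t = x ∧
      ∀ k l (h : k + l + 1 = i + j + 1), k ≠ i → torMap C D h t = 0 := by
  obtain ⟨y, hy⟩ := LinearMap.rTensor_surjective (bdSub D j) (homologyMk_surjective C i) x.1
  obtain ⟨s, hs⟩ := LinearMap.lTensor_surjective (cycleSub C i) (toBdSub_surjective D j) y
  have h1 : (homologyMk C i).rTensor (cycleSub D j)
      ((bdSub D j).subtype.lTensor (cycleSub C i) y) = 0 := by
    have e4 : (homologyMk C i).rTensor (cycleSub D j) ∘ₗ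
        (bdSub D j).subtype.lTensor (cycleSub C i) =
        (bdSub D j).subtype.lTensor (C.homology i : ModuleCat.{u} K) ∘ₗ
        (homologyMk C i).rTensor (bdSub D j) :=
      TensorProduct.ext' fun a b => rfl
    refine (LinearMap.congr_fun e4 y).trans ?_
    exact (congrArg ((bdSub D j).subtype.lTensor (C.homology i : ModuleCat.{u} K)) hy).trans x.2
  obtain ⟨v, hv⟩ := (rTensor_exact (cycleSub D j) (exact_toCycleSub_homologyMk C i)
      (homologyMk_surjective C i) _).1 h1
  have hsv : (toCycleSub D j).lTensor (cycleSub C i) s =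
      (toCycleSub C i).rTensor (cycleSub D j) v := by
    rw [hv, ← hs]
    have e : (toCycleSub D j).lTensor (cycleSub C i) =
        (bdSub D j).subtype.lTensor (cycleSub C i) ∘ₗ (toBdSub D j).lTensor (cycleSub C i) :=
      TensorProduct.ext' fun a b => rfl
    exact LinearMap.congr_fun e s
  let t₁ := tensorι C D i (j + 1) (i + j + 1) ((cycleSub C i).subtype.rTensor _ s)
  let t₂ := tensorι C D (i + 1) j (i + j + 1) ((cycleSub D j).subtype.lTensor _ v)
  -- The factor (-1)ⁱ compensates the Koszul sign in the boundary of `t₁`.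
  let t : cycleSub (HomologicalComplex.tensorObj C D) (i + j + 1) :=
    ⟨t₁ - (-1 : K) ^ i • t₂, by
      rw [LinearMap.mem_ker, map_sub, map_smul, sub_eq_zero]
      refine (d_tensorι_subtype_left rfl s).trans ?_
      refine Eq.trans ?_ (congrArg (fun z => (-1 : K) ^ i • z)
        (d_tensorι_subtype_right rfl v)).symm
      rw [hsv]⟩
  -- The second factor of `t₂` consists of cycles, so `t₂` contributes to no torsion component.
  have ht₂ : ∀ k l (h : k + l + 1 = i + j + 1),
      (toBdSub D l).lTensor (C.X k) (tensorπ C D (i := k) (j := l + 1) h t₂) = 0 := by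
    intro k l h
    by_cases hk : k = i + 1
    · subst hk
      obtain rfl : j = l + 1 := by omega
      refine (congrArg ((toBdSub D l).lTensor (C.X (i + 1)))
        (tensorπ_ι_self (i := i + 1) (j := l + 1) h _)).trans ?_
      exact lTensor_toBdSub_cycleSub (i + 1) l v
    · exact (congrArg ((toBdSub D l).lTensor (C.X k))
        (tensorπ_ι_ne (k := k) (l := l + 1) h hk _)).trans (map_zero _)
  have ht : ∀ k l (h : k + l + 1 = i + j + 1),
      (toBdSub D l).lTensor (C.X k) (tensorπ C D (i := k) (j := l + 1) h t) =
      (toBdSub D l).lTensor (C.X k) (tensorπ C D (i := k) (j := l + 1) h t₁) := by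
    intro k l h
    change (toBdSub D l).lTensor (C.X k)
      (tensorπ C D (i := k) (j := l + 1) h (t₁ - (-1 : K) ^ i • t₂)) = _
    rw [map_sub, map_sub, map_smul, map_smul, ht₂ k l h, smul_zero, sub_zero]
  refine ⟨t, Subtype.ext ?_, fun k l h hk => torMap_eq_zero h t ?_⟩
  · rw [torMap_eq rfl t y, hy]
    rw [ht i j rfl, ← hs]
    have e : (cycleSub C i).subtype.rTensor (bdSub D j) ∘ₗ
        (toBdSub D j).lTensor (cycleSub C i) =
        (toBdSub D j).lTensor (C.X i) ∘ₗ (cycleSub C i).subtype.rTensor (D.X (j + 1)) :=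
      TensorProduct.ext' fun a b => rfl
    refine (LinearMap.congr_fun e s).trans ?_
    exact congrArg ((toBdSub D j).lTensor (C.X i)) (tensorπ_ι_self rfl _).symm
  · rw [ht k l h]
    exact (congrArg ((toBdSub D l).lTensor (C.X k))
        (tensorπ_ι_ne (k := k) (l := l + 1) h hk _)).trans (map_zero _)

end Kunneth

/-- The condition stands for i + j = n - 1 without truncated subtraction and leaves no torsion term
for `n = 0`. -/
instance antidiagonalPredFinite (n : ℕ) : Finite {p : ℕ × ℕ // p.1 + p.2 + 1 = n} :=
  Finite.of_injective (β := Fin (n + 1) × Fin (n + 1))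
    (fun p => (⟨p.1.1, by have := p.2; omega⟩, ⟨p.1.2, by have := p.2; omega⟩))
    fun p q h => Subtype.ext (Prod.ext (congrArg (fun x => (x.1 : ℕ)) h)
      (congrArg (fun x => (x.2 : ℕ)) h))

/-! ### The Künneth exact sequence. -/

section Kunneth

variable {K : Type u} [CommRing K] [IsDomain K] [IsPrincipalIdealRing K]
  (C D : ChainComplex (ModuleCat.{u} K) ℕ)
  [∀ n, Module.Projective K (C.X n)] [∀ n, Module.Projective K (D.X n)]

/-- The cross product `⨁ Hᵢ(C) ⊗ Hⱼ(D) → Hₙ(C ⊗ D)`. -/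
def totalCross (n : ℕ) : (DirectSum {p : ℕ × ℕ // p.1 + p.2 = n} fun p =>
    (C.homology p.1.1 : ModuleCat.{u} K) ⊗[K] (D.homology p.1.2 : ModuleCat.{u} K)) →ₗ[K]
      ((HomologicalComplex.tensorObj C D).homology n : ModuleCat.{u} K) :=
  DirectSum.toModule K _ _ fun p => homologyCross C D p.1.1 p.1.2 n

variable {C D}

lemma exists_map_homologyMk_eq {n : ℕ} (e : DirectSum {p : ℕ × ℕ // p.1 + p.2 = n} fun p =>
    (C.homology p.1.1 : ModuleCat.{u} K) ⊗[K] (D.homology p.1.2 : ModuleCat.{u} K)) :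
    ∃ u : ∀ p : {p : ℕ × ℕ // p.1 + p.2 = n}, cycleSub C p.1.1 ⊗[K] cycleSub D p.1.2,
      (∀ p, TensorProduct.map (homologyMk C p.1.1) (homologyMk D p.1.2) (u p) = e p) ∧
      totalCross C D n e = homologyMk _ n (∑ p, cycleProd C D p.1.1 p.1.2 n (u p)) := by
  choose u hu using fun p : {p : ℕ × ℕ // p.1 + p.2 = n} =>
    TensorProduct.map_surjective (homologyMk_surjective C p.1.1)
      (homologyMk_surjective D p.1.2) (e p)
  refine ⟨u, hu, ?_⟩
  rw [map_sum]
  conv_lhs => rw [← DirectSum.sum_univ_of e, map_sum]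
  refine Finset.sum_congr rfl fun p _ => ?_
  refine Eq.trans (b := homologyCross C D p.1.1 p.1.2 n (e p)) (by
    exact DirectSum.toModule_lof K (M := fun p : {p : ℕ × ℕ // p.1 + p.2 = n} =>
      (C.homology p.1.1 : ModuleCat.{u} K) ⊗[K] (D.homology p.1.2 : ModuleCat.{u} K)) p (e p)) ?_
  rw [← hu p]
  exact homologyCross_map p.1.1 p.1.2 n (u p)

/-- If a sum of products of cycles is a boundary, `crossRetr` at `p` kills it and at the same time
returns its component at `p`. -/
lemma totalCross_injective (n : ℕ) : Function.Injective (totalCross C D n) := by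
  rw [injective_iff_map_eq_zero]
  intro e he
  obtain ⟨u, hu, h⟩ := exists_map_homologyMk_eq e
  rw [he] at h
  obtain ⟨s, hs⟩ := (homologyMk_eq_zero_iff _ n _).1 h.symm
  refine DFinsupp.ext fun p => ?_
  have h1 := crossRetr_d p.2 s
  rw [hs, Submodule.coe_sum, map_sum, Finset.sum_eq_single p] at h1
  · rw [crossRetr_cycleProd_self p.2, hu] at h1
    exact h1
  · intro q _ hq
    refine crossRetr_cycleProd_ne p.2 (fun h => hq ?_) (u q)
    have h2 := p.2
    have h3 := q.2
    exact Subtype.ext (Prod.ext h.symm (by omega))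
  · exact fun hp => absurd (Finset.mem_univ p) hp

variable (C D) in
lemma exists_totalTorMap (n : ℕ) :
    ∃ g : ((HomologicalComplex.tensorObj C D).homology n : ModuleCat.{u} K) →ₗ[K]
      (∀ p : {p : ℕ × ℕ // p.1 + p.2 + 1 = n}, torKer C D p.1.1 p.1.2),
      ∀ t p, g (homologyMk _ n t) p = torMap C D p.2 t := by
  obtain ⟨g, hg⟩ := LinearMap.exists_comp_eq_of_ker_le
    (homologyMk (HomologicalComplex.tensorObj C D) n) (homologyMk_surjective _ n)
    (LinearMap.pi fun p : {p : ℕ × ℕ // p.1 + p.2 + 1 = n} => torMap C D p.2) (fun t ht =>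
      funext fun p => torMap_of_mem_bdSub p.2 t ((homologyMk_eq_zero_iff _ n t).1 ht))
  exact ⟨g, fun t p => congrFun (LinearMap.congr_fun hg t) p⟩

variable (C D) in
/-- The algebraic Künneth formula for complexes of projective modules over a principal ideal
domain. -/
theorem kunneth (n : ℕ) :
    ∃ (f : (DirectSum {p : ℕ × ℕ // p.1 + p.2 = n} fun p =>
          (C.homology p.1.1 : ModuleCat.{u} K) ⊗[K] (D.homology p.1.2 : ModuleCat.{u} K)) →ₗ[K]
          ((HomologicalComplex.tensorObj C D).homology n : ModuleCat.{u} K))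
      (g : ((HomologicalComplex.tensorObj C D).homology n : ModuleCat.{u} K) →ₗ[K]
        (DirectSum {p : ℕ × ℕ // p.1 + p.2 + 1 = n} fun p =>
          (((CategoryTheory.Tor (ModuleCat.{u} K) 1).obj (C.homology p.1.1)).obj
            (D.homology p.1.2) : ModuleCat.{u} K))),
      Function.Injective f ∧ Function.Exact f g ∧ Function.Surjective g := by
  obtain ⟨g, hg⟩ := exists_totalTorMap C D n
  have hexact : Function.Exact (totalCross C D n) g := by
    intro x
    obtain ⟨t, rfl⟩ := homologyMk_surjective _ n x
    constructor
    · intro hx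
      obtain ⟨u, hu⟩ := exists_eq_of_torMap_eq_zero t fun i j h => by
        rw [← hg t ⟨(i, j), h⟩, hx]
        rfl
      refine ⟨∑ p, DirectSum.lof K _ _ p
        (TensorProduct.map (homologyMk C p.1.1) (homologyMk D p.1.2) (u p)), ?_⟩
      rw [hu, map_sum]
      exact Finset.sum_congr rfl fun p _ =>
        (DirectSum.toModule_lof K p _).trans (homologyCross_map p.1.1 p.1.2 n (u p))
    · rintro ⟨e, he⟩
      obtain ⟨u, -, h⟩ := exists_map_homologyMk_eq e
      rw [← he, h]
      refine funext fun p => ?_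
      rw [hg, map_sum]
      exact Finset.sum_eq_zero fun q _ => torMap_cycleProd p.2 q.2 (u q)
  have : Fintype {p : ℕ × ℕ // p.1 + p.2 + 1 = n} := Fintype.ofFinite _
  have hsurj : Function.Surjective g := by
    intro x
    -- Each torsion summand is hit separately by a cycle whose other torsion components vanish.
    have h1 : ∀ p : {p : ℕ × ℕ // p.1 + p.2 + 1 = n}, ∃ y, g y = Pi.single p (x p) := by
      rintro ⟨⟨i, j⟩, rfl⟩
      obtain ⟨t, ht, ht'⟩ := exists_torMap_eq (x ⟨(i, j), rfl⟩)
      refine ⟨homologyMk _ _ t, funext fun q => ?_⟩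
      rw [hg]
      by_cases hq : q = ⟨(i, j), rfl⟩
      · subst hq
        rw [Pi.single_eq_same]
        exact ht
      · rw [Pi.single_eq_of_ne hq]
        refine ht' _ _ q.2 fun h => hq ?_
        have h2 := q.2
        exact Subtype.ext (Prod.ext h (by dsimp only at h h2 ⊢; omega))
    choose y hy using h1
    exact ⟨∑ p, y p, by rw [map_sum, Finset.sum_congr rfl fun p _ => hy p, Finset.univ_sum_single]⟩
  -- The kernels computed so far are replaced by Tor, and the finite product by the direct sum.
  let e := (LinearEquiv.piCongrRight fun p : {p : ℕ × ℕ // p.1 + p.2 + 1 = n} =>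
    (nonempty_torEquivKer C D p.1.1 p.1.2).some.symm) ≪≫ₗ
    (DirectSum.linearEquivFunOnFintype K {p : ℕ × ℕ // p.1 + p.2 + 1 = n} _).symm
  refine ⟨totalCross C D n, e.toLinearMap ∘ₗ g, totalCross_injective n, fun x => ?_,
    e.surjective.comp hsurj⟩
  rw [← hexact x]
  exact e.map_eq_zero_iff

variable (C D) in
/-- The Künneth formula for a complex isomorphic to a tensor product. -/
theorem kunneth_of_iso {E : ChainComplex (ModuleCat.{u} K) ℕ}
    (φ : HomologicalComplex.tensorObj C D ≅ E) (n : ℕ) :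
    ∃ (f : (DirectSum {p : ℕ × ℕ // p.1 + p.2 = n} fun p =>
          (C.homology p.1.1 : ModuleCat.{u} K) ⊗[K] (D.homology p.1.2 : ModuleCat.{u} K)) →ₗ[K]
          (E.homology n : ModuleCat.{u} K))
      (g : (E.homology n : ModuleCat.{u} K) →ₗ[K]
        (DirectSum {p : ℕ × ℕ // p.1 + p.2 + 1 = n} fun p =>
          (((CategoryTheory.Tor (ModuleCat.{u} K) 1).obj (C.homology p.1.1)).obj
            (D.homology p.1.2) : ModuleCat.{u} K))),
      Function.Injective f ∧ Function.Exact f g ∧ Function.Surjective g := by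
  obtain ⟨f, g, hf, hfg, hg⟩ := kunneth C D n
  let e := ((HomologicalComplex.homologyFunctor (ModuleCat.{u} K) _ n).mapIso φ).toLinearEquiv
  refine ⟨e.toLinearMap ∘ₗ f, g ∘ₗ e.symm.toLinearMap, e.injective.comp hf, fun x => ?_,
    hg.comp e.symm.surjective⟩
  refine (hfg (e.symm x)).trans ?_
  exact ⟨fun ⟨y, hy⟩ => ⟨y, (congrArg e hy).trans (e.apply_symm_apply x)⟩,
    fun ⟨y, hy⟩ => ⟨y, by rw [← hy]; exact (e.symm_apply_apply (f y)).symm⟩⟩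

end Kunneth

instance (K : Type u) [CommRing K] [IsDomain K] [IsPrincipalIdealRing K] {X : SSet.{u}}
    (Y : ∀ n : ℕ, Set (X _⦋n⦌)) (n : ℕ) : Module.Projective K ((omegaChains K Y).X n) :=
  Module.Projective.submodule_of_isPrincipalIdealRing
    (omegaSubmodule (normalizedChains K X) (fun n => clsSpan K (Y n)) n)

end

theorem mainTheorem7 (K : Type u) [CommRing K] [IsDomain K] [IsPrincipalIdealRing K] :
    (∀ S S' : SetPathPair.{u},
      Nonempty ((S.box S').Omega K ≅
        HomologicalComplex.tensorObj (S.Omega K) (S'.Omega K)) ∧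
      ∀ n : ℕ,
        ∃ (f : (DirectSum {p : ℕ × ℕ // p.1 + p.2 = n} fun p =>
              ((S.Omega K).homology p.1.1 : ModuleCat.{u} K) ⊗[K]
                ((S'.Omega K).homology p.1.2 : ModuleCat.{u} K)) →ₗ[K]
              (((S.box S').Omega K).homology n : ModuleCat.{u} K))
          (g : (((S.box S').Omega K).homology n : ModuleCat.{u} K) →ₗ[K]
            (DirectSum {p : ℕ × ℕ // p.1 + p.2 + 1 = n} fun p =>
              (((CategoryTheory.Tor (ModuleCat.{u} K) 1).obj ((S.Omega K).homology p.1.1)).obj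
                ((S'.Omega K).homology p.1.2) : ModuleCat.{u} K))),
          Function.Injective f ∧ Function.Exact f g ∧ Function.Surjective g) ∧
    (∀ (V V' : Type u) (P : RegularPathComplex V) (P' : RegularPathComplex V'),
      Nonempty ((P.box P').Omega K ≅
        HomologicalComplex.tensorObj (P.Omega K) (P'.Omega K))) := by
  refine ⟨fun S S' => ⟨?_, fun n => ?_⟩, fun V V' P P' => ?_⟩
  · rw [SetPathPair.Omega_eq K S, SetPathPair.Omega_eq K S', SetPathPair.Omega_eq]
    exact ⟨(shuffleIso K S S').symm⟩
  · rw [SetPathPair.Omega_eq K S, SetPathPair.Omega_eq K S', SetPathPair.Omega_eq]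
    exact kunneth_of_iso _ _ (shuffleIso K S S') n
  -- The complexes of `P` and `P'` equal those of their path pairs. The complex of the box product
  -- is only isomorphic to its counterpart, since cosk₀ (V × V') is isomorphic to the product of the
  -- two coskeleta.
  · rw [RegularPathComplex.Omega_eq K P, RegularPathComplex.Omega_eq K P']
    exact ⟨P.boxIso K P' ≪≫ (shuffleIso K P.toSetPathPair P'.toSetPathPair).symm⟩
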